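/- **Setting.** Let $\Pi\subseteq\widetilde\Pi$ be orthogonal projectors on $n$ qubits (the range of $\Pi$ is contained in that of $\widetilde\Pi\neq 0$), and let $|\psi\rangle$, on the $n$ system qubits and $r$ further qubits, be a purification of the state $\widetilde\Pi/\mathrm{rank}(\widetilde\Pi)$. A unitary $U$ on $n'+m$ qubits is a $(1,m,\chi)$ projected unitary encoding of an $n'$-qubit operator $A$, with orthogonal projectors $\Pi_L,\Pi_R$, if $\|A\otimes|0^m\rangle\langle 0^m|-\Pi_L U\Pi_R\|\le\chi$ in operator norm. For a projector $P$ let $\mathrm{C}_P\mathrm{NOT}=(I-P)\otimes I+P\otimes X$. We are given a $(1,m_1,\chi_\psi)$ projected unitary encoding $V_\psi$ of $|\psi\rangle\langle\bar 0|$ with projectors $\Pi_L^1,\Pi_R^1$, a $(1,m_2,\chi_\pi)$ projected unitary encoding $V_\Pi$ of $\Pi$ with projectors $\Pi_L^2,\Pi_R^2$, and, for $i=1,2$, unitary gates within operator-norm distance $\epsilon_L^i$, $\epsilon_R^i$ of $\mathrm{C}_{\Pi_L^i}\mathrm{NOT}$, $\mathrm{C}_{\Pi_R^i}\mathrm{NOT}$.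 (A unitary with $V_\psi|\bar 0\rangle=|\psi\rangle$ is the case $\chi_\psi=0$, $\Pi_L^1=I$, $\Pi_R^1=|\bar 0\rangle\langle\bar 0|$.) An estimation algorithm is a quantum circuit, started in the all-zero state and made of calls to $V_\psi$, $V_\Pi$, their inverses and the four given $\mathrm{C}_\Pi\mathrm{NOT}$ gates, and of arbitrary two-qubit gates (single-qubit gates included), which is run and measured a number of times independently, together with a classical function of the measurement outcomes. It does not depend on the given objects, only on the numbers of qubits, on the accuracy parameters and, in (b), on the error bounds. **Theorem (normalized projector rank estimation).** There are absolute constants $C>0$, $k\in\mathbb N$ such that for all $n,r,m_1,m_2$ and $\delta,\eta\in(0,1)$: (a) If $\chi_\psi=\chi_\pi=0$ and $\epsilon_L^i=\epsilon_R^i=0$ for $i=1,2$, then there is an algorithm that estimates $\sqrt{\mathrm{rank}(\Pi)/\mathrm{rank}(\widetilde\Pi)}$ to additive error $\delta$ with success probability at least $1-\eta$, using at most $C(1+\log(1/\eta))$ repetitions of a circuit that makes at most $C/\delta$ calls and uses at most $\frac{C}{\delta}(1+\log(1/\delta))^k$ additional two-qubit gates. (b) In general, let $0<\epsilon_f<1$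 and $$\epsilon:=\frac4\delta\log(\epsilon_f^{-1})\sqrt{2\chi_\psi+\chi_\pi+\sum_{i=1}^{2}(\epsilon_L^i+\epsilon_R^i)}+\epsilon_f ,$$ where $\chi_\psi,\chi_\pi,\epsilon_L^i,\epsilon_R^i\ge 0$, and suppose that $\epsilon<\frac12$. Then there is an algorithm that estimates $\sqrt{\mathrm{rank}(\Pi)/\mathrm{rank}(\widetilde\Pi)}$ to additive error $\delta$ with success probability at least $1-\eta$, using at most $C X(1+\log X)^k$ repetitions, where $$X=\frac{(1+\log(\delta^{-1}))(1+\log(\eta^{-1}))}{(1-\chi_\psi)^2(1-2\epsilon)^2},$$ of a circuit that makes at most $\frac C\delta\log(\epsilon_f^{-1})$ calls and uses at most $\frac C\delta\log(\epsilon_f^{-1})$ additional single- and two-qubit gates. -/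

import Mathlib

open scoped Matrix.Norms.L2Operator

namespace RankEst

/-! ### Qubit registers and operators on them -/

/-- Computational basis states of a register whose qubits (wires) are labelled by `α`. -/
abbrev Bits (α : Type) : Type := α → Bool

/-- Operators on the register with wires `α`, as matrices in the computational basis.
The norm on them is the operator norm induced by the Euclidean norm. -/
abbrev QOp (α : Type) : Type := Matrix (Bits α) (Bits α) ℂ

/-- State vectors of the register with wires `α`. -/
abbrev QVec (α : Type) : Type := Bits α → ℂ

/-- The state with all qubits equal to zero. -/
def ketZero (α : Type) [Fintype α] [DecidableEq α] : QVec α :=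
  Pi.single (fun _ => false) 1

/-- The rank-one operator `|ψ⟩⟨φ|`. -/
def ketBra {α : Type} (ψ φ : QVec α) : QOp α := Matrix.vecMulVec ψ (star φ)

/-- The tensor product of operators on two disjoint registers. -/
def tensor {α β : Type} (A : QOp α) (B : QOp β) : QOp (α ⊕ β) := fun x y =>
  A (fun i => x (Sum.inl i)) (fun i => y (Sum.inl i)) *
    B (fun j => x (Sum.inr j)) (fun j => y (Sum.inr j))

/-- The tensor product of state vectors on two disjoint registers. -/
def tensorVec {α β : Type} (v : QVec α) (w : QVec β) : QVec (α ⊕ β) := fun x =>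
  v (fun i => x (Sum.inl i)) * w (fun j => x (Sum.inr j))

/-- The Pauli operator `X` on a single qubit. -/
def pauliX : QOp Unit := fun x y => if x () = y () then 0 else 1

/-- `C_ΠNOT = (I - Π) ⊗ I + Π ⊗ X`. -/
def cProjNot {α : Type} [Fintype α] [DecidableEq α] (P : QOp α) : QOp (α ⊕ Unit) :=
  tensor (1 - P) 1 + tensor P pauliX

/-- The operator on all wires `W` that acts as `G` on the wires selected by `f`
and as the identity on the others. -/
noncomputable def applyOn {α W : Type} (f : α ↪ W) (G : QOp α) : QOp W := fun x y =>
  open Classical in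
  if ∀ i, i ∉ Set.range f → x i = y i then G (fun a => x (f a)) (fun a => y (f a)) else 0

/-- `U` is an `(a, m, ε)` projected unitary encoding of `A`, with projectors `L` and `R`:
the wires `α` carry `A`, and `β` are the `m` extra qubits, so that `A` is identified with
`A ⊗ |0⟩⟨0|`. -/
structure IsProjUnitaryEncoding {α β : Type} [Fintype α] [DecidableEq α] [Fintype β]
    [DecidableEq β] (a ε : ℝ) (L R U : QOp (α ⊕ β)) (A : QOp α) : Prop where
  unitary : U ∈ Matrix.unitaryGroup (Bits (α ⊕ β)) ℂ
  left : IsStarProjection L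
  right : IsStarProjection R
  bound : ‖tensor A (ketBra (ketZero β) (ketZero β)) - (a : ℂ) • (L * U * R)‖ ≤ ε

theorem ketBra_ketZero_isStarProjection {α : Type} [Fintype α] [DecidableEq α] :
    IsStarProjection (ketBra (ketZero α) (ketZero α)) := by
  constructor
  · show ketBra _ _ * ketBra _ _ = _
    simp [ketBra, ketZero, Matrix.vecMulVec_mul_vecMulVec]
  · show star (ketBra _ _) = _
    simp [ketBra, Matrix.star_eq_conjTranspose, Matrix.conjTranspose_vecMulVec]

/-- A unitary that prepares `|ψ⟩` (and returns its extra qubits to zero) is an exact encoding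
of `|ψ⟩⟨0|`, with left projector `I` and right projector `|0⟩⟨0|` on all its qubits. -/
theorem isProjUnitaryEncoding_of_prepares {α β : Type} [Fintype α] [DecidableEq α] [Fintype β]
    [DecidableEq β] (U : QOp (α ⊕ β)) (hU : U ∈ Matrix.unitaryGroup (Bits (α ⊕ β)) ℂ)
    (ψ : QVec α) (h : U.mulVec (ketZero (α ⊕ β)) = tensorVec ψ (ketZero β)) :
    IsProjUnitaryEncoding 1 0 1 (ketBra (ketZero (α ⊕ β)) (ketZero (α ⊕ β))) U
      (ketBra ψ (ketZero α)) := by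
  refine ⟨hU, ⟨one_mul 1, star_one _⟩, ketBra_ketZero_isStarProjection, ?_⟩
  have key : tensor (ketBra ψ (ketZero α)) (ketBra (ketZero β) (ketZero β)) =
      ketBra (tensorVec ψ (ketZero β)) (ketZero (α ⊕ β)) := by
    ext x y
    have h2 : ketZero (α ⊕ β) y =
        ketZero α (fun i => y (Sum.inl i)) * ketZero β (fun j => y (Sum.inr j)) := by
      simp only [ketZero, Pi.single_apply, funext_iff, Sum.forall]
      split_ifs <;> simp_all
    simp only [tensor, ketBra, Matrix.vecMulVec_apply, tensorVec, Pi.star_apply, h2, star_mul]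
    ring
  rw [key, Complex.ofReal_one, one_smul, one_mul, ketBra, ketBra, Matrix.mul_vecMulVec, h]
  simp

/-- `G` is a unitary implementation, with error at most `ε`, of `C_ΠNOT`. -/
structure IsApproxCProjNot {α : Type} [Fintype α] [DecidableEq α] (ε : ℝ)
    (P : QOp α) (G : QOp (α ⊕ Unit)) : Prop where
  unitary : G ∈ Matrix.unitaryGroup (Bits (α ⊕ Unit)) ℂ
  bound : ‖G - cProjNot P‖ ≤ ε

/-- `ψ` is a purification of the operator `ρ` on the first register: tracing out the second
register of `|ψ⟩⟨ψ|` gives `ρ`. -/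
def IsPurification {α β : Type} [Fintype β] [DecidableEq β] (ψ : QVec (α ⊕ β)) (ρ : QOp α) :
    Prop :=
  ∀ x x' : Bits α, ∑ z : Bits β, ψ (Sum.elim x z) * star (ψ (Sum.elim x' z)) = ρ x x'

/-! ### Problem instances

`n` system qubits, `r` qubits of the purifying register, `m₁` ancilla qubits of the
encoding of `|ψ⟩⟨0|`, and `m₂` ancilla qubits of the encoding of `Π`. -/

/-- The projectors, the state, and the given unitaries. -/
structure Instance (n r m₁ m₂ : ℕ) where
  /-- `Π` -/
  P : QOp (Fin n)
  /-- `Π̃` -/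
  Pt : QOp (Fin n)
  /-- the purification of `Π̃ / rank Π̃` -/
  ψ : QVec (Fin n ⊕ Fin r)
  /-- `V_ψ` and the projectors of its encoding -/
  Vpsi : QOp ((Fin n ⊕ Fin r) ⊕ Fin m₁)
  Lpsi : QOp ((Fin n ⊕ Fin r) ⊕ Fin m₁)
  Rpsi : QOp ((Fin n ⊕ Fin r) ⊕ Fin m₁)
  /-- `V_Π` and the projectors of its encoding -/
  Vproj : QOp (Fin n ⊕ Fin m₂)
  Lproj : QOp (Fin n ⊕ Fin m₂)
  Rproj : QOp (Fin n ⊕ Fin m₂)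
  /-- the given (possibly faulty) gates for the `C_ΠNOT` of each of the four projectors -/
  GLpsi : QOp (((Fin n ⊕ Fin r) ⊕ Fin m₁) ⊕ Unit)
  GRpsi : QOp (((Fin n ⊕ Fin r) ⊕ Fin m₁) ⊕ Unit)
  GLproj : QOp ((Fin n ⊕ Fin m₂) ⊕ Unit)
  GRproj : QOp ((Fin n ⊕ Fin m₂) ⊕ Unit)

/-- Error bounds: of the two encodings, and of the four `C_ΠNOT` gates. -/
structure Errors where
  χpsi : ℝ
  χproj : ℝ
  εLpsi : ℝ
  εRpsi : ℝ
  εLproj : ℝ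
  εRproj : ℝ

/-- No errors at all. -/
def Errors.zero : Errors := ⟨0, 0, 0, 0, 0, 0⟩

structure Errors.Nonneg (e : Errors) : Prop where
  χpsi : 0 ≤ e.χpsi
  χproj : 0 ≤ e.χproj
  εLpsi : 0 ≤ e.εLpsi
  εRpsi : 0 ≤ e.εRpsi
  εLproj : 0 ≤ e.εLproj
  εRproj : 0 ≤ e.εRproj

/-- `ε = (4/δ) log(1/ε_f) √(2χ_ψ + χ_π + ∑ᵢ (ε_Lⁱ + ε_Rⁱ)) + ε_f`. -/
noncomputable def Errors.eps (e : Errors) (δ εf : ℝ) : ℝ :=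
  4 / δ * Real.log (1 / εf) *
    √(2 * e.χpsi + e.χproj + ((e.εLpsi + e.εRpsi) + (e.εLproj + e.εRproj))) + εf

/-- `log(1/δ) log(1/η) / ((1-χ_ψ)² (1-2ε)²)`, with `1 + log` for `log` so that it is bounded
below also for `δ` and `η` close to `1`. -/
noncomputable def Errors.repScale (e : Errors) (δ η εf : ℝ) : ℝ :=
  (1 + Real.log (1 / δ)) * (1 + Real.log (1 / η)) /
    ((1 - e.χpsi) ^ 2 * (1 - 2 * e.eps δ εf) ^ 2)

/-- The instance consists of the objects it should, within the errors `e`. -/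
structure Instance.Valid {n r m₁ m₂ : ℕ} (D : Instance n r m₁ m₂) (e : Errors) : Prop where
  proj : IsStarProjection D.P
  projt : IsStarProjection D.Pt
  subset : LinearMap.range D.P.mulVecLin ≤ LinearMap.range D.Pt.mulVecLin
  ne_zero : D.Pt ≠ 0
  purif : IsPurification D.ψ ((1 / (D.Pt.rank : ℂ)) • D.Pt)
  encpsi : IsProjUnitaryEncoding 1 e.χpsi D.Lpsi D.Rpsi D.Vpsi (ketBra D.ψ (ketZero (Fin n ⊕ Fin r)))
  encproj : IsProjUnitaryEncoding 1 e.χproj D.Lproj D.Rproj D.Vproj D.P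
  gateLpsi : IsApproxCProjNot e.εLpsi D.Lpsi D.GLpsi
  gateRpsi : IsApproxCProjNot e.εRpsi D.Rpsi D.GRpsi
  gateLproj : IsApproxCProjNot e.εLproj D.Lproj D.GLproj
  gateRproj : IsApproxCProjNot e.εRproj D.Rproj D.GRproj

/-- The quantity to be estimated, `√(rank Π / rank Π̃)`. -/
noncomputable def Instance.target {n r m₁ m₂ : ℕ} (D : Instance n r m₁ m₂) : ℝ :=
  √((D.P.rank : ℝ) / (D.Pt.rank : ℝ))

/-! ### Circuits with calls to the given unitaries -/

/-- The unitaries a circuit may call: `V_ψ`, `V_Π`, their inverses, and the four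
`C_ΠNOT` gates. -/
inductive Call where
  | Vpsi | Vpsiinv | Vproj | Vprojinv | CLpsi | CRpsi | CLproj | CRproj

/-- The wires on which a called unitary acts. -/
def Call.Wires (n r m₁ m₂ : ℕ) : Call → Type
  | .Vpsi | .Vpsiinv => (Fin n ⊕ Fin r) ⊕ Fin m₁
  | .Vproj | .Vprojinv => Fin n ⊕ Fin m₂
  | .CLpsi | .CRpsi => ((Fin n ⊕ Fin r) ⊕ Fin m₁) ⊕ Unit
  | .CLproj | .CRproj => (Fin n ⊕ Fin m₂) ⊕ Unit

/-- The operator that a call stands for. -/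
def Instance.op {n r m₁ m₂ : ℕ} (D : Instance n r m₁ m₂) :
    (q : Call) → QOp (q.Wires n r m₁ m₂)
  | .Vpsi => D.Vpsi
  | .Vpsiinv => D.Vpsi.conjTranspose
  | .Vproj => D.Vproj
  | .Vprojinv => D.Vproj.conjTranspose
  | .CLpsi => D.GLpsi
  | .CRpsi => D.GRpsi
  | .CLproj => D.GLproj
  | .CRproj => D.GRproj

/-- One operation of a circuit on `w` qubits: an arbitrary unitary on two distinct qubits
(single-qubit gates are the special case in which one of the two is idle), or a call applied
to distinct qubits of the circuit. -/
inductive Op (n r m₁ m₂ w : ℕ) where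
  | gate (f : Fin 2 ↪ Fin w) (U : Matrix.unitaryGroup (Bits (Fin 2)) ℂ)
  | call (q : Call) (f : q.Wires n r m₁ m₂ ↪ Fin w)

def Op.isCall {n r m₁ m₂ w : ℕ} : Op n r m₁ m₂ w → Bool
  | .gate _ _ => false
  | .call _ _ => true

/-- The operator on all qubits that an operation of the circuit performs. -/
noncomputable def Op.toMatrix {n r m₁ m₂ w : ℕ} (D : Instance n r m₁ m₂) :
    Op n r m₁ m₂ w → QOp (Fin w)
  | .gate f U => applyOn f (U : QOp (Fin 2))
  | .call q f => applyOn f (D.op q)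

/-- The final state of the circuit (first operation first) started in the all-zero state. -/
noncomputable def finalState {n r m₁ m₂ w : ℕ} (D : Instance n r m₁ m₂)
    (c : List (Op n r m₁ m₂ w)) : QVec (Fin w) :=
  c.foldl (fun v g => (g.toMatrix D).mulVec v) (ketZero (Fin w))

/-- The probability of outcome `x` when all qubits of the final state are measured in the
computational basis. -/
noncomputable def outcomeProb {n r m₁ m₂ w : ℕ} (D : Instance n r m₁ m₂)
    (c : List (Op n r m₁ m₂ w)) (x : Bits (Fin w)) : ℝ :=
  ‖finalState D c x‖ ^ 2

/-- An estimation algorithm: a quantum circuit, which is run and measured `reps` times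
independently, and a classical function of the outcomes. It does not depend on
an instance, only on the numbers of qubits. -/
structure Algorithm (n r m₁ m₂ : ℕ) where
  width : ℕ
  circuit : List (Op n r m₁ m₂ width)
  reps : ℕ
  estimate : (Fin reps → Bits (Fin width)) → ℝ

/-- The number of calls (to `V_ψ`, `V_Π`, their inverses and the `C_ΠNOT` gates) made by
one run of the circuit. -/
def Algorithm.calls {n r m₁ m₂ : ℕ} (a : Algorithm n r m₁ m₂) : ℕ :=
  a.circuit.countP (fun g => g.isCall)

/-- The number of two-qubit gates used by one run of the circuit besides the calls. -/
def Algorithm.gates {n r m₁ m₂ : ℕ} (a : Algorithm n r m₁ m₂) : ℕ :=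
  a.circuit.countP (fun g => !g.isCall)

/-- The probability that the estimate is within `δ` of the target. -/
noncomputable def Algorithm.successProb {n r m₁ m₂ : ℕ} (a : Algorithm n r m₁ m₂)
    (D : Instance n r m₁ m₂) (δ : ℝ) : ℝ :=
  ∑ ω : Fin a.reps → Bits (Fin a.width) with |a.estimate ω - D.target| ≤ δ,
    ∏ i, outcomeProb D a.circuit (ω i)

end RankEst

/-!
The target `t = √(rank Π / rank Π̃)` is the norm of `Π |ψ⟩`, because `⟨ψ| Π |ψ⟩` is the trace of
`Π Π̃ / rank Π̃` (`Instance.Valid.braket_psi`, `Instance.Valid.l2norm_proj_psi`). So the reflections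
about `|ψ⟩` and along the range of `Π` act on the span of `|ψ⟩` and `Π |ψ⟩` as reflections of a
plane whose axes enclose an angle with cosine `t`, and their product, the *walk*, is a rotation with
eigenvalues `μ` such that `|1 + μ| / 2 = t`. Estimating the phase of the walk on `|ψ⟩` to accuracy
`O(δ)` estimates `t` with `O(1/δ)` applications of the walk.

*The walk.* From a projected unitary encoding of a partial isometry `T`, the reflection
`1 - 2 Tᴴ T` is obtained by computing the two projectors of the encoding into flag qubits,
flipping the sign if both are set, and uncomputing. An encoding error `χ` changes it by `O(√χ)` only
(`l2norm_reflection_sub_le`, `Instance.Valid.l2norm_walkOp_sub_le`). Only the sign flip has to be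
controlled, which takes five two-qubit gates; this keeps the number of gates linear in the number of
calls. No polynomial transformation of singular values is needed.

*Robust spectral analysis.* The implemented walk `U` is diagonalized as a unitary on the whole
register. The two approximate relations for `U |ψ⟩` and `U Π |ψ⟩` imply that the spectral weight of
`|ψ⟩` is concentrated, in mean square, on eigenvalues with `|1 + μ| / 2` close to `t`
(`sum_dist_mul_amplitude_sq_le`); the second error is proportional to `t`, so the bound does not
degenerate for small `t`.

*Phase estimation.* There is no quantum Fourier transform: Hadamard tests of the powers
`U ^ (2 ^ k)`, `k ≤ K`, are performed one after the other on the same system register. On each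
eigenvector their outcomes are independent coin tosses whose biases are the real and imaginary parts
of `μ ^ (2 ^ k)`. Averages that are correct to a constant accuracy on all levels determine `μ` up to
`O(2 ^ (-K))` (`norm_sub_one_sq_le`, `abs_decode_sub_le`), and testing level `k` a number of times
proportional to `K + 1 - k` makes the failure probabilities summable at a total cost of `O(2 ^ K)`
(`le_sum_decode`, `le_sum_testProduct`). The median of independent runs amplifies the success
probability (`le_sum_median`).

*Errors.* If `ε < 1/2`, then the sum `S` of the error bounds satisfies `√S ≤ δ / 16`, whatever
`ε_f` is (`Errors.sqrt_total_le`). The reflections are then accurate to `O(√S) = O(δ)`, and faulty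
gates perturb the final state by `O(S / δ) = O(δ)`, which is small enough if `δ` is below an
absolute constant. For larger `δ`, the product of the two encoded operators is applied to the zero state, and
the norm `t` of the result is estimated by the frequency with which all flags are set
(`exists_algorithm_frequency`); the `O(S)` error is harmless there.
-/


open scoped Matrix.Norms.L2Operator

namespace RankEst

set_option linter.unusedSectionVars false

/-! ### Euclidean norm of coordinate vectors -/

section Vectors
open Matrix
variable {m n : Type*} [Fintype m] [Fintype n]

/-- The Euclidean norm of a coordinate vector. Function types carry the supremum norm, so the
norm is taken after passing to `EuclideanSpace`. -/
noncomputable def l2norm (v : n → ℂ) : ℝ := ‖WithLp.toLp 2 v‖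

/-- The inner product of coordinate vectors, conjugate-linear in the first argument. -/
noncomputable def braket (v w : n → ℂ) : ℂ := star v ⬝ᵥ w

theorem l2norm_sq (v : n → ℂ) : l2norm v ^ 2 = ∑ i, ‖v i‖ ^ 2 := by
  simp [l2norm, EuclideanSpace.norm_sq_eq]

theorem l2norm_nonneg (v : n → ℂ) : 0 ≤ l2norm v := norm_nonneg _

theorem l2norm_add_le (v w : n → ℂ) : l2norm (v + w) ≤ l2norm v + l2norm w := by
  simpa [l2norm] using norm_add_le (WithLp.toLp 2 v) (WithLp.toLp 2 w)

theorem l2norm_sub_rev (v w : n → ℂ) : l2norm (v - w) = l2norm (w - v) := by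
  simpa [l2norm] using norm_sub_rev (WithLp.toLp 2 v) (WithLp.toLp 2 w)

theorem l2norm_sub_le_sub (u v w : n → ℂ) :
    l2norm (u - w) ≤ l2norm (u - v) + l2norm (v - w) := by
  have := l2norm_add_le (u - v) (v - w)
  rwa [sub_add_sub_cancel] at this

theorem abs_l2norm_sub_le (v w : n → ℂ) : |l2norm v - l2norm w| ≤ l2norm (v - w) := by
  simpa [l2norm] using abs_norm_sub_norm_le (WithLp.toLp 2 v) (WithLp.toLp 2 w)

theorem l2norm_smul (c : ℂ) (v : n → ℂ) : l2norm (c • v) = ‖c‖ * l2norm v := by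
  simpa [l2norm] using norm_smul c (WithLp.toLp 2 v)

theorem l2norm_zero : l2norm (0 : n → ℂ) = 0 := by simp [l2norm]

theorem braket_self (v : n → ℂ) : braket v v = ((l2norm v ^ 2 : ℝ) : ℂ) := by
  rw [l2norm_sq, braket, dotProduct]
  push_cast
  refine Finset.sum_congr rfl fun i _ => ?_
  simp only [Pi.star_apply, RCLike.star_def]
  rw [mul_comm, Complex.mul_conj, Complex.normSq_eq_norm_sq]
  push_cast; rfl

theorem braket_eq_inner (v w : n → ℂ) :
    braket v w = inner ℂ (WithLp.toLp 2 v) (WithLp.toLp 2 w) := by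
  simp [braket, EuclideanSpace.inner_eq_star_dotProduct, dotProduct_comm]

theorem norm_braket_le (v w : n → ℂ) : ‖braket v w‖ ≤ l2norm v * l2norm w := by
  rw [braket_eq_inner]; exact norm_inner_le_norm _ _

theorem l2norm_sub_sq (v w : n → ℂ) :
    l2norm (v - w) ^ 2 = l2norm v ^ 2 - 2 * (braket v w).re + l2norm w ^ 2 := by
  have := @norm_sub_sq ℂ _ _ _ _ (WithLp.toLp 2 v) (WithLp.toLp 2 w)
  rw [braket_eq_inner]
  simpa [l2norm] using this

theorem braket_mulVec (M : Matrix m n ℂ) (v : m → ℂ) (w : n → ℂ) :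
    braket v (M *ᵥ w) = braket (Mᴴ *ᵥ v) w := by
  simp only [braket, star_mulVec, conjTranspose_conjTranspose, dotProduct_mulVec]

theorem l2norm_mulVec_le [DecidableEq n] (M : Matrix m n ℂ) (v : n → ℂ) :
    l2norm (M *ᵥ v) ≤ ‖M‖ * l2norm v := by
  exact l2_opNorm_mulVec M (WithLp.toLp 2 v)

/-- Matrices with orthonormal columns preserve the Euclidean norm. -/
theorem l2norm_mulVec_of_isometry [DecidableEq n] {M : Matrix m n ℂ} (h : Mᴴ * M = 1)
    (v : n → ℂ) : l2norm (M *ᵥ v) = l2norm v := by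
  have h1 : braket (M *ᵥ v) (M *ᵥ v) = braket v v := by
    rw [braket_mulVec, mulVec_mulVec, h, one_mulVec]
  rw [braket_self, braket_self] at h1
  have h2 : l2norm (M *ᵥ v) ^ 2 = l2norm v ^ 2 := by exact_mod_cast h1
  exact (pow_left_inj₀ (l2norm_nonneg _) (l2norm_nonneg _) two_ne_zero).mp h2

theorem l2norm_mulVec_of_unitary [DecidableEq n] {M : Matrix n n ℂ} (h : M ∈ unitaryGroup n ℂ)
    (v : n → ℂ) : l2norm (M *ᵥ v) = l2norm v :=
  l2norm_mulVec_of_isometry (mem_unitaryGroup_iff'.mp h) v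

theorem l2norm_single_one [DecidableEq n] (i : n) : l2norm (Pi.single i (1 : ℂ)) = 1 := by
  simp [l2norm]

theorem norm_le_of_forall_l2norm_le [DecidableEq n] {M : Matrix m n ℂ} {c : ℝ} (hc : 0 ≤ c)
    (h : ∀ v, l2norm (M *ᵥ v) ≤ c * l2norm v) : ‖M‖ ≤ c := by
  rw [l2_opNorm_def]
  exact ContinuousLinearMap.opNorm_le_bound _ hc fun v => h v.ofLp

theorem norm_le_one_of_unitary [DecidableEq n] {M : Matrix n n ℂ} (h : M ∈ unitaryGroup n ℂ) :
    ‖M‖ ≤ 1 :=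
  norm_le_of_forall_l2norm_le zero_le_one fun v => by
    rw [l2norm_mulVec_of_unitary h, one_mul]

theorem norm_le_one_of_isStarProjection [DecidableEq n] {M : Matrix n n ℂ}
    (h : IsStarProjection M) : ‖M‖ ≤ 1 := by
  have h1 : ‖M‖ * ‖M‖ = ‖M‖ := by
    rw [← l2_opNorm_conjTranspose_mul_self]
    have h2 : Mᴴ = M := h.isSelfAdjoint
    rw [h2, h.isIdempotentElem]
  by_contra hlt
  nlinarith [norm_nonneg M]

end Vectors

/-! ### Diagonalization of unitary matrices -/

section Spectral
open Matrix
variable {m : Type*} [Fintype m] [DecidableEq m]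

/-- A unitary matrix has an orthonormal eigenbasis, with eigenvalues on the unit circle: its
Hermitian and skew-Hermitian parts commute, hence are simultaneously diagonalizable. -/
theorem exists_eigenbasis_of_unitary {U : Matrix m m ℂ} (hU : U ∈ unitaryGroup m ℂ) :
    ∃ (Z : Matrix m m ℂ) (μ : m → ℂ), Z ∈ unitaryGroup m ℂ ∧ (∀ i, ‖μ i‖ = 1) ∧
      Z * U = diagonal μ * Z := by
  classical
  have h1 : Uᴴ * U = 1 := mem_unitaryGroup_iff'.mp hU
  have h2 : U * Uᴴ = 1 := mem_unitaryGroup_iff.mp hU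
  set A : Matrix m m ℂ := U + Uᴴ with hA
  set B : Matrix m m ℂ := Complex.I • (U - Uᴴ) with hB
  have hAh : A.IsHermitian := by simp [hA, IsHermitian, add_comm]
  have hBh : B.IsHermitian := by
    rw [IsHermitian, hB, conjTranspose_smul, conjTranspose_sub, conjTranspose_conjTranspose,
      RCLike.star_def, Complex.conj_I, neg_smul, ← smul_neg, neg_sub]
  have hAB : A * B = B * A := by
    simp only [hA, hB, mul_smul_comm, smul_mul_assoc, add_mul, mul_add, sub_mul, mul_sub, h1, h2]
    rw [← smul_add]
    congr 1; abel
  have hAs := isSymmetric_toEuclideanLin_iff.mpr hAh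
  have hBs := isSymmetric_toEuclideanLin_iff.mpr hBh
  have hC : Commute (toEuclideanLin A) (toEuclideanLin B) := by
    refine LinearMap.ext fun v => ?_
    simp [toLpLin_apply, mulVec_mulVec, hAB]
  have hint := LinearMap.IsSymmetric.directSum_isInternal_of_commute hAs hBs hC
  have horth := LinearMap.IsSymmetric.orthogonalFamily_eigenspace_inf_eigenspace hAs hBs
  let b0 := hint.collectedBasis fun i => (stdOrthonormalBasis ℂ _).toBasis
  have hb0 : Orthonormal ℂ b0 := by
    simpa [b0] using horth.orthonormal_sigma_orthonormal (v_family := fun i =>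
      (stdOrthonormalBasis ℂ ↥(Module.End.eigenspace (toEuclideanLin A) i.2 ⊓
        Module.End.eigenspace (toEuclideanLin B) i.1)).toBasis) (by simp)
  have : Fintype (Σ i : ℂ × ℂ, Fin (Module.finrank ℂ
      ↥(Module.End.eigenspace (toEuclideanLin A) i.2 ⊓
        Module.End.eigenspace (toEuclideanLin B) i.1))) :=
    FiniteDimensional.fintypeBasisIndex b0
  let b1 := b0.toOrthonormalBasis hb0
  have hcard := (Module.finrank_eq_card_basis b0).symm.trans
    (Module.finrank_eq_card_basis (EuclideanSpace.basisFun m ℂ).toBasis)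
  let e := Fintype.equivOfCardEq hcard
  let b := b1.reindex e
  -- eigenvalue of `U = (A - i B) / 2`
  let μ : m → ℂ := fun i => ((e.symm i).1.2 - Complex.I * (e.symm i).1.1) / 2
  have hUAB : ∀ v : m → ℂ, U *ᵥ v = (1 / 2 : ℂ) • (A *ᵥ v - Complex.I • (B *ᵥ v)) := by
    intro v
    have : U = (1 / 2 : ℂ) • (A - Complex.I • B) := by
      rw [hA, hB, smul_smul, Complex.I_mul_I, neg_one_smul]
      ext i j; simp; ring
    conv_lhs => rw [this]
    rw [smul_mulVec, sub_mulVec, smul_mulVec]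
  have hbU : ∀ i, U *ᵥ (b i).ofLp = μ i • (b i).ofLp := by
    intro i
    have hmem : b i ∈ Module.End.eigenspace (toEuclideanLin A) (e.symm i).1.2 ⊓
        Module.End.eigenspace (toEuclideanLin B) (e.symm i).1.1 := by
      simp [b, b1, b0]
    obtain ⟨ha, hb⟩ := hmem
    have ha' := congrArg WithLp.ofLp (Module.End.mem_eigenspace_iff.mp ha)
    have hb' := congrArg WithLp.ofLp (Module.End.mem_eigenspace_iff.mp hb)
    simp only [ofLp_toLpLin, toLin'_apply, WithLp.ofLp_smul] at ha' hb'
    rw [hUAB, ha', hb', smul_smul, ← sub_smul, smul_smul]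
    congr 1
    simp only [μ]; ring
  have hbn : ∀ i, l2norm (b i).ofLp = 1 := fun i => b.orthonormal.1 i
  have hμ : ∀ i, ‖μ i‖ = 1 := by
    intro i
    have h3 := l2norm_mulVec_of_unitary hU (b i).ofLp
    rw [hbU, l2norm_smul, hbn, mul_one] at h3
    exact h3
  have hbU' : ∀ i, Uᴴ *ᵥ (b i).ofLp = star (μ i) • (b i).ofLp := by
    intro i
    have h3 : star (μ i) * μ i = 1 := by
      rw [RCLike.star_def, mul_comm, Complex.mul_conj, Complex.normSq_eq_norm_sq, hμ]; simp
    have h4 := congrArg (fun v => star (μ i) • (Uᴴ *ᵥ v)) (hbU i)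
    simp only [mulVec_mulVec, h1, one_mulVec, mulVec_smul, smul_smul, h3, one_smul] at h4
    exact h4.symm
  refine ⟨of fun i j => star ((b i).ofLp j), μ, ?_, hμ, ?_⟩
  · refine mem_unitaryGroup_iff.mpr (ext fun i j => ?_)
    have h3 := orthonormal_iff_ite.mp b.orthonormal i j
    rw [EuclideanSpace.inner_eq_star_dotProduct, dotProduct_comm] at h3
    simpa [mul_apply, star_eq_conjTranspose, one_apply, dotProduct] using h3
  · ext i j
    have h3 := congrFun (congrArg star (hbU' i)) j
    rw [star_mulVec, conjTranspose_conjTranspose] at h3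
    rw [diagonal_mul]
    simpa [vecMul, mul_apply, dotProduct] using h3

end Spectral

/-! ### Operators acting on a subset of the wires -/

section ApplyOn
open Matrix
variable {α β W : Type}

theorem extend_comp_self (f : α ↪ W) (y : Bits α) (x : Bits W) :
    (fun a => Function.extend f y x (f a)) = y :=
  funext fun a => f.injective.extend_apply y x a

theorem extend_extend (f : α ↪ W) (y z : Bits α) (x : Bits W) :
    Function.extend f z (Function.extend f y x) = Function.extend f z x := by
  classical
  funext i
  by_cases h : ∃ a, f a = i
  · obtain ⟨a, rfl⟩ := h
    rw [f.injective.extend_apply, f.injective.extend_apply]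
  · rw [Function.extend_apply' _ _ _ h, Function.extend_apply' _ _ _ h,
      Function.extend_apply' _ _ _ h]

theorem extend_of_comp (f : α ↪ W) (x : Bits W) : Function.extend f (fun a => x (f a)) x = x := by
  classical
  funext i
  by_cases h : ∃ a, f a = i
  · obtain ⟨a, rfl⟩ := h
    rw [f.injective.extend_apply]
  · rw [Function.extend_apply' _ _ _ h]

theorem extend_inl (b : Bits β) (y : Bits α) (x : Bits α) :
    Function.extend (Function.Embedding.inl : α ↪ α ⊕ β) y (Sum.elim x b) = Sum.elim y b := by
  funext i
  rcases i with a | c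
  · exact Function.Embedding.inl.injective.extend_apply y _ a
  · rw [Function.extend_apply' _ _ _ (by simp)]; rfl

variable [Fintype α] [DecidableEq α] [Fintype β] [DecidableEq β] [Fintype W] [DecidableEq W]

/-- An operator on the wires in the range of `f` sums over all ways to overwrite those wires. -/
theorem applyOn_mulVec (f : α ↪ W) (G : QOp α) (v : QVec W) (x : Bits W) :
    (applyOn f G *ᵥ v) x = ∑ y : Bits α, G (fun a => x (f a)) y * v (Function.extend f y x) := by
  classical
  rw [mulVec, dotProduct]
  symm
  refine Finset.sum_of_injOn (fun y => Function.extend f y x) ?_ (by simp) ?_ ?_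
  · intro y _ z _ h
    have h' : Function.extend f y x = Function.extend f z x := h
    rw [← extend_comp_self f y x, h', extend_comp_self]
  · intro y _ hy
    have : ¬ ∀ i, i ∉ Set.range f → x i = y i := by
      intro h
      refine hy ⟨fun a => y (f a), by simp, ?_⟩
      funext i
      by_cases hi : ∃ a, f a = i
      · obtain ⟨a, rfl⟩ := hi
        exact f.injective.extend_apply _ _ _
      · show Function.extend f _ x i = y i
        rw [Function.extend_apply' _ _ _ hi]
        exact h i hi
    rw [applyOn, if_neg this, zero_mul]
  · intro y _
    have : ∀ i, i ∉ Set.range f → x i = Function.extend f y x i := by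
      intro i hi
      rw [Function.extend_apply' _ _ _ hi]
    rw [applyOn, if_pos this, extend_comp_self]

theorem applyOn_mul (f : α ↪ W) (G H : QOp α) : applyOn f (G * H) = applyOn f G * applyOn f H := by
  refine Matrix.ext_of_mulVec_single fun i : Bits W => ?_
  rw [← mulVec_mulVec]
  generalize (Pi.single i 1 : QVec W) = v
  funext x
  simp only [applyOn_mulVec, extend_comp_self, extend_extend, mul_apply, Finset.sum_mul,
    Finset.mul_sum]
  rw [Finset.sum_comm]
  simp only [mul_assoc]

theorem applyOn_one (f : α ↪ W) : applyOn f (1 : QOp α) = 1 := by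
  refine Matrix.ext_of_mulVec_single fun i : Bits W => ?_
  generalize (Pi.single i 1 : QVec W) = v
  funext x
  simp [applyOn_mulVec, one_apply, extend_of_comp]

theorem applyOn_add (f : α ↪ W) (G H : QOp α) : applyOn f (G + H) = applyOn f G + applyOn f H := by
  ext x y
  simp only [applyOn, Matrix.add_apply]
  split_ifs <;> simp

theorem applyOn_smul (f : α ↪ W) (c : ℂ) (G : QOp α) : applyOn f (c • G) = c • applyOn f G := by
  ext x y
  simp only [applyOn, Matrix.smul_apply]
  split_ifs <;> simp

theorem applyOn_conjTranspose (f : α ↪ W) (G : QOp α) : applyOn f Gᴴ = (applyOn f G)ᴴ := by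
  ext x y
  simp only [applyOn, conjTranspose_apply]
  simp only [eq_comm (a := x _) (b := y _)]
  split_ifs <;> simp

/-- Acting on some of the wires, as a homomorphism of star algebras. -/
noncomputable def applyOnHom (f : α ↪ W) : QOp α →⋆ₐ[ℂ] QOp W where
  toFun := applyOn f
  map_one' := applyOn_one f
  map_mul' := applyOn_mul f
  map_zero' := by ext x y; simp [applyOn]
  map_add' := applyOn_add f
  commutes' c := by
    rw [Algebra.algebraMap_eq_smul_one, Algebra.algebraMap_eq_smul_one, applyOn_smul, applyOn_one]
  map_star' := applyOn_conjTranspose f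

theorem applyOn_sub (f : α ↪ W) (G H : QOp α) : applyOn f (G - H) = applyOn f G - applyOn f H :=
  map_sub (applyOnHom f) G H

theorem norm_applyOn_le (f : α ↪ W) (G : QOp α) : ‖applyOn f G‖ ≤ ‖G‖ :=
  NonUnitalStarAlgHom.norm_apply_le (applyOnHom f) G

theorem applyOn_mem_unitaryGroup (f : α ↪ W) {G : QOp α} (h : G ∈ unitaryGroup (Bits α) ℂ) :
    applyOn f G ∈ unitaryGroup (Bits W) ℂ := by
  rw [mem_unitaryGroup_iff] at h ⊢
  rw [star_eq_conjTranspose, ← applyOn_conjTranspose, ← applyOn_mul, ← star_eq_conjTranspose, h,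
    applyOn_one]

theorem applyOn_isStarProjection (f : α ↪ W) {G : QOp α} (h : IsStarProjection G) :
    IsStarProjection (applyOn f G) :=
  ⟨by rw [IsIdempotentElem, ← applyOn_mul, h.isIdempotentElem], by
    rw [IsSelfAdjoint, star_eq_conjTranspose, ← applyOn_conjTranspose, ← star_eq_conjTranspose,
      h.isSelfAdjoint.star_eq]⟩

theorem applyOn_trans (f : α ↪ β) (g : β ↪ W) (G : QOp α) :
    applyOn (f.trans g) G = applyOn g (applyOn f G) := by
  refine Matrix.ext_of_mulVec_single fun i : Bits W => ?_
  generalize (Pi.single i 1 : QVec W) = v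
  funext x
  have h1 := applyOn_mulVec f G (fun y => v (Function.extend g y x)) (fun b => x (g b))
  rw [applyOn_mulVec g, applyOn_mulVec]
  refine Eq.trans ?_ h1.symm
  refine Finset.sum_congr rfl fun y _ => ?_
  congr 2
  funext i
  by_cases h : ∃ b, g b = i
  · obtain ⟨b, rfl⟩ := h
    rw [g.injective.extend_apply]
    by_cases h' : ∃ a, f a = b
    · obtain ⟨a, rfl⟩ := h'
      rw [f.injective.extend_apply, ← Function.Embedding.trans_apply,
        (f.trans g).injective.extend_apply]
    · rw [Function.extend_apply' _ _ _ h', Function.extend_apply']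
      rintro ⟨a, ha⟩
      exact h' ⟨a, g.injective ha⟩
  · rw [Function.extend_apply' _ _ _ h, Function.extend_apply']
    rintro ⟨a, ha⟩
    exact h ⟨f a, ha⟩

/-- An operator on the left register acts on each slice with fixed right register. -/
theorem applyOn_inl_mulVec (G : QOp α) (v : QVec (α ⊕ β)) (x : Bits α) (b : Bits β) :
    (applyOn (Function.Embedding.inl : α ↪ α ⊕ β) G *ᵥ v) (Sum.elim x b) =
      (G *ᵥ fun y => v (Sum.elim y b)) x := by
  rw [applyOn_mulVec, mulVec, dotProduct]
  simp only [extend_inl]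
  rfl

end ApplyOn

/-! ### Slices of a bipartite state -/

section Slices
open Matrix
variable {α β S : Type} [Fintype α] [DecidableEq α] [Fintype β] [DecidableEq β]
  [Fintype S] [DecidableEq S]

/-- The (unnormalized) state of the left register when the right register is in the basis
state `b`. -/
def slice (v : QVec (α ⊕ β)) (b : Bits β) : QVec α := fun x => v (Sum.elim x b)

/-- The state `u ⊗ |b⟩`. -/
def withBits (b : Bits β) (u : QVec α) : QVec (α ⊕ β) := fun z =>
  if (fun j => z (Sum.inr j)) = b then u (fun i => z (Sum.inl i)) else 0

theorem sum_bits_sum {M : Type*} [AddCommMonoid M] (g : Bits (α ⊕ β) → M) :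
    ∑ z, g z = ∑ b : Bits β, ∑ x : Bits α, g (Sum.elim x b) := by
  rw [Finset.sum_comm, ← Fintype.sum_prod_type' (fun x b => g (Sum.elim x b))]
  exact Fintype.sum_equiv (Equiv.sumArrowEquivProdArrow α β Bool) _ _ fun z => by
    congr 1; funext i; cases i <;> rfl

theorem slice_ext {v w : QVec (α ⊕ β)} (h : ∀ b, slice v b = slice w b) : v = w := by
  funext z
  have := congrFun (h fun j => z (Sum.inr j)) fun i => z (Sum.inl i)
  have hz : Sum.elim (fun i => z (Sum.inl i)) (fun j => z (Sum.inr j)) = z :=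
    Sum.elim_comp_inl_inr z
  simpa only [slice, hz] using this

theorem slice_withBits (b b' : Bits β) (u : QVec α) :
    slice (withBits b u) b' = if b' = b then u else 0 := by
  funext x
  by_cases h : b' = b <;> simp [slice, withBits, h]

theorem slice_sub (v w : QVec (α ⊕ β)) (b : Bits β) :
    slice (v - w) b = slice v b - slice w b := rfl

theorem slice_smul (c : ℂ) (v : QVec (α ⊕ β)) (b : Bits β) :
    slice (c • v) b = c • slice v b := rfl

theorem withBits_sub (b : Bits β) (v w : QVec α) :
    withBits b (v - w) = withBits b v - withBits b w := by
  funext z; simp only [withBits, Pi.sub_apply]; split_ifs <;> simp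

theorem withBits_smul (b : Bits β) (c : ℂ) (v : QVec α) :
    withBits b (c • v) = c • withBits b v := by
  funext z; simp only [withBits, Pi.smul_apply]; split_ifs <;> simp

theorem l2norm_sq_eq_sum_slice (v : QVec (α ⊕ β)) :
    l2norm v ^ 2 = ∑ b, l2norm (slice v b) ^ 2 := by
  simp only [l2norm_sq, sum_bits_sum, slice]

theorem braket_withBits (b : Bits β) (w : QVec α) (v : QVec (α ⊕ β)) :
    braket (withBits b w) v = braket w (slice v b) := by
  simp only [braket, dotProduct, sum_bits_sum]
  rw [Finset.sum_eq_single b]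
  · simp [withBits, slice]
  · intro b' _ hb; simp [withBits, hb]
  · simp

theorem l2norm_withBits (b : Bits β) (u : QVec α) : l2norm (withBits b u) = l2norm u := by
  have h : l2norm (withBits b u) ^ 2 = l2norm u ^ 2 := by
    rw [l2norm_sq_eq_sum_slice, Finset.sum_eq_single b]
    · simp [slice_withBits]
    · intro b' _ hb; simp [slice_withBits, hb, l2norm_zero]
    · simp
  exact (pow_left_inj₀ (l2norm_nonneg _) (l2norm_nonneg _) two_ne_zero).mp h

theorem slice_applyOn_inl (G : QOp α) (v : QVec (α ⊕ β)) (b : Bits β) :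
    slice (applyOn (Function.Embedding.inl : α ↪ α ⊕ β) G *ᵥ v) b = G *ᵥ slice v b :=
  funext fun x => applyOn_inl_mulVec G v x b

/-- Attaching the wire `h` of the right register to an embedding into the left one. -/
def withTarget (f : α ↪ S) (h : β) : α ⊕ Unit ↪ S ⊕ β :=
  f.sumMap ⟨fun _ => h, fun _ _ _ => rfl⟩

/-- `C_ΠNOT` with its target in the right register applies `1 - Π` if the target bit is kept, and
`Π` if it is flipped. -/
theorem slice_applyOn_withTarget (f : α ↪ S) (h : β) (P : QOp α) (v : QVec (S ⊕ β))
    (b : Bits β) :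
    slice (applyOn (withTarget f h) (cProjNot P) *ᵥ v) b =
      (1 - applyOn f P) *ᵥ slice v b + applyOn f P *ᵥ slice v (Function.update b h (!b h)) := by
  have hext : ∀ (y : Bits α) (c x : _), Function.extend (withTarget f h) (Sum.elim y fun _ => c)
      (Sum.elim x b) = Sum.elim (Function.extend f y x) (Function.update b h c) := by
    intro y c x
    funext i
    rcases i with i | j
    · by_cases hi : ∃ a, f a = i
      · obtain ⟨a, rfl⟩ := hi
        rw [Sum.elim_inl, f.injective.extend_apply]
        exact (withTarget f h).injective.extend_apply _ _ (Sum.inl a)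
      · rw [Function.extend_apply', Sum.elim_inl, Sum.elim_inl, Function.extend_apply' _ _ _ hi]
        rintro ⟨a | u, ha⟩
        · exact hi ⟨a, Sum.inl_injective ha⟩
        · cases ha
    · by_cases hj : j = h
      · subst hj
        rw [Sum.elim_inr, Function.update_self]
        exact (withTarget f j).injective.extend_apply _ _ (Sum.inr ())
      · rw [Function.extend_apply', Sum.elim_inr, Sum.elim_inr, Function.update_of_ne hj]
        rintro ⟨a | u, ha⟩
        · cases ha
        · exact hj (Sum.inr_injective ha).symm
  have hsub : (1 - applyOn f P) = applyOn f (1 - P) := by rw [applyOn_sub, applyOn_one]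
  have key : ∀ (c : Bool) (x : Bits S) (a : Bits α), slice v (Function.update b h c)
      (Function.extend f a x) = v (Function.extend (withTarget f h) (Sum.elim a fun _ => c)
      (Sum.elim x b)) := by
    intro c x a; rw [hext]; rfl
  have hb : slice v b = slice v (Function.update b h (b h)) := by rw [Function.update_eq_self]
  rw [hsub, hb]
  funext x
  rw [Pi.add_apply, applyOn_mulVec, applyOn_mulVec]
  simp only [key]
  rw [slice, applyOn_mulVec, sum_bits_sum]
  refine (Fintype.sum_equiv (Equiv.funUnique Unit Bool) _ (fun c => ∑ y : Bits α,
      cProjNot P (fun a => Sum.elim x b (withTarget f h a)) (Sum.elim y fun _ => c) *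
        v (Function.extend (withTarget f h) (Sum.elim y fun _ => c) (Sum.elim x b)))
      (fun c => rfl)).trans ?_
  have hc : ∀ (c : Bool) (y : Bits α),
      cProjNot P (fun a => Sum.elim x b (withTarget f h a)) (Sum.elim y fun _ => c) =
        (if c = b h then (1 - P) (fun a => x (f a)) y else 0) +
          (if c = b h then 0 else P (fun a => x (f a)) y) := by
    intro c y
    have h1 : ((1 : QOp Unit) (fun _ => b h) fun _ => c) = if c = b h then 1 else 0 := by
      simp only [one_apply, funext_iff, forall_const, eq_comm (a := b h)]
    show (1 - P) (fun a => x (f a)) y * (1 : QOp Unit) (fun _ => b h) (fun _ => c) +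
      P (fun a => x (f a)) y * pauliX (fun _ => b h) (fun _ => c) = _
    rw [h1, pauliX]
    simp only [eq_comm (a := b h)]
    split_ifs <;> simp
  simp only [hc]
  rw [Fintype.sum_bool]
  cases b h <;> simp [add_comm]

end Slices

/-! ### Reflections built from encodings -/

section Reflection
open Matrix
variable {S : Type} [Fintype S] [DecidableEq S]

/-- The sign flip on the states whose two flag wires are both set. -/
def flagSign (S : Type) [Fintype S] [DecidableEq S] : QOp (S ⊕ Fin 2) :=
  diagonal fun z => if z (Sum.inr 0) && z (Sum.inr 1) then -1 else 1

theorem flagSign_mulVec (v : QVec (S ⊕ Fin 2)) :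
    flagSign S *ᵥ v = v - (2 : ℂ) • withBits (fun _ => true) (slice v fun _ => true) := by
  refine slice_ext fun b => funext fun x => ?_
  rw [slice_sub, slice_smul, slice_withBits]
  have : (b = fun _ => true) ↔ (b 0 && b 1) = true := by
    simp [funext_iff, Fin.forall_fin_two]
  have hl : slice (flagSign S *ᵥ v) b x = (if b 0 && b 1 then -1 else 1) * slice v b x :=
    mulVec_diagonal _ _ _
  rw [hl]
  by_cases h : (b 0 && b 1) = true
  · rw [if_pos h, if_pos (this.mpr h), ← this.mpr h]
    simp only [Pi.sub_apply, Pi.smul_apply, smul_eq_mul]; ring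
  · rw [if_neg h, if_neg (mt this.mp h)]
    simp

theorem flagSign_mem_unitaryGroup : flagSign S ∈ unitaryGroup (Bits (S ⊕ Fin 2)) ℂ := by
  rw [mem_unitaryGroup_iff, star_eq_conjTranspose, flagSign, diagonal_conjTranspose,
    diagonal_mul_diagonal, ← diagonal_one]
  congr 1; funext z
  simp only [Pi.star_apply]
  split_ifs <;> simp

theorem norm_le_one_of_partialIsometry {T : QOp S} (hT : T * Tᴴ * T = T) : ‖T‖ ≤ 1 := by
  have h1 : IsStarProjection (Tᴴ * T) := by
    refine ⟨?_, ?_⟩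
    · rw [IsIdempotentElem, Matrix.mul_assoc, ← Matrix.mul_assoc T, hT]
    · rw [IsSelfAdjoint, star_eq_conjTranspose, conjTranspose_mul, conjTranspose_conjTranspose]
  have h2 := norm_le_one_of_isStarProjection h1
  rw [l2_opNorm_conjTranspose_mul_self] at h2
  nlinarith [norm_nonneg T]

/-- If the two flags of `B (u ⊗ |00⟩)` are both set with amplitude `M u`, and `M` is `χ`-close to
the partial isometry `T`, then `Bᴴ Z B`, with `Z` the sign flip on set flags, acts on flags in
state zero as the reflection `1 - 2 Tᴴ T`, up to `O(√χ)`. -/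
theorem l2norm_reflection_sub_le {B : QOp (S ⊕ Fin 2)} {T M : QOp S} {χ : ℝ}
    (hB : B ∈ unitaryGroup (Bits (S ⊕ Fin 2)) ℂ)
    (hM : ∀ u, slice (B *ᵥ withBits (fun _ => false) u) (fun _ => true) = M *ᵥ u)
    (hT : T * Tᴴ * T = T) (hTM : ‖T - M‖ ≤ χ) (u : QVec S) :
    l2norm ((Bᴴ * flagSign S * B) *ᵥ withBits (fun _ => false) u -
      withBits (fun _ => false) (u - (2 : ℂ) • ((Tᴴ * T) *ᵥ u))) ≤
        (2 * χ + 2 * √(2 * χ)) * l2norm u := by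
  have hχ : 0 ≤ χ := (norm_nonneg _).trans hTM
  have hBB : Bᴴ * B = 1 := mem_unitaryGroup_iff'.mp hB
  have hBB' : B * Bᴴ = 1 := mem_unitaryGroup_iff.mp hB
  have hTn := norm_le_one_of_partialIsometry hT
  set y := (Tᴴ * T) *ᵥ u with hy
  have hTy : T *ᵥ y = T *ᵥ u := by rw [hy, mulVec_mulVec, ← Matrix.mul_assoc, hT]
  have hTu : l2norm (T *ᵥ u) ≤ l2norm u :=
    (l2norm_mulVec_le T u).trans (mul_le_of_le_one_left (l2norm_nonneg _) hTn)
  have hyn : l2norm y ^ 2 = l2norm (T *ᵥ u) ^ 2 := by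
    have h1 : braket y y = braket (T *ᵥ u) (T *ᵥ u) := by
      conv_lhs => rw [hy, ← mulVec_mulVec, braket_mulVec, conjTranspose_conjTranspose]
      rw [mulVec_mulVec, mulVec_mulVec, hT]
    rw [braket_self, braket_self] at h1
    exact_mod_cast h1
  have hyn' : l2norm y = l2norm (T *ᵥ u) :=
    (pow_left_inj₀ (l2norm_nonneg _) (l2norm_nonneg _) two_ne_zero).mp hyn
  set a := withBits (fun _ : Fin 2 => true) (T *ᵥ u) with ha
  set c := B *ᵥ withBits (fun _ => false) y with hc
  have hdiff : ∀ w, l2norm ((M - T) *ᵥ w) ≤ χ * l2norm w := fun w =>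
    (l2norm_mulVec_le _ w).trans (mul_le_mul_of_nonneg_right
      (by rwa [← norm_neg, neg_sub]) (l2norm_nonneg _))
  -- `a` and `c` both have norm `‖T u‖`, and their overlap is `‖T u‖ ^ 2` up to `χ ‖u‖ ^ 2`
  have hac : l2norm (a - c) ≤ √(2 * χ) * l2norm u := by
    have h1 : braket a c = ((l2norm (T *ᵥ u) ^ 2 : ℝ) : ℂ) +
        braket (T *ᵥ u) ((M - T) *ᵥ y) := by
      rw [ha, hc, braket_withBits, hM, sub_mulVec, hTy, ← braket_self]
      simp only [braket, dotProduct_sub]; ring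
    have h2 : |(braket (T *ᵥ u) ((M - T) *ᵥ y)).re| ≤ l2norm (T *ᵥ u) * (χ * l2norm y) :=
      (Complex.abs_re_le_norm _).trans ((norm_braket_le _ _).trans
        (mul_le_mul_of_nonneg_left (hdiff y) (l2norm_nonneg _)))
    have h3 : l2norm (a - c) ^ 2 ≤ 2 * χ * l2norm u ^ 2 := by
      rw [l2norm_sub_sq, h1, ha, hc, l2norm_mulVec_of_unitary hB, l2norm_withBits,
        l2norm_withBits, hyn, Complex.add_re, Complex.ofReal_re]
      rw [hyn'] at h2
      have h4 := (abs_le.mp h2).1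
      have h5 : l2norm (T *ᵥ u) ^ 2 ≤ l2norm u ^ 2 :=
        pow_le_pow_left₀ (l2norm_nonneg _) hTu 2
      nlinarith
    have h4 := Real.sqrt_le_sqrt h3
    rwa [Real.sqrt_sq (l2norm_nonneg _), Real.sqrt_mul (by positivity),
      Real.sqrt_sq (l2norm_nonneg _)] at h4
  have hmain : B *ᵥ ((Bᴴ * flagSign S * B) *ᵥ withBits (fun _ => false) u -
      withBits (fun _ => false) (u - (2 : ℂ) • y)) =
        (-2 : ℂ) • (withBits (fun _ => true) ((M - T) *ᵥ u) + (a - c)) := by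
    rw [mulVec_sub, mulVec_mulVec, Matrix.mul_assoc, ← Matrix.mul_assoc B, hBB', Matrix.one_mul,
      ← mulVec_mulVec, flagSign_mulVec, hM, withBits_sub, mulVec_sub, withBits_smul, mulVec_smul,
      ← hc, sub_mulVec, withBits_sub, ← ha]
    module
  rw [← l2norm_mulVec_of_unitary hB, hmain, l2norm_smul]
  have h6 := l2norm_add_le (withBits (fun _ : Fin 2 => true) ((M - T) *ᵥ u)) (a - c)
  rw [l2norm_withBits] at h6
  have h7 := hdiff u
  rw [norm_neg, Complex.norm_ofNat]
  nlinarith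

end Reflection

/-! ### Circuits on registers with arbitrary wire labels -/

section Circuits
open Matrix
variable {n r m₁ m₂ : ℕ} {V W : Type}

/-- An operation of a circuit whose wires are labelled by `W`. -/
inductive WireOp (n r m₁ m₂ : ℕ) (W : Type) where
  | gate (f : Fin 2 ↪ W) (U : Matrix.unitaryGroup (Bits (Fin 2)) ℂ)
  | call (q : Call) (f : q.Wires n r m₁ m₂ ↪ W)

/-- Whether the operation is a call to one of the given unitaries. -/
def WireOp.isCall : WireOp n r m₁ m₂ W → Bool
  | .gate _ _ => false
  | .call _ _ => true

/-- Relabelling the wires of an operation. -/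
def WireOp.map (e : V ↪ W) : WireOp n r m₁ m₂ V → WireOp n r m₁ m₂ W
  | .gate f U => .gate (f.trans e) U
  | .call q f => .call q (f.trans e)

/-- Numbering the wires of an operation. -/
def WireOp.toOp {w : ℕ} (e : W ≃ Fin w) : WireOp n r m₁ m₂ W → Op n r m₁ m₂ w
  | .gate f U => .gate (f.trans e.toEmbedding) U
  | .call q f => .call q (f.trans e.toEmbedding)

/-- The operator that an operation performs on all wires. -/
noncomputable def WireOp.toMatrix (D : Instance n r m₁ m₂) : WireOp n r m₁ m₂ W → QOp W
  | .gate f U => applyOn f (U : QOp (Fin 2))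
  | .call q f => applyOn f (D.op q)

theorem WireOp.isCall_toOp {w : ℕ} (e : W ≃ Fin w) (g : WireOp n r m₁ m₂ W) :
    (g.toOp e).isCall = g.isCall := by cases g <;> rfl

instance : (q : Call) → Fintype (q.Wires n r m₁ m₂)
  | .Vpsi | .Vpsiinv => inferInstanceAs (Fintype ((Fin n ⊕ Fin r) ⊕ Fin m₁))
  | .Vproj | .Vprojinv => inferInstanceAs (Fintype (Fin n ⊕ Fin m₂))
  | .CLpsi | .CRpsi => inferInstanceAs (Fintype (((Fin n ⊕ Fin r) ⊕ Fin m₁) ⊕ Unit))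
  | .CLproj | .CRproj => inferInstanceAs (Fintype ((Fin n ⊕ Fin m₂) ⊕ Unit))

instance : (q : Call) → DecidableEq (q.Wires n r m₁ m₂)
  | .Vpsi | .Vpsiinv => inferInstanceAs (DecidableEq ((Fin n ⊕ Fin r) ⊕ Fin m₁))
  | .Vproj | .Vprojinv => inferInstanceAs (DecidableEq (Fin n ⊕ Fin m₂))
  | .CLpsi | .CRpsi => inferInstanceAs (DecidableEq (((Fin n ⊕ Fin r) ⊕ Fin m₁) ⊕ Unit))
  | .CLproj | .CRproj => inferInstanceAs (DecidableEq ((Fin n ⊕ Fin m₂) ⊕ Unit))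

variable [Fintype V] [DecidableEq V] [Fintype W] [DecidableEq W]

/-- The operator performed by a circuit, the first operation of the list acting first. -/
noncomputable def circuitMatrix (D : Instance n r m₁ m₂) : List (WireOp n r m₁ m₂ W) → QOp W
  | [] => 1
  | g :: c => circuitMatrix D c * g.toMatrix D

theorem circuitMatrix_append (D : Instance n r m₁ m₂) (c d : List (WireOp n r m₁ m₂ W)) :
    circuitMatrix D (c ++ d) = circuitMatrix D d * circuitMatrix D c := by
  induction c with
  | nil => simp [circuitMatrix]
  | cons g c ih => rw [List.cons_append, circuitMatrix, ih, circuitMatrix, Matrix.mul_assoc]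

theorem WireOp.toMatrix_map (D : Instance n r m₁ m₂) (e : V ↪ W) (g : WireOp n r m₁ m₂ V) :
    (g.map e).toMatrix D = applyOn e (g.toMatrix D) := by
  cases g <;> exact applyOn_trans _ _ _

theorem circuitMatrix_map (D : Instance n r m₁ m₂) (e : V ↪ W)
    (c : List (WireOp n r m₁ m₂ V)) :
    circuitMatrix D (c.map (WireOp.map e)) = applyOn e (circuitMatrix D c) := by
  induction c with
  | nil => simp [circuitMatrix, applyOn_one]
  | cons g c ih =>
    rw [List.map_cons, circuitMatrix, ih, circuitMatrix, applyOn_mul, WireOp.toMatrix_map]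

theorem applyOn_trans_equiv {α : Type} (f : α ↪ V) (e : V ≃ W) (G : QOp α) (x y : Bits W) :
    applyOn (f.trans e.toEmbedding) G x y = applyOn f G (x ∘ e) (y ∘ e) := by
  classical
  have : (∀ i, i ∉ Set.range (f.trans e.toEmbedding) → x i = y i) ↔
      ∀ i, i ∉ Set.range f → (x ∘ e) i = (y ∘ e) i := by
    rw [← e.forall_congr_right]
    simp
  unfold applyOn
  by_cases h : ∀ i, i ∉ Set.range f → (x ∘ e) i = (y ∘ e) i
  · rw [if_pos h, if_pos (this.mpr h)]; rfl
  · rw [if_neg h, if_neg (mt this.mp h)]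

theorem finalState_map_toOp {w : ℕ} (D : Instance n r m₁ m₂) (e : W ≃ Fin w)
    (c : List (WireOp n r m₁ m₂ W)) (x : Bits (Fin w)) :
    finalState D (c.map (WireOp.toOp e)) x = (circuitMatrix D c *ᵥ ketZero W) (x ∘ e) := by
  have hstep : ∀ (g : WireOp n r m₁ m₂ W) (v : QVec W),
      ((g.toOp e).toMatrix D *ᵥ fun y => v (y ∘ e)) = fun y => (g.toMatrix D *ᵥ v) (y ∘ e) := by
    intro g v
    have : ∀ x y, (g.toOp e).toMatrix D x y = g.toMatrix D (x ∘ e) (y ∘ e) := by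
      cases g <;> exact fun x y => applyOn_trans_equiv _ _ _ _ _
    funext y
    simp only [mulVec, dotProduct, this]
    exact Fintype.sum_equiv (e.symm.arrowCongr (Equiv.refl Bool)) _ _ fun z => rfl
  have hmain : ∀ (c : List (WireOp n r m₁ m₂ W)) (v : QVec W),
      (c.map (WireOp.toOp e)).foldl (fun v g => (g.toMatrix D).mulVec v) (fun y => v (y ∘ e)) =
        fun y => (circuitMatrix D c *ᵥ v) (y ∘ e) := by
    intro c
    induction c with
    | nil => intro v; simp [circuitMatrix]
    | cons g c ih =>
      intro v
      rw [List.map_cons, List.foldl_cons, hstep, ih]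
      simp only [circuitMatrix, mulVec_mulVec]
  have h0 : ketZero (Fin w) = fun y => ketZero W (y ∘ e) := by
    funext y
    have : y = (fun _ => false) ↔ y ∘ e = fun _ => false := by
      simp only [funext_iff, Function.comp]
      exact (e.forall_congr_right (q := fun i => y i = false)).symm
    simp only [ketZero, Pi.single_apply, this]
  rw [finalState, h0, hmain]

/-- A circuit on any finite set of wires, together with a number of repetitions and an
estimator, is an algorithm with the same costs and success probability. -/
theorem exists_algorithm (c : List (WireOp n r m₁ m₂ W)) (N : ℕ)
    (est : (Fin N → Bits W) → ℝ) :
    ∃ a : Algorithm n r m₁ m₂, a.reps = N ∧ a.calls = c.countP (fun g => g.isCall) ∧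
      a.gates = c.countP (fun g => !g.isCall) ∧
      ∀ D δ, a.successProb D δ = ∑ ω : Fin N → Bits W with |est ω - D.target| ≤ δ,
        ∏ i, ‖(circuitMatrix D c *ᵥ ketZero W) (ω i)‖ ^ 2 := by
  let e := Fintype.equivFin W
  refine ⟨⟨Fintype.card W, c.map (WireOp.toOp e), N, fun ω => est fun i => ω i ∘ e⟩, rfl, ?_, ?_,
    fun D δ => ?_⟩
  · simp only [Algorithm.calls, List.countP_map]
    exact List.countP_congr fun g _ => by simp [WireOp.isCall_toOp]
  · simp only [Algorithm.gates, List.countP_map]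
    exact List.countP_congr fun g _ => by simp [WireOp.isCall_toOp]
  · simp only [Algorithm.successProb, outcomeProb, finalState_map_toOp, Finset.sum_filter]
    exact Fintype.sum_equiv ((Equiv.refl _).arrowCongr (e.symm.arrowCongr (Equiv.refl Bool))) _ _
      fun ω => rfl

/-! ### Ideal gates, and the effect of faulty ones -/

/-- The instance with the `C_ΠNOT` gates replaced by the exact ones. -/
def Instance.ideal (D : Instance n r m₁ m₂) : Instance n r m₁ m₂ :=
  { D with
    GLpsi := cProjNot D.Lpsi
    GRpsi := cProjNot D.Rpsi
    GLproj := cProjNot D.Lproj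
    GRproj := cProjNot D.Rproj }

/-- Every given operator of the instance is unitary. -/
def Instance.IsUnitary (D : Instance n r m₁ m₂) : Prop :=
  ∀ q : Call, D.op q ∈ unitaryGroup (Bits (q.Wires n r m₁ m₂)) ℂ

theorem Instance.IsUnitary.toMatrix_mem {D : Instance n r m₁ m₂} (h : D.IsUnitary)
    (g : WireOp n r m₁ m₂ W) : g.toMatrix D ∈ unitaryGroup (Bits W) ℂ := by
  cases g with
  | gate f U => exact applyOn_mem_unitaryGroup f U.2
  | call q f => exact applyOn_mem_unitaryGroup f (h q)

theorem Instance.IsUnitary.circuitMatrix_mem {D : Instance n r m₁ m₂} (h : D.IsUnitary)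
    (c : List (WireOp n r m₁ m₂ W)) : circuitMatrix D c ∈ unitaryGroup (Bits W) ℂ := by
  induction c with
  | nil => exact one_mem _
  | cons g c ih => exact mul_mem ih (h.toMatrix_mem g)

/-- Replacing every called operator by a `κ`-close one perturbs the circuit by `κ` per call. -/
theorem norm_circuitMatrix_sub_le {D D' : Instance n r m₁ m₂} (h : D.IsUnitary)
    (h' : D'.IsUnitary) {κ : ℝ} (hκ : ∀ q, ‖D.op q - D'.op q‖ ≤ κ)
    (c : List (WireOp n r m₁ m₂ W)) :
    ‖circuitMatrix D c - circuitMatrix D' c‖ ≤ c.countP (fun g => g.isCall) * κ := by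
  induction c with
  | nil => simp [circuitMatrix]
  | cons g c ih =>
    have hg : ‖g.toMatrix D - g.toMatrix D'‖ ≤ if g.isCall then κ else 0 := by
      cases g with
      | gate f U => simp [WireOp.toMatrix, WireOp.isCall]
      | call q f =>
        simp only [WireOp.toMatrix, WireOp.isCall, if_true, ← applyOn_sub]
        exact (norm_applyOn_le f _).trans (hκ q)
    have hsplit : circuitMatrix D (g :: c) - circuitMatrix D' (g :: c) =
        (circuitMatrix D c - circuitMatrix D' c) * g.toMatrix D +
          circuitMatrix D' c * (g.toMatrix D - g.toMatrix D') := by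
      simp only [circuitMatrix]; noncomm_ring
    have h1 := norm_mul_le (circuitMatrix D c - circuitMatrix D' c) (g.toMatrix D)
    have h2 := norm_mul_le (circuitMatrix D' c) (g.toMatrix D - g.toMatrix D')
    have h3 := norm_le_one_of_unitary (h.toMatrix_mem g)
    have h4 := norm_le_one_of_unitary (h'.circuitMatrix_mem c)
    rw [hsplit]
    refine (norm_add_le _ _).trans ?_
    rw [List.countP_cons]
    have h5 : ((c.countP (fun g => g.isCall) + if g.isCall then 1 else 0 : ℕ) : ℝ) * κ =
        c.countP (fun g => g.isCall) * κ + if g.isCall then κ else 0 := by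
      split_ifs <;> (push_cast; ring)
    rw [h5]
    nlinarith [norm_nonneg (circuitMatrix D c - circuitMatrix D' c),
      norm_nonneg (g.toMatrix D - g.toMatrix D')]

theorem cProjNot_isHermitian {α : Type} [Fintype α] [DecidableEq α] {P : QOp α}
    (hP : IsStarProjection P) : (cProjNot P)ᴴ = cProjNot P := by
  have h1 : Pᴴ = P := hP.isSelfAdjoint
  have ht : ∀ (A : QOp α) (B : QOp Unit), (tensor A B)ᴴ = tensor Aᴴ Bᴴ := by
    intro A B; ext x y; simp [tensor]
  have hX : pauliXᴴ = pauliX := by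
    ext x y; simp [pauliX, eq_comm]
  rw [cProjNot, conjTranspose_add, ht, ht, conjTranspose_sub, conjTranspose_one,
    conjTranspose_one, h1, hX]

theorem tensor_mul {α β : Type} [Fintype α] [DecidableEq α] [Fintype β] [DecidableEq β]
    (A A' : QOp α) (B B' : QOp β) : tensor A B * tensor A' B' = tensor (A * A') (B * B') := by
  ext x y
  simp only [tensor, mul_apply, sum_bits_sum, Finset.sum_mul_sum, Sum.elim_inl, Sum.elim_inr]
  rw [Finset.sum_comm]
  refine Finset.sum_congr rfl fun _ _ => Finset.sum_congr rfl fun _ _ => ?_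
  ring

theorem cProjNot_mul_self {α : Type} [Fintype α] [DecidableEq α] {P : QOp α}
    (hP : IsStarProjection P) : cProjNot P * cProjNot P = 1 := by
  have h1 : P * P = P := hP.isIdempotentElem
  have hX : pauliX * pauliX = 1 := by
    ext x y
    rw [mul_apply]
    refine (Fintype.sum_equiv (Equiv.funUnique Unit Bool) _
      (fun c => pauliX x (fun _ => c) * pauliX (fun _ => c) y) (fun c => rfl)).trans ?_
    have hxy : (x = y) ↔ x () = y () := ⟨fun h => h ▸ rfl, fun h => funext fun _ => h⟩
    simp only [pauliX, one_apply, hxy]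
    cases x () <;> cases y () <;> simp
  have hadd : ∀ (A A' : QOp α) (B : QOp Unit), tensor A B + tensor A' B = tensor (A + A') B := by
    intro A A' B; ext x y; simp [tensor, add_mul]
  have hzero : ∀ (B : QOp Unit), tensor (0 : QOp α) B = 0 := by
    intro B; ext x y; simp [tensor]
  have hone : tensor (1 : QOp α) (1 : QOp Unit) = 1 := by
    ext x y
    simp only [tensor, one_apply, funext_iff, Sum.forall, ← ite_and, mul_ite, mul_one, mul_zero]
    congr 1
    exact propext and_comm
  have h2 : (1 - P) * (1 - P) = 1 - P := by simp [mul_sub, sub_mul, h1]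
  have h3 : (1 - P) * P = 0 := by simp [sub_mul, h1]
  have h4 : P * (1 - P) = 0 := by simp [mul_sub, h1]
  rw [cProjNot, add_mul, mul_add, mul_add]
  simp only [tensor_mul, h1, h2, h3, h4, hzero, hX, Matrix.mul_one, add_zero, zero_add, hadd]
  rw [sub_add_cancel, hone]

theorem cProjNot_mem_unitaryGroup {α : Type} [Fintype α] [DecidableEq α] {P : QOp α}
    (hP : IsStarProjection P) : cProjNot P ∈ unitaryGroup (Bits (α ⊕ Unit)) ℂ := by
  rw [mem_unitaryGroup_iff, star_eq_conjTranspose, cProjNot_isHermitian hP, cProjNot_mul_self hP]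

/-- The sum of the bounds on the gate errors. -/
noncomputable def Errors.gateTotal (e : Errors) : ℝ :=
  (e.εLpsi + e.εRpsi) + (e.εLproj + e.εRproj)

theorem conjTranspose_mem_unitaryGroup {α : Type} [Fintype α] [DecidableEq α] {U : QOp α}
    (hU : U ∈ unitaryGroup (Bits α) ℂ) : Uᴴ ∈ unitaryGroup (Bits α) ℂ := by
  rw [mem_unitaryGroup_iff, star_eq_conjTranspose, conjTranspose_conjTranspose]
  exact mem_unitaryGroup_iff'.mp hU

variable {D : Instance n r m₁ m₂} {e : Errors}

theorem Instance.Valid.isUnitary (h : D.Valid e) : D.IsUnitary := by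
  intro q
  cases q
  · exact h.encpsi.unitary
  · exact conjTranspose_mem_unitaryGroup h.encpsi.unitary
  · exact h.encproj.unitary
  · exact conjTranspose_mem_unitaryGroup h.encproj.unitary
  · exact h.gateLpsi.unitary
  · exact h.gateRpsi.unitary
  · exact h.gateLproj.unitary
  · exact h.gateRproj.unitary

theorem Instance.Valid.ideal_isUnitary (h : D.Valid e) : D.ideal.IsUnitary := by
  intro q
  cases q
  · exact h.encpsi.unitary
  · exact conjTranspose_mem_unitaryGroup h.encpsi.unitary
  · exact h.encproj.unitary
  · exact conjTranspose_mem_unitaryGroup h.encproj.unitary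
  · exact cProjNot_mem_unitaryGroup h.encpsi.left
  · exact cProjNot_mem_unitaryGroup h.encpsi.right
  · exact cProjNot_mem_unitaryGroup h.encproj.left
  · exact cProjNot_mem_unitaryGroup h.encproj.right

theorem Instance.Valid.norm_op_sub_ideal_le (h : D.Valid e) (q : Call) :
    ‖D.op q - D.ideal.op q‖ ≤ e.gateTotal := by
  have h1 : 0 ≤ e.εLpsi := (norm_nonneg _).trans h.gateLpsi.bound
  have h2 : 0 ≤ e.εRpsi := (norm_nonneg _).trans h.gateRpsi.bound
  have h3 : 0 ≤ e.εLproj := (norm_nonneg _).trans h.gateLproj.bound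
  have h4 : 0 ≤ e.εRproj := (norm_nonneg _).trans h.gateRproj.bound
  have h0 : 0 ≤ e.gateTotal := by rw [Errors.gateTotal]; linarith
  have hz : ∀ {α : Type} [Fintype α] [DecidableEq α] (A : QOp α), ‖A - A‖ ≤ e.gateTotal := by
    intro α _ _ A; simpa using h0
  cases q
  · exact hz D.Vpsi
  · exact hz D.Vpsiᴴ
  · exact hz D.Vproj
  · exact hz D.Vprojᴴ
  · exact h.gateLpsi.bound.trans (by rw [Errors.gateTotal]; linarith)
  · exact h.gateRpsi.bound.trans (by rw [Errors.gateTotal]; linarith)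
  · exact h.gateLproj.bound.trans (by rw [Errors.gateTotal]; linarith)
  · exact h.gateRproj.bound.trans (by rw [Errors.gateTotal]; linarith)

end Circuits

/-! ### Two-qubit gates -/

section Gates
open Matrix
variable {n r m₁ m₂ : ℕ} {W : Type}

/-- The two-qubit operator with matrix entries `⟨a b| U |c d⟩ = g a b c d`. -/
def twoQubit (g : Bool → Bool → Bool → Bool → ℂ) : QOp (Fin 2) := fun x y =>
  g (x 0) (x 1) (y 0) (y 1)

theorem sum_bits_two {M : Type*} [AddCommMonoid M] (F : Bits (Fin 2) → M) :
    ∑ y, F y = ∑ c : Bool, ∑ d : Bool, F ![c, d] := by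
  rw [← Fintype.sum_prod_type' (fun c d => F ![c, d])]
  exact Fintype.sum_equiv (finTwoArrowEquiv Bool) _ _ fun y => by
    congr 1; funext i; fin_cases i <;> rfl

theorem twoQubit_mem_unitaryGroup {g : Bool → Bool → Bool → Bool → ℂ}
    (h : ∀ a b c d, ∑ e, ∑ f, g a b e f * star (g c d e f) = if a = c ∧ b = d then 1 else 0) :
    twoQubit g ∈ unitaryGroup (Bits (Fin 2)) ℂ := by
  refine mem_unitaryGroup_iff.mpr (Matrix.ext fun x y => ?_)
  have hxy : x = y ↔ x 0 = y 0 ∧ x 1 = y 1 := by simp [funext_iff, Fin.forall_fin_two]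
  rw [mul_apply, sum_bits_two, one_apply]
  simp only [hxy]
  exact h (x 0) (x 1) (y 0) (y 1)

/-- The embedding of two qubits onto the wires `p` and `q`. -/
def pairEmb (p q : W) (h : p ≠ q) : Fin 2 ↪ W where
  toFun := ![p, q]
  inj' := by
    intro i j hij
    fin_cases i <;> fin_cases j <;> simp_all [eq_comm]

variable [Fintype W] [DecidableEq W]

theorem applyOn_pairEmb_mulVec {p q : W} (h : p ≠ q) (g : Bool → Bool → Bool → Bool → ℂ)
    (v : QVec W) (x : Bits W) :
    (applyOn (pairEmb p q h) (twoQubit g) *ᵥ v) x = ∑ c, ∑ d, g (x p) (x q) c d *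
      v (Function.update (Function.update x p c) q d) := by
  rw [applyOn_mulVec, sum_bits_two]
  refine Finset.sum_congr rfl fun c _ => Finset.sum_congr rfl fun d _ => ?_
  have : Function.extend (pairEmb p q h) ![c, d] x =
      Function.update (Function.update x p c) q d := by
    funext i
    by_cases hq : i = q
    · subst hq
      rw [Function.update_self]
      exact (pairEmb p i h).injective.extend_apply _ _ 1
    · rw [Function.update_of_ne hq]
      by_cases hp : i = p
      · subst hp
        rw [Function.update_self]
        exact (pairEmb i q h).injective.extend_apply _ _ 0
      · rw [Function.update_of_ne hp, Function.extend_apply']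
        rintro ⟨a, ha⟩
        fin_cases a
        · exact hp ha.symm
        · exact hq ha.symm
  rw [this]
  rfl

/-- Matrix entries of the controlled phase gate `diag(1, 1, 1, ω)`. -/
def ctrlPhaseFun (ω : ℂ) (a b c d : Bool) : ℂ :=
  if a = c ∧ b = d then (if a && b then ω else 1) else 0

/-- Matrix entries of the controlled not gate. -/
def ctrlNotFun (a b c d : Bool) : ℂ := if c = a ∧ d = xor b a then 1 else 0

/-- Matrix entries of `H diag(1, s)` on the first qubit, `H` the Hadamard gate. -/
noncomputable def hadamardPhaseFun (s : ℂ) (a b c d : Bool) : ℂ :=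
  if b = d then ((√2 : ℝ) : ℂ)⁻¹ * ((if a && c then -1 else 1) * (if c then s else 1)) else 0

theorem ctrlPhase_mem {ω : ℂ} (h : ω * star ω = 1) :
    twoQubit (ctrlPhaseFun ω) ∈ unitaryGroup (Bits (Fin 2)) ℂ :=
  twoQubit_mem_unitaryGroup fun a b c d => by
    cases a <;> cases b <;> cases c <;> cases d <;> simp [ctrlPhaseFun] <;> simpa using h

theorem ctrlNot_mem : twoQubit ctrlNotFun ∈ unitaryGroup (Bits (Fin 2)) ℂ :=
  twoQubit_mem_unitaryGroup fun a b c d => by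
    cases a <;> cases b <;> cases c <;> cases d <;> simp [ctrlNotFun]

theorem sqrt_two_inv_mul_self : ((√2 : ℝ) : ℂ)⁻¹ * ((√2 : ℝ) : ℂ)⁻¹ = 1 / 2 := by
  rw [← mul_inv, ← Complex.ofReal_mul, Real.mul_self_sqrt (by norm_num)]; simp

theorem hadamardPhase_mem {s : ℂ} (h : s * star s = 1) :
    twoQubit (hadamardPhaseFun s) ∈ unitaryGroup (Bits (Fin 2)) ℂ :=
  twoQubit_mem_unitaryGroup fun a b c d => by
    have h' : s * (starRingEnd ℂ) s = 1 := h
    have key : ∀ σ ρ : ℂ, ((√2 : ℝ) : ℂ)⁻¹ * ((√2 : ℝ) : ℂ)⁻¹ * (σ * ρ) +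
        ((√2 : ℝ) : ℂ)⁻¹ * ((√2 : ℝ) : ℂ)⁻¹ * (s * (starRingEnd ℂ) s) = (σ * ρ + 1) / 2 := by
      intro σ ρ; rw [sqrt_two_inv_mul_self, h']; ring
    have k1 := key 1 1
    have k2 := key (-1) 1
    cases a <;> cases b <;> cases c <;> cases d <;>
      simp [hadamardPhaseFun] <;> first | linear_combination k1 | linear_combination -k2

/-- The controlled phase gate on the wires `p`, `q`. -/
noncomputable def ctrlPhase (ω : ℂ) (h : ω * star ω = 1) (p q : W) (hpq : p ≠ q) :
    WireOp n r m₁ m₂ W := .gate (pairEmb p q hpq) ⟨_, ctrlPhase_mem h⟩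

/-- The controlled not gate with control `p` and target `q`. -/
noncomputable def ctrlNot (p q : W) (hpq : p ≠ q) : WireOp n r m₁ m₂ W :=
  .gate (pairEmb p q hpq) ⟨_, ctrlNot_mem⟩

/-- The gate `H diag(1, s)` on the wire `p`, with `q` idle. -/
noncomputable def hadamardPhase (s : ℂ) (h : s * star s = 1) (p q : W) (hpq : p ≠ q) :
    WireOp n r m₁ m₂ W := .gate (pairEmb p q hpq) ⟨_, hadamardPhase_mem h⟩

variable (D : Instance n r m₁ m₂)

theorem ctrlPhase_mulVec (ω : ℂ) (h : ω * star ω = 1) (p q : W) (hpq : p ≠ q) (v : QVec W)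
    (x : Bits W) : ((ctrlPhase ω h p q hpq).toMatrix D *ᵥ v) x =
      (if x p && x q then ω else 1) * v x := by
  refine (applyOn_pairEmb_mulVec hpq (ctrlPhaseFun ω) v x).trans ?_
  have hx : Function.update (Function.update x p (x p)) q (x q) = x := by simp
  rw [Finset.sum_eq_single (x p), Finset.sum_eq_single (x q), hx, ctrlPhaseFun,
    if_pos ⟨rfl, rfl⟩]
  · intro d _ hd; rw [ctrlPhaseFun, if_neg fun h => hd h.2.symm, zero_mul]
  · simp
  · intro c _ hc
    exact Finset.sum_eq_zero fun d _ => by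
      rw [ctrlPhaseFun, if_neg fun h => hc h.1.symm, zero_mul]
  · simp

theorem ctrlNot_mulVec (p q : W) (hpq : p ≠ q) (v : QVec W) (x : Bits W) :
    ((ctrlNot p q hpq : WireOp n r m₁ m₂ W).toMatrix D *ᵥ v) x =
      v (Function.update x q (xor (x q) (x p))) := by
  refine (applyOn_pairEmb_mulVec hpq ctrlNotFun v x).trans ?_
  rw [Finset.sum_eq_single (x p), Finset.sum_eq_single (xor (x q) (x p)), ctrlNotFun,
    if_pos ⟨rfl, rfl⟩, one_mul, Function.update_eq_self]
  · intro d _ hd; rw [ctrlNotFun, if_neg fun h => hd h.2, zero_mul]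
  · simp
  · intro c _ hc
    exact Finset.sum_eq_zero fun d _ => by rw [ctrlNotFun, if_neg fun h => hc h.1, zero_mul]
  · simp

theorem hadamardPhase_mulVec (s : ℂ) (h : s * star s = 1) (p q : W) (hpq : p ≠ q) (v : QVec W)
    (x : Bits W) : ((hadamardPhase s h p q hpq).toMatrix D *ᵥ v) x =
      ((√2 : ℝ) : ℂ)⁻¹ * (v (Function.update x p false) +
        ((if x p then -1 else 1) * s) * v (Function.update x p true)) := by
  refine (applyOn_pairEmb_mulVec hpq (hadamardPhaseFun s) v x).trans ?_
  have hd : ∀ c, ∑ d, hadamardPhaseFun s (x p) (x q) c d *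
      v (Function.update (Function.update x p c) q d) =
        hadamardPhaseFun s (x p) (x q) c (x q) * v (Function.update x p c) := by
    intro c
    have : Function.update (Function.update x p c) q (x q) = Function.update x p c := by
      rw [← Function.update_of_ne hpq.symm c x, Function.update_eq_self]
    rw [Finset.sum_eq_single (x q), this]
    · intro d _ hd; rw [hadamardPhaseFun, if_neg fun h => hd h.symm, zero_mul]
    · simp
  simp only [hd]
  rw [Fintype.sum_bool]
  simp only [hadamardPhaseFun, if_true, Bool.and_true, Bool.and_false]
  cases x p <;> simp <;> ring

end Gates

/-! ### Controlled operations and Hadamard tests -/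

section Tests
open Matrix
variable {n r m₁ m₂ : ℕ} {S T : Type} [Fintype S] [DecidableEq S] [Fintype T] [DecidableEq T]

/-- `X` acts as `M` on the left register if the wire `τ` of the right one is set, and as the
identity otherwise. -/
def IsControlled {α : Type} [Fintype α] [DecidableEq α] (τ : T) (M : QOp α) (X : QOp (α ⊕ T)) :
    Prop :=
  ∀ v b, slice (X *ᵥ v) b = if b τ then M *ᵥ slice v b else slice v b

theorem IsControlled.mul {α : Type} [Fintype α] [DecidableEq α] {τ : T} {M N : QOp α}
    {X Y : QOp (α ⊕ T)} (hX : IsControlled τ M X) (hY : IsControlled τ N Y) :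
    IsControlled τ (M * N) (X * Y) := by
  intro v b
  rw [← mulVec_mulVec, hX, hY]
  split_ifs
  · rw [mulVec_mulVec]
  · rfl

theorem isControlled_one {α : Type} [Fintype α] [DecidableEq α] (τ : T) :
    IsControlled τ (1 : QOp α) 1 := by
  intro v b; simp

theorem I_mul_star : Complex.I * star Complex.I = 1 := by simp

theorem neg_I_mul_star : -Complex.I * star (-Complex.I) = 1 := by simp

/-- The doubly controlled sign flip, on the two flag wires and the wire `τ`, as five two-qubit
gates: `(-1)^(abc) = i^(ac) i^(bc) (-i)^((a xor b)c)`. -/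
noncomputable def ctrlFlagSign (n r m₁ m₂ : ℕ) (S : Type) {T : Type} [DecidableEq T] (τ : T) :
    List (WireOp n r m₁ m₂ ((S ⊕ Fin 2) ⊕ T)) :=
  [ctrlPhase Complex.I I_mul_star (Sum.inl (Sum.inr 0)) (Sum.inr τ) (by simp),
    ctrlPhase Complex.I I_mul_star (Sum.inl (Sum.inr 1)) (Sum.inr τ) (by simp),
    ctrlNot (Sum.inl (Sum.inr 0)) (Sum.inl (Sum.inr 1)) (by simp),
    ctrlPhase (-Complex.I) neg_I_mul_star (Sum.inl (Sum.inr 1)) (Sum.inr τ) (by simp),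
    ctrlNot (Sum.inl (Sum.inr 0)) (Sum.inl (Sum.inr 1)) (by simp)]

variable (D : Instance n r m₁ m₂)

theorem isControlled_ctrlFlagSign (τ : T) :
    IsControlled τ (flagSign S) (circuitMatrix D (ctrlFlagSign n r m₁ m₂ S τ)) := by
  intro v b
  funext x
  have hl : slice (circuitMatrix D (ctrlFlagSign n r m₁ m₂ S τ) *ᵥ v) b x =
      (if x (Sum.inr 0) && x (Sum.inr 1) && b τ then -1 else 1) * v (Sum.elim x b) := by
    simp only [slice, ctrlFlagSign, circuitMatrix, Matrix.one_mul, ← mulVec_mulVec]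
    rw [ctrlNot_mulVec, ctrlPhase_mulVec, ctrlNot_mulVec, ctrlPhase_mulVec, ctrlPhase_mulVec]
    have h01 : (Sum.inl (Sum.inr 0) : (S ⊕ Fin 2) ⊕ T) ≠ Sum.inl (Sum.inr 1) := by simp
    simp only [Function.update_self, Function.update_idem, Function.update_of_ne h01,
      Function.update_of_ne (show (Sum.inr τ : (S ⊕ Fin 2) ⊕ T) ≠ Sum.inl (Sum.inr 1) by simp),
      Bool.bne_assoc, bne_self_eq_false, Bool.bne_false, Sum.elim_inl, Sum.elim_inr]
    have hx : Function.update (Sum.elim x b) (Sum.inl (Sum.inr 1)) (x (Sum.inr 1)) =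
        Sum.elim x b := by
      rw [← Sum.elim_inl (f := x) (g := b), Function.update_eq_self]
    rw [hx]
    cases x (Sum.inr 0) <;> cases x (Sum.inr 1) <;> cases b τ <;>
      simp [← mul_assoc]
  have hr : (flagSign S *ᵥ slice v b) x =
      (if x (Sum.inr 0) && x (Sum.inr 1) then -1 else 1) * v (Sum.elim x b) :=
    mulVec_diagonal _ _ _
  rw [hl]
  cases hb : b τ
  · simp [slice]
  · simp only [if_true, hr, Bool.and_true]

/-- The doubly controlled sign flip, conjugated by the circuits `pre` and `post`. These two are not
controlled: they cancel each other if the sign is not flipped. -/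
noncomputable def ctrlReflection (pre post : List (WireOp n r m₁ m₂ (S ⊕ Fin 2))) (τ : T) :
    List (WireOp n r m₁ m₂ ((S ⊕ Fin 2) ⊕ T)) :=
  pre.map (WireOp.map Function.Embedding.inl) ++ (ctrlFlagSign n r m₁ m₂ S τ ++
    post.map (WireOp.map Function.Embedding.inl))

theorem isControlled_ctrlReflection {pre post : List (WireOp n r m₁ m₂ (S ⊕ Fin 2))} (τ : T)
    (h : circuitMatrix D post * circuitMatrix D pre = 1) :
    IsControlled τ (circuitMatrix D post * flagSign S * circuitMatrix D pre)
      (circuitMatrix D (ctrlReflection pre post τ)) := by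
  intro v b
  rw [ctrlReflection, circuitMatrix_append, circuitMatrix_append, circuitMatrix_map,
    circuitMatrix_map, ← mulVec_mulVec, ← mulVec_mulVec, slice_applyOn_inl,
    isControlled_ctrlFlagSign, slice_applyOn_inl]
  split_ifs
  · rw [mulVec_mulVec, mulVec_mulVec, Matrix.mul_assoc]
  · rw [mulVec_mulVec, h, one_mulVec]

/-- The phase applied before the final Hadamard gate of a test: `-i` for a sine test, and none
for a cosine test. -/
noncomputable def testPhase (sine : Bool) : ℂ := if sine then -Complex.I else 1

theorem testPhase_mul_star (sine : Bool) : testPhase sine * star (testPhase sine) = 1 := by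
  cases sine <;> simp [testPhase]

/-- The Hadamard test, on the wire `τ`, of the `j`-th power of the walk. -/
noncomputable def hadamardTest (walk : T → List (WireOp n r m₁ m₂ ((S ⊕ Fin 2) ⊕ T)))
    (j : ℕ) (sine : Bool) (τ : T) : List (WireOp n r m₁ m₂ ((S ⊕ Fin 2) ⊕ T)) :=
  hadamardPhase 1 (by simp) (Sum.inr τ) (Sum.inl (Sum.inr 0)) (by simp) ::
    ((List.replicate j (walk τ)).flatten ++
      [hadamardPhase (testPhase sine) (testPhase_mul_star sine) (Sum.inr τ)
        (Sum.inl (Sum.inr 0)) (by simp)])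

/-- The amplitude `(1 ± s μ ^ j) / 2` of the outcome `b` of a Hadamard test on an eigenvector
with eigenvalue `μ`. -/
noncomputable def testAmplitude (j : ℕ) (sine b : Bool) (μ : ℂ) : ℂ :=
  (1 / 2) * (1 + ((if b then -1 else 1) * testPhase sine) * μ ^ j)

/-- The operator applied to the system when a Hadamard test of `M ^ j` has the outcome `b`. -/
noncomputable def testOperator {α : Type} [Fintype α] [DecidableEq α] (M : QOp α) (j : ℕ)
    (sine b : Bool) : QOp α :=
  (1 / 2 : ℂ) • (1 + ((if b then -1 else 1) * testPhase sine) • M ^ j)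

theorem slice_hadamardPhase (s : ℂ) (h : s * star s = 1) (τ : T) (v : QVec ((S ⊕ Fin 2) ⊕ T))
    (b : Bits T) :
    slice ((hadamardPhase s h (Sum.inr τ) (Sum.inl (Sum.inr 0)) (by simp)).toMatrix D *ᵥ v) b =
      ((√2 : ℝ) : ℂ)⁻¹ • (slice v (Function.update b τ false) +
        ((if b τ then -1 else 1) * s) • slice v (Function.update b τ true)) := by
  funext x
  have hu : ∀ c, Function.update (Sum.elim x b) (Sum.inr τ) c =
      Sum.elim x (Function.update b τ c) := fun c => by rw [Sum.update_elim_inr]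
  simp only [slice, hadamardPhase_mulVec, hu, Sum.elim_inr, Pi.smul_apply, Pi.add_apply,
    smul_eq_mul]
  rfl

theorem isControlled_replicate {walk : List (WireOp n r m₁ m₂ ((S ⊕ Fin 2) ⊕ T))}
    {M : QOp (S ⊕ Fin 2)} {τ : T} (h : IsControlled τ M (circuitMatrix D walk)) (j : ℕ) :
    IsControlled τ (M ^ j) (circuitMatrix D (List.replicate j walk).flatten) := by
  induction j with
  | zero => simpa [circuitMatrix] using isControlled_one τ
  | succ j ih =>
    rw [List.replicate_succ, List.flatten_cons, circuitMatrix_append, pow_succ]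
    exact ih.mul h

/-- A Hadamard test on a wire in state zero applies to the system the operator of its outcome. -/
theorem slice_hadamardTest {walk : T → List (WireOp n r m₁ m₂ ((S ⊕ Fin 2) ⊕ T))}
    {M : QOp (S ⊕ Fin 2)} {τ : T} (h : IsControlled τ M (circuitMatrix D (walk τ))) (j : ℕ)
    (sine : Bool) {v : QVec ((S ⊕ Fin 2) ⊕ T)} (hv : ∀ b, b τ = true → slice v b = 0)
    (b : Bits T) :
    slice (circuitMatrix D (hadamardTest walk j sine τ) *ᵥ v) b =
      testOperator M j sine (b τ) *ᵥ slice v (Function.update b τ false) := by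
  rw [hadamardTest, circuitMatrix, circuitMatrix_append, ← mulVec_mulVec, ← mulVec_mulVec]
  simp only [circuitMatrix, Matrix.one_mul]
  rw [slice_hadamardPhase]
  simp only [isControlled_replicate D h j _ _, slice_hadamardPhase, Function.update_self,
    Function.update_idem, hv (Function.update b τ true) (by simp), smul_zero, add_zero,
    Bool.false_eq_true, if_false, if_true]
  rw [testOperator, smul_mulVec, add_mulVec, one_mulVec, smul_mulVec, mulVec_smul,
    ← sqrt_two_inv_mul_self]
  module

/-- The product of the operators of a sequence of tests with outcomes `b`. -/
noncomputable def testProduct {α : Type} [Fintype α] [DecidableEq α] (M : QOp α) (pow : T → ℕ)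
    (sine : T → Bool) (b : Bits T) : List T → QOp α
  | [] => 1
  | τ :: l => testProduct M pow sine b l * testOperator M (pow τ) (sine τ) (b τ)

/-- Tests performed one after the other on the same system apply the product of their operators;
unused test wires stay zero. -/
theorem slice_hadamardTests {walk : T → List (WireOp n r m₁ m₂ ((S ⊕ Fin 2) ⊕ T))}
    {M : QOp (S ⊕ Fin 2)} (h : ∀ τ, IsControlled τ M (circuitMatrix D (walk τ)))
    (pow : T → ℕ) (sine : T → Bool) (l : List T) (hl : l.Nodup) :
    ∀ {v : QVec ((S ⊕ Fin 2) ⊕ T)}, (∀ b, ∀ τ ∈ l, b τ = true → slice v b = 0) →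
      ∀ b, slice (circuitMatrix D
        (l.flatMap fun τ => hadamardTest walk (pow τ) (sine τ) τ) *ᵥ v) b =
          testProduct M pow sine b l *ᵥ slice v fun τ => if τ ∈ l then false else b τ := by
  induction l with
  | nil => intro v _ b; simp [circuitMatrix, testProduct]
  | cons τ l ih =>
    intro v hv b
    obtain ⟨hτ, hl⟩ := List.nodup_cons.mp hl
    have h1 := slice_hadamardTest D (h τ) (pow τ) (sine τ) (v := v)
      fun b => hv b τ List.mem_cons_self
    rw [List.flatMap_cons, circuitMatrix_append, ← mulVec_mulVec, ih hl, h1, testProduct,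
      mulVec_mulVec, if_neg hτ]
    · congr 2
      funext σ
      by_cases hσ : σ = τ
      · subst hσ; simp
      · simp [hσ]
    · intro b σ hσ hb
      have hne : σ ≠ τ := fun h => hτ (h ▸ hσ)
      rw [h1, hv _ σ (List.mem_cons_of_mem _ hσ) (by rwa [Function.update_of_ne hne]),
        mulVec_zero]

/-- In an eigenbasis of `M`, with `Z` the change of basis, a sequence of tests multiplies the
coordinates by the products of the amplitudes. -/
theorem mul_testProduct {α : Type} [Fintype α] [DecidableEq α] {M Z : QOp α} {μ : Bits α → ℂ}
    (h : Z * M = diagonal μ * Z) (pow : T → ℕ) (sine : T → Bool) (b : Bits T) (l : List T) :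
    Z * testProduct M pow sine b l = diagonal (fun i =>
      (l.map fun τ => testAmplitude (pow τ) (sine τ) (b τ) (μ i)).prod) * Z := by
  have hpow : ∀ j, Z * M ^ j = diagonal (fun i => μ i ^ j) * Z := by
    intro j
    induction j with
    | zero => simp
    | succ j ih =>
      rw [pow_succ, ← Matrix.mul_assoc, ih, Matrix.mul_assoc, h, ← Matrix.mul_assoc,
        diagonal_mul_diagonal]
      rfl
  have hop : ∀ j s c, Z * testOperator M j s c =
      diagonal (fun i => testAmplitude j s c (μ i)) * Z := by
    intro j s c
    have : (diagonal fun i => testAmplitude j s c (μ i)) = (1 / 2 : ℂ) • (1 +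
        ((if c then -1 else 1) * testPhase s) • diagonal (fun i => μ i ^ j)) := by
      rw [← diagonal_one, ← diagonal_smul, diagonal_add, ← diagonal_smul]
      rfl
    rw [this, testOperator, mul_smul_comm, mul_add, mul_smul_comm, hpow, smul_mul_assoc,
      add_mul, smul_mul_assoc, Matrix.mul_one, Matrix.one_mul]
  induction l with
  | nil => simp [testProduct]
  | cons τ l ih =>
    rw [testProduct, ← Matrix.mul_assoc, ih, Matrix.mul_assoc, hop, ← Matrix.mul_assoc,
      diagonal_mul_diagonal]
    congr 2
    funext i
    rw [List.map_cons, List.prod_cons, mul_comm]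

end Tests

/-! ### Concentration for independent samples -/

section Concentration
variable {ι Ω : Type*} [Fintype ι] [DecidableEq ι] [Fintype Ω]

theorem sum_prod_eq_one {p : ι → Ω → ℝ} (hp : ∀ i, ∑ x, p i x = 1) :
    ∑ ω : ι → Ω, ∏ i, p i (ω i) = 1 := by
  classical
  rw [← Fintype.piFinset_univ, ← Finset.prod_univ_sum]
  simp [hp]

/-- Hoeffding's inequality for independent centred variables bounded by one, by the exponential
moment method. -/
theorem sum_prod_tail_le {p : ι → Ω → ℝ} (hp0 : ∀ i x, 0 ≤ p i x) (hp : ∀ i, ∑ x, p i x = 1)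
    {f : ι → Ω → ℝ} (hf : ∀ i x, |f i x| ≤ 1) (s : Finset ι)
    (hmean : ∀ i ∈ s, ∑ x, p i x * f i x = 0) {a : ℝ} (ha : 0 ≤ a) (ha' : a ≤ 2) :
    ∑ ω : ι → Ω with a * s.card ≤ ∑ i ∈ s, f i (ω i), ∏ i, p i (ω i) ≤
      Real.exp (-(s.card * (a ^ 2 / 4))) := by
  classical
  set t := a / 2 with ht
  let g : ι → Ω → ℝ := fun i x => if i ∈ s then Real.exp (t * f i x) else 1
  have hg0 : ∀ i x, 0 ≤ g i x := fun i x => by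
    simp only [g]; split_ifs <;> positivity
  have hprod : ∀ ω : ι → Ω, ∏ i, g i (ω i) = Real.exp (t * ∑ i ∈ s, f i (ω i)) := by
    intro ω
    simp only [g]
    rw [Finset.prod_ite_mem, Finset.univ_inter, ← Real.exp_sum, Finset.mul_sum]
  have hfac : ∀ i, ∑ x, p i x * g i x ≤ if i ∈ s then Real.exp (t ^ 2) else 1 := by
    intro i
    by_cases hi : i ∈ s
    · simp only [g, hi, if_true]
      have hx : ∀ x, p i x * Real.exp (t * f i x) ≤ p i x * (1 + t ^ 2) + t * (p i x * f i x) := by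
        intro x
        have h1 : |t * f i x| ≤ 1 := by
          rw [abs_mul, abs_of_nonneg (by positivity : 0 ≤ t)]
          nlinarith [hf i x, abs_nonneg (f i x)]
        have h2 := (abs_le.mp (Real.abs_exp_sub_one_sub_id_le h1)).2
        have h3 : f i x ^ 2 ≤ 1 := by
          rw [← sq_abs]; exact pow_le_one₀ (abs_nonneg _) (hf i x)
        have h4 : Real.exp (t * f i x) ≤ (1 + t ^ 2) + t * f i x := by
          nlinarith [sq_nonneg t]
        nlinarith [mul_le_mul_of_nonneg_left h4 (hp0 i x)]
      calc _ ≤ ∑ x, (p i x * (1 + t ^ 2) + t * (p i x * f i x)) :=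
            Finset.sum_le_sum fun x _ => hx x
        _ = 1 + t ^ 2 := by
            rw [Finset.sum_add_distrib, ← Finset.sum_mul, ← Finset.mul_sum, hp, hmean i hi]; ring
        _ ≤ _ := by linarith [Real.add_one_le_exp (t ^ 2)]
    · simp [g, hi, hp]
  have hle : ∑ ω : ι → Ω with a * s.card ≤ ∑ i ∈ s, f i (ω i), ∏ i, p i (ω i) ≤
      ∑ ω : ι → Ω, Real.exp (-(t * (a * s.card))) * ∏ i, (p i (ω i) * g i (ω i)) := by
    rw [Finset.sum_filter]
    refine Finset.sum_le_sum fun ω _ => ?_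
    have h0 : 0 ≤ ∏ i, p i (ω i) := Finset.prod_nonneg fun i _ => hp0 i _
    rw [Finset.prod_mul_distrib, hprod, mul_left_comm, ← Real.exp_add]
    split_ifs with h
    · refine le_mul_of_one_le_right h0 (Real.one_le_exp ?_)
      nlinarith [mul_le_mul_of_nonneg_left h (by positivity : 0 ≤ t)]
    · positivity
  refine hle.trans ?_
  rw [← Finset.mul_sum, ← Fintype.piFinset_univ,
    ← Finset.prod_univ_sum (fun _ => Finset.univ) fun i x => p i x * g i x]
  have hpr : ∏ i, ∑ x, p i x * g i x ≤ Real.exp (t ^ 2 * s.card) := by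
    refine (Finset.prod_le_prod (fun i _ => Finset.sum_nonneg fun x _ =>
      mul_nonneg (hp0 i x) (hg0 i x)) fun i _ => hfac i).trans ?_
    rw [Finset.prod_ite_mem, Finset.univ_inter, Finset.prod_const, ← Real.exp_nat_mul, mul_comm]
  calc _ ≤ Real.exp (-(t * (a * s.card))) * Real.exp (t ^ 2 * s.card) := by gcongr
    _ = _ := by rw [← Real.exp_add]; congr 1; rw [ht]; ring

/-- Union bound. -/
theorem sum_filter_le_sum_sum_filter {κ : Type*} [Fintype κ] {w : Ω → ℝ} (hw : ∀ x, 0 ≤ w x)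
    (B : Ω → Prop) [DecidablePred B] (E : κ → Ω → Prop) [∀ k, DecidablePred (E k)]
    (h : ∀ x, B x → ∃ k, E k x) :
    ∑ x with B x, w x ≤ ∑ k, ∑ x with E k x, w x := by
  simp only [Finset.sum_filter]
  rw [Finset.sum_comm]
  refine Finset.sum_le_sum fun x _ => ?_
  have hnn : ∀ k ∈ Finset.univ, 0 ≤ if E k x then w x else 0 := fun k _ => by
    split_ifs <;> simp [hw]
  split_ifs with hB
  · obtain ⟨k, hk⟩ := h x hB
    refine le_trans ?_ (Finset.single_le_sum hnn (Finset.mem_univ k))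
    rw [if_pos hk]
  · exact Finset.sum_nonneg hnn

end Concentration

/-! ### Amplification by medians -/

section Median

/-- A median of a sequence of real numbers: the least `y` such that more than half of the terms
are at most `y`. -/
noncomputable def median {N : ℕ} (x : Fin N → ℝ) : ℝ :=
  sInf {y | N < 2 * (Finset.univ.filter fun j => x j ≤ y).card}

/-- The median is as accurate as the majority of the terms. -/
theorem abs_median_sub_le {N : ℕ} {x : Fin N → ℝ} {t δ : ℝ}
    (h : N < 2 * (Finset.univ.filter fun j => |x j - t| ≤ δ).card) : |median x - t| ≤ δ := by
  have hlow : ∀ y ∈ {y | N < 2 * (Finset.univ.filter fun j => x j ≤ y).card}, t - δ ≤ y := by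
    intro y hy
    by_contra hlt
    push Not at hlt
    have hd : Disjoint (Finset.univ.filter fun j => |x j - t| ≤ δ)
        (Finset.univ.filter fun j => x j ≤ y) := by
      refine Finset.disjoint_filter.mpr fun j _ h1 h2 => ?_
      have := (abs_le.mp h1).1
      linarith
    have h1 := Finset.card_union_of_disjoint hd
    have h2 := Finset.card_le_univ ((Finset.univ.filter fun j => |x j - t| ≤ δ) ∪
      (Finset.univ.filter fun j => x j ≤ y))
    rw [Fintype.card_fin] at h2
    have h3 : N < 2 * (Finset.univ.filter fun j => x j ≤ y).card := hy
    omega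
  have hmem : t + δ ∈ {y | N < 2 * (Finset.univ.filter fun j => x j ≤ y).card} := by
    refine lt_of_lt_of_le h (Nat.mul_le_mul_left 2 (Finset.card_le_card ?_))
    intro j hj
    simp only [Finset.mem_filter, Finset.mem_univ, true_and] at hj ⊢
    linarith [(abs_le.mp hj).2]
  have h1 := le_csInf ⟨_, hmem⟩ hlow
  have h2 := csInf_le ⟨t - δ, hlow⟩ hmem
  rw [abs_le, median]
  constructor <;> linarith

/-- If a single sample yields a `δ`-accurate estimate with probability at least `3/4`, then the
median of `64 log (1/η)` samples is `δ`-accurate with probability at least `1 - η`. -/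
theorem le_sum_median {Ω : Type*} [Fintype Ω] {p : Ω → ℝ} (hp0 : ∀ x, 0 ≤ p x)
    (hp : ∑ x, p x = 1) {est : Ω → ℝ} {t δ η : ℝ} (hη : 0 < η)
    (h : 3 / 4 ≤ ∑ x with |est x - t| ≤ δ, p x) {N : ℕ} (hN : 64 * Real.log (1 / η) ≤ N) :
    1 - η ≤ ∑ ω : Fin N → Ω with |median (fun i => est (ω i)) - t| ≤ δ, ∏ i, p (ω i) := by
  classical
  set q := ∑ x with ¬ |est x - t| ≤ δ, p x with hq
  have hsplit := Finset.sum_filter_add_sum_filter_not Finset.univ (fun x => |est x - t| ≤ δ) p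
  rw [hp] at hsplit
  have hq0 : 0 ≤ q := Finset.sum_nonneg fun x _ => hp0 x
  have hq1 : q ≤ 1 / 4 := by linarith
  have hsplit' := Finset.sum_filter_add_sum_filter_not Finset.univ
    (fun ω : Fin N → Ω => |median (fun i => est (ω i)) - t| ≤ δ) fun ω => ∏ i, p (ω i)
  rw [sum_prod_eq_one (p := fun _ : Fin N => p) fun _ => hp] at hsplit'
  let f : Fin N → Ω → ℝ := fun _ x => (if ¬ |est x - t| ≤ δ then 1 else 0) - q
  have htail := sum_prod_tail_le (p := fun _ : Fin N => p) (fun _ => hp0) (fun _ => hp) (f := f)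
    (fun i x => by simp only [f]; rw [abs_le]; split_ifs <;> constructor <;> linarith)
    Finset.univ (fun i _ => by
      simp only [f, mul_sub, Finset.sum_sub_distrib, ← Finset.sum_mul, hp, mul_ite, mul_one,
        mul_zero]
      rw [← Finset.sum_filter, ← hq]; ring)
    (a := 1 / 4) (by norm_num) (by norm_num)
  have hle : ∑ ω : Fin N → Ω with ¬ |median (fun i => est (ω i)) - t| ≤ δ, ∏ i, p (ω i) ≤
      ∑ ω : Fin N → Ω with (1 / 4 : ℝ) * (Finset.univ : Finset (Fin N)).card ≤
        ∑ i ∈ Finset.univ, f i (ω i), ∏ i, p (ω i) := by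
    refine Finset.sum_le_sum_of_subset_of_nonneg ?_ fun ω _ _ =>
      Finset.prod_nonneg fun i _ => hp0 _
    intro ω hω
    simp only [Finset.mem_filter, Finset.mem_univ, true_and] at hω ⊢
    have h1 := mt abs_median_sub_le hω
    push Not at h1
    have h2 := Finset.card_filter_add_card_filter_not (s := Finset.univ) (fun i : Fin N =>
      |est (ω i) - t| ≤ δ)
    simp only [f, Finset.sum_sub_distrib, Finset.sum_const, Finset.card_univ, Fintype.card_fin,
      nsmul_eq_mul, Finset.sum_boole] at h2 ⊢
    have h3 : (N : ℝ) ≤ 2 * ((Finset.univ.filter fun i => ¬ |est (ω i) - t| ≤ δ).card : ℝ) := by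
      exact_mod_cast (by omega :
        N ≤ 2 * (Finset.univ.filter fun i => ¬ |est (ω i) - t| ≤ δ).card)
    nlinarith [(Nat.cast_nonneg N : (0 : ℝ) ≤ N)]
  have hexp : Real.exp (-((Finset.univ : Finset (Fin N)).card * ((1 / 4 : ℝ) ^ 2 / 4))) ≤ η := by
    rw [Finset.card_univ, Fintype.card_fin]
    calc _ ≤ Real.exp (-Real.log (1 / η)) := Real.exp_le_exp.mpr (by linarith)
      _ = η := by rw [one_div, Real.log_inv, neg_neg, Real.exp_log hη]
  linarith

end Median

/-! ### Decoding a phase from Hadamard tests of its dyadic powers -/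

section Decoding

/-- If the `2^k`-th powers of a point of the unit circle stay within distance one of `1` for all
`k ≤ K`, then the point itself is within `O(2^(-K))` of `1`: the squared tangent of half the angle
at least quadruples under squaring. -/
theorem norm_sub_one_sq_le (K : ℕ) : ∀ ρ : ℂ, ‖ρ‖ = 1 → (∀ k ≤ K, ‖ρ ^ 2 ^ k - 1‖ ≤ 1) →
    3 * 4 ^ K * ‖ρ - 1‖ ^ 2 ≤ 4 - ‖ρ - 1‖ ^ 2 := by
  induction K with
  | zero =>
    intro ρ _ h
    have h0 := h 0 le_rfl
    simp only [pow_zero, pow_one] at h0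
    have := pow_le_one₀ (n := 2) (norm_nonneg _) h0
    linarith
  | succ K ih =>
    intro ρ hρ h
    have h0 := h 0 (Nat.zero_le _)
    simp only [pow_zero, pow_one] at h0
    have hx : ‖ρ - 1‖ ^ 2 ≤ 1 := pow_le_one₀ (norm_nonneg _) h0
    have hsq := ih (ρ ^ 2) (by simp [hρ]) fun k hk => by
      rw [← pow_mul, ← pow_succ']; exact h (k + 1) (by omega)
    have hpar : ‖ρ + 1‖ ^ 2 = 4 - ‖ρ - 1‖ ^ 2 := by
      have := parallelogram_law_with_norm ℝ ρ 1
      rw [hρ, norm_one] at this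
      nlinarith
    have hfac : ‖ρ ^ 2 - 1‖ ^ 2 = ‖ρ - 1‖ ^ 2 * (4 - ‖ρ - 1‖ ^ 2) := by
      rw [← hpar, ← mul_pow, ← norm_mul]; congr 2; ring
    rw [hfac] at hsq
    generalize ‖ρ - 1‖ ^ 2 = x at *
    have h4 : 0 < 4 - x := by linarith
    refine le_of_mul_le_mul_right ?_ h4
    rw [pow_succ]
    nlinarith

/-- Points of the unit circle whose dyadic powers up to `2 ^ K` are close are
`O(2 ^ (-K))`-close. -/
theorem norm_sub_le_of_dyadic_powers {K : ℕ} {μ ν : ℂ} (hμ : ‖μ‖ = 1) (hν : ‖ν‖ = 1)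
    (h : ∀ k ≤ K, ‖ν ^ 2 ^ k - μ ^ 2 ^ k‖ ≤ 1) : ‖ν - μ‖ ≤ 2 / 2 ^ K := by
  have hμ0 : μ ≠ 0 := norm_ne_zero_iff.mp (by rw [hμ]; exact one_ne_zero)
  have hpow : ∀ j : ℕ, ‖(ν / μ) ^ j - 1‖ = ‖ν ^ j - μ ^ j‖ := by
    intro j
    have : (ν / μ) ^ j - 1 = (ν ^ j - μ ^ j) / μ ^ j := by
      rw [div_pow, sub_div, div_self (pow_ne_zero _ hμ0)]
    rw [this, norm_div, norm_pow, hμ, one_pow, div_one]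
  have h1 := norm_sub_one_sq_le K (ν / μ) (by rw [norm_div, hμ, hν, div_one])
    fun k hk => by rw [hpow]; exact h k hk
  have h2 := hpow 1
  simp only [pow_one] at h2
  rw [h2] at h1
  rw [le_div_iff₀ (by positivity)]
  have h3 : (4 : ℝ) ^ K = (2 ^ K) ^ 2 := by rw [← pow_mul, mul_comm, pow_mul]; norm_num
  rw [h3] at h1
  have h4 : (‖ν - μ‖ * 2 ^ K) ^ 2 ≤ 2 ^ 2 := by
    nlinarith [sq_nonneg ‖ν - μ‖, sq_nonneg (‖ν - μ‖ * 2 ^ K)]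
  exact (pow_le_pow_iff_left₀ (by positivity) (by norm_num) two_ne_zero).mp h4

/-- The number of tests of each kind of the power `2 ^ k`: low powers are tested more often, so
that the failure probabilities have a bounded sum, at a total cost of `O(2 ^ K)`. The factor makes
the failure probability of one average at most `exp (-10 (K + 1 - k))`. -/
def testCount (K k : ℕ) : ℕ := 1440 * (K + 1 - k)

/-- The tests of phase estimation with `K + 1` levels: level, kind (cosine or sine), number. -/
abbrev PhaseTest (K : ℕ) : Type := Σ k : Fin (K + 1), Bool × Fin (testCount K k)

/-- The value of an outcome: `1` for `false`, and `-1` for `true`. -/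
def outcomeSign (b : Bool) : ℝ := if b then -1 else 1

/-- The average of the outcomes of the tests of one level and kind. On an eigenvector with
eigenvalue `μ` its expectation is the real part (cosine tests) or the imaginary part (sine tests) of
`μ ^ 2 ^ k`. -/
noncomputable def testAverage {K : ℕ} (b : Bits (PhaseTest K)) (k : Fin (K + 1)) (sine : Bool) :
    ℝ :=
  (∑ i, outcomeSign (b ⟨k, sine, i⟩)) / testCount K k

/-- A point of the unit circle whose dyadic powers fit all averages to within `1/2`. -/
def IsConsistent {K : ℕ} (b : Bits (PhaseTest K)) (ν : ℂ) : Prop :=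
  ‖ν‖ = 1 ∧ ∀ k : Fin (K + 1),
    ‖(testAverage b k false + testAverage b k true * Complex.I : ℂ) - ν ^ 2 ^ (k : ℕ)‖ ≤ 1 / 2

open Classical in
/-- The estimate of `|1 + μ| / 2` from the outcomes of the tests on an eigenvector with eigenvalue
`μ`: its value at any consistent point of the circle (and zero if there is none). -/
noncomputable def decode {K : ℕ} (b : Bits (PhaseTest K)) : ℝ :=
  if h : ∃ ν, IsConsistent b ν then ‖1 + h.choose‖ / 2 else 0

theorem abs_decode_sub_le {K : ℕ} {b : Bits (PhaseTest K)} {μ : ℂ} (h : IsConsistent b μ) :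
    |decode b - ‖1 + μ‖ / 2| ≤ 1 / 2 ^ K := by
  have hex : ∃ ν, IsConsistent b ν := ⟨μ, h⟩
  rw [decode, dif_pos hex]
  have hν := hex.choose_spec
  set ν := hex.choose
  have h1 := norm_sub_le_of_dyadic_powers (K := K) h.1 hν.1 fun k hk => by
    have h1 := h.2 ⟨k, by omega⟩
    have h2 := hν.2 ⟨k, by omega⟩
    rw [norm_sub_rev] at h2
    have := norm_sub_le_norm_sub_add_norm_sub (ν ^ 2 ^ k) _ (μ ^ 2 ^ k) |>.trans
      (add_le_add h2 h1)
    linarith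
  have h2 := abs_norm_sub_norm_le (1 + ν) (1 + μ)
  rw [add_sub_add_left_eq_sub] at h2
  rw [← sub_div, abs_div, abs_two, div_le_iff₀ two_pos]
  refine h2.trans (h1.trans (le_of_eq (by ring)))

theorem norm_testAmplitude_sq (j : ℕ) (sine b : Bool) {μ : ℂ} (hμ : ‖μ‖ = 1) :
    ‖testAmplitude j sine b μ‖ ^ 2 =
      (1 + outcomeSign b * if sine then (μ ^ j).im else (μ ^ j).re) / 2 := by
  have hz : ‖μ ^ j‖ ^ 2 = 1 := by rw [norm_pow, hμ, one_pow, one_pow]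
  rw [testAmplitude]
  generalize μ ^ j = z at *
  rw [← Complex.normSq_eq_norm_sq, Complex.normSq_apply] at hz ⊢
  cases sine <;> cases b <;>
    simp [testPhase, outcomeSign] <;> linear_combination (1 / 4 : ℝ) * hz

end Decoding

/-! ### Success probability of phase estimation on an eigenvector -/

section PhaseProbability

theorem sum_bool_outcome (c : ℝ) (F : ℝ → ℝ) :
    ∑ b : Bool, (1 + outcomeSign b * c) / 2 * F (outcomeSign b) =
      (1 - c) / 2 * F (-1) + (1 + c) / 2 * F 1 := by
  simp only [Fintype.sum_bool, outcomeSign, if_true, Bool.false_eq_true, if_false]; ring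

theorem sum_geometric_le (K : ℕ) : ∑ k : Fin (K + 1), ((1 : ℝ) / 1000) ^ (K + 1 - (k : ℕ)) ≤
    1 / 999 := by
  rw [Finset.sum_range (fun k => ((1 : ℝ) / 1000) ^ (K + 1 - k)) |>.symm,
    ← Finset.sum_range_reflect]
  have h : ∀ n : ℕ, ∑ i ∈ Finset.range n, ((1 : ℝ) / 1000) ^ (i + 1) =
      (1 - (1 / 1000) ^ n) / 999 := by
    intro n
    induction n with
    | zero => simp
    | succ n ih => rw [Finset.sum_range_succ, ih]; ring
  have h2 : ∀ i ∈ Finset.range (K + 1), ((1 : ℝ) / 1000) ^ (K + 1 - (K + 1 - 1 - i)) =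
      (1 / 1000) ^ (i + 1) := by
    intro i hi
    rw [Finset.mem_range] at hi
    congr 1; omega
  rw [Finset.sum_congr rfl h2, h]
  have : (0 : ℝ) ≤ (1 / 1000) ^ (K + 1) := by positivity
  linarith

theorem exp_neg_testCount_le (K : ℕ) (k : Fin (K + 1)) :
    Real.exp (-(testCount K k * (((1 : ℝ) / 6) ^ 2 / 4))) ≤ (1 / 1000) ^ (K + 1 - (k : ℕ)) := by
  have h10 : Real.exp (-10) ≤ 1 / 1000 := by
    rw [Real.exp_neg, ← one_div]
    refine one_div_le_one_div_of_le (by norm_num) ?_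
    have h1 : Real.exp 10 = Real.exp 1 ^ 10 := by rw [← Real.exp_nat_mul]; norm_num
    rw [h1]
    have h2 : (2 : ℝ) ≤ Real.exp 1 := by linarith [Real.add_one_le_exp (1 : ℝ)]
    calc (1000 : ℝ) ≤ 2 ^ 10 := by norm_num
      _ ≤ _ := pow_le_pow_left₀ (by norm_num) h2 10
  have h3 : -(testCount K k * (((1 : ℝ) / 6) ^ 2 / 4)) = (K + 1 - (k : ℕ) : ℕ) * (-10 : ℝ) := by
    rw [testCount, Nat.cast_mul]; push_cast; ring
  rw [h3, Real.exp_nat_mul]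
  exact pow_le_pow_left₀ (Real.exp_pos _).le h10 _

/-- On an eigenvector with eigenvalue `μ`, the outcomes of the tests are independent, and the
decoded value is `2 ^ (-K)`-close to `|1 + μ| / 2` with high probability. -/
theorem le_sum_decode (K : ℕ) {μ : ℂ} (hμ : ‖μ‖ = 1) :
    199 / 200 ≤ ∑ b : Bits (PhaseTest K) with |decode b - ‖1 + μ‖ / 2| ≤ 1 / 2 ^ K,
      ∏ τ, ‖testAmplitude (2 ^ (τ.1 : ℕ)) τ.2.1 (b τ) μ‖ ^ 2 := by
  classical
  let p : PhaseTest K → Bool → ℝ := fun τ x =>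
    ‖testAmplitude (2 ^ (τ.1 : ℕ)) τ.2.1 x μ‖ ^ 2
  let c : Fin (K + 1) → Bool → ℝ := fun k s =>
    if s then (μ ^ 2 ^ (k : ℕ)).im else (μ ^ 2 ^ (k : ℕ)).re
  have hpc : ∀ τ x, p τ x = (1 + outcomeSign x * c τ.1 τ.2.1) / 2 := fun τ x =>
    norm_testAmplitude_sq _ _ _ hμ
  have hc : ∀ k s, |c k s| ≤ 1 := by
    intro k s
    have h1 : ‖μ ^ 2 ^ (k : ℕ)‖ = 1 := by rw [norm_pow, hμ, one_pow]
    rw [← h1]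
    simp only [c]
    split_ifs
    · exact Complex.abs_im_le_norm _
    · exact Complex.abs_re_le_norm _
  have hp0 : ∀ τ x, 0 ≤ p τ x := fun τ x => by positivity
  have hp1 : ∀ τ, ∑ x, p τ x = 1 := by
    intro τ
    have := sum_bool_outcome (c τ.1 τ.2.1) fun _ => 1
    simp only [mul_one] at this
    simp only [hpc]
    linarith
  let f : Bool → PhaseTest K → Bool → ℝ := fun g τ x =>
    outcomeSign g * (outcomeSign x - c τ.1 τ.2.1) / 2
  have hf : ∀ g τ x, |f g τ x| ≤ 1 := by
    intro g τ x
    have h1 := abs_le.mp (hc τ.1 τ.2.1)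
    simp only [f]
    rw [abs_le]
    cases g <;> cases x <;> simp [outcomeSign] <;> constructor <;> linarith
  have hmean : ∀ g τ, ∑ x, p τ x * f g τ x = 0 := by
    intro g τ
    simp only [hpc]
    rw [sum_bool_outcome (c τ.1 τ.2.1) fun y => outcomeSign g * (y - c τ.1 τ.2.1) / 2]
    ring
  let s : Fin (K + 1) → Bool → Finset (PhaseTest K) := fun k sine =>
    Finset.univ.map ⟨fun i : Fin (testCount K k) => (⟨k, sine, i⟩ : PhaseTest K), fun i j h => by
      simpa using h⟩
  have hcard : ∀ k sine, (s k sine).card = testCount K k := by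
    intro k sine; simp [s]
  -- the bad events: level, kind of test, and direction of the deviation
  have htail : ∀ e : Fin (K + 1) × Bool × Bool,
      ∑ b : Bits (PhaseTest K) with (1 / 6 : ℝ) * (s e.1 e.2.1).card ≤
        ∑ τ ∈ s e.1 e.2.1, f e.2.2 τ (b τ), ∏ τ, p τ (b τ) ≤
          (1 / 1000) ^ (K + 1 - (e.1 : ℕ)) := by
    intro e
    refine (sum_prod_tail_le hp0 hp1 (hf e.2.2) (s e.1 e.2.1) (fun τ _ => hmean e.2.2 τ)
      (a := 1 / 6) (by norm_num) (by norm_num)).trans ?_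
    rw [hcard]
    exact exp_neg_testCount_le K e.1
  have hbad : ∀ b : Bits (PhaseTest K), ¬ |decode b - ‖1 + μ‖ / 2| ≤ 1 / 2 ^ K →
      ∃ e : Fin (K + 1) × Bool × Bool, (1 / 6 : ℝ) * (s e.1 e.2.1).card ≤
        ∑ τ ∈ s e.1 e.2.1, f e.2.2 τ (b τ) := by
    intro b hb
    by_contra hcon
    push Not at hcon
    refine hb (abs_decode_sub_le ⟨hμ, fun k => ?_⟩)
    have hm : (0 : ℝ) < testCount K k := by
      have : 0 < testCount K k := by rw [testCount]; omega
      exact_mod_cast this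
    -- an error of `1/3` in both coordinates is one of `√2 / 3 < 1/2` in the plane
    have hav : ∀ sine, |testAverage b k sine - c k sine| ≤ 1 / 3 := by
      intro sine
      have hsum : ∀ g, ∑ τ ∈ s k sine, f g τ (b τ) =
          outcomeSign g * (testCount K k * (testAverage b k sine - c k sine)) / 2 := by
        intro g
        have h1 : ∑ τ ∈ s k sine, f g τ (b τ) = ∑ i : Fin (testCount K k),
            outcomeSign g * (outcomeSign (b ⟨k, sine, i⟩) - c k sine) / 2 :=
          Finset.sum_map _ _ _
        rw [h1, ← Finset.sum_div, ← Finset.mul_sum, Finset.sum_sub_distrib, testAverage,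
          mul_sub (testCount K k : ℝ), mul_div_cancel₀ _ hm.ne']
        simp
      have h1 := hcon (k, sine, false)
      have h2 := hcon (k, sine, true)
      simp only [hsum, hcard] at h1 h2
      simp only [outcomeSign, if_true, Bool.false_eq_true, if_false] at h1 h2
      rw [abs_le]
      constructor
      · by_contra hlt; push Not at hlt; nlinarith
      · by_contra hlt; push Not at hlt; nlinarith
    have h1 := hav false
    have h2 := hav true
    simp only [c, if_true, Bool.false_eq_true, if_false] at h1 h2
    have h3 : ‖(testAverage b k false + testAverage b k true * Complex.I : ℂ) -
        μ ^ 2 ^ (k : ℕ)‖ ^ 2 ≤ (1 / 2) ^ 2 := by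
      rw [← Complex.normSq_eq_norm_sq, Complex.normSq_apply]
      simp only [Complex.sub_re, Complex.add_re, Complex.ofReal_re, Complex.mul_re, Complex.I_re,
        Complex.ofReal_im, Complex.I_im, Complex.sub_im, Complex.add_im, Complex.mul_im]
      have h4 := sq_le_sq' (abs_le.mp h1).1 (abs_le.mp h1).2
      have h5 := sq_le_sq' (abs_le.mp h2).1 (abs_le.mp h2).2
      nlinarith
    exact (pow_le_pow_iff_left₀ (norm_nonneg _) (by norm_num) two_ne_zero).mp h3
  have hunion := sum_filter_le_sum_sum_filter
    (w := fun b : Bits (PhaseTest K) => ∏ τ, p τ (b τ))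
    (fun b => Finset.prod_nonneg fun τ _ => hp0 τ _) _ _ hbad
  have hsplit := Finset.sum_filter_add_sum_filter_not Finset.univ
    (fun b : Bits (PhaseTest K) => |decode b - ‖1 + μ‖ / 2| ≤ 1 / 2 ^ K)
    fun b => ∏ τ, p τ (b τ)
  rw [sum_prod_eq_one hp1] at hsplit
  have htot : ∑ e : Fin (K + 1) × Bool × Bool, ((1 : ℝ) / 1000) ^ (K + 1 - (e.1 : ℕ)) ≤
      4 / 999 := by
    rw [Fintype.sum_prod_type]
    simp only [Finset.sum_const, Finset.card_univ, Fintype.card_prod, Fintype.card_bool,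
      nsmul_eq_mul, ← Finset.mul_sum]
    push_cast
    linarith [sum_geometric_le K]
  have := (hunion.trans (Finset.sum_le_sum fun e _ => htail e)).trans htot
  linarith

end PhaseProbability

/-! ### Spectral concentration of an approximate rotation -/

section SpectralConcentration
open Matrix
variable {m : Type*} [Fintype m] [DecidableEq m]

/-- On the unit circle, `1 + μ` points in the direction of the square root of `μ`. -/
theorem one_add_sq_eq {μ : ℂ} (hμ : ‖μ‖ = 1) : (1 + μ) ^ 2 = μ * ((‖1 + μ‖ ^ 2 : ℝ) : ℂ) := by
  have h1 : μ * (starRingEnd ℂ) μ = 1 := by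
    rw [Complex.mul_conj, Complex.normSq_eq_norm_sq, hμ]; simp
  rw [← Complex.normSq_eq_norm_sq, ← Complex.mul_conj, map_add, map_one]
  linear_combination (-1 - μ) * h1

/-- Spectral estimate for one eigenvalue `μ`: `a` and `b` are the coordinates of `Ψ` and `u` along
its eigenvector, and `e₁` and `e₂` those of the errors. Eliminating `b` gives
`(|1 + μ| ^ 2 - 4 t ^ 2) |a| ≤ |1 + μ| |e₁| + 2 |e₂|`. For `t = 0` the quotient `|e₂| / t` is zero,
which is justified by `h₀`. -/
theorem dist_mul_amplitude_sq_le {μ a b e₁ e₂ : ℂ} {t : ℝ} (hμ : ‖μ‖ = 1) (ht : 0 ≤ t)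
    (h₁ : μ * a = (4 * t ^ 2 - 1) * a - 2 * b + e₁) (h₂ : μ * b = -b + 2 * t ^ 2 * a + e₂)
    (h₀ : t = 0 → e₂ = 0) :
    (‖1 + μ‖ / 2 - t) ^ 2 * ‖a‖ ^ 2 ≤ (‖e₁‖ ^ 2 + (‖e₂‖ / t) ^ 2) / 4 := by
  set X := ‖1 + μ‖ with hX
  have hX0 : 0 ≤ X := norm_nonneg _
  have key : μ * (((X ^ 2 - (2 * t) ^ 2 : ℝ) : ℂ) * a) = (1 + μ) * e₁ - 2 * e₂ := by
    have h3 := one_add_sq_eq hμ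
    push_cast at h3 ⊢
    linear_combination (1 + μ) * h₁ - 2 * h₂ - a * h3
  have key2 : |X - 2 * t| * (X + 2 * t) * ‖a‖ ≤ X * ‖e₁‖ + 2 * ‖e₂‖ := by
    have h3 := congrArg norm key
    rw [norm_mul, norm_mul, hμ, one_mul, Complex.norm_real, Real.norm_eq_abs] at h3
    have h4 : |X ^ 2 - (2 * t) ^ 2| = |X - 2 * t| * (X + 2 * t) := by
      rw [sq_sub_sq, abs_mul, abs_of_nonneg (by positivity : 0 ≤ X + 2 * t), mul_comm]
    rw [← h4, h3]
    refine (norm_sub_le _ _).trans ?_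
    rw [norm_mul, norm_mul, Complex.norm_ofNat]
  have hsq : (X / 2 - t) ^ 2 * ‖a‖ ^ 2 = (|X - 2 * t| * ‖a‖) ^ 2 / 4 := by
    rw [mul_pow, sq_abs]; ring
  rw [hsq]
  refine div_le_div_of_nonneg_right ?_ (by norm_num)
  rcases ht.eq_or_lt with rfl | ht
  · rw [h₀ rfl] at key2 ⊢
    simp only [mul_zero, sub_zero, add_zero, norm_zero, abs_of_nonneg hX0] at key2 ⊢
    rcases hX0.eq_or_lt with h | h
    · rw [← h]; simp
    · have : X * ‖a‖ ≤ ‖e₁‖ := le_of_mul_le_mul_left (by linarith) h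
      have := pow_le_pow_left₀ (by positivity) this 2
      simpa using this
  · set g := ‖e₂‖ / t with hg
    have hg0 : 0 ≤ g := by positivity
    have hge : ‖e₂‖ = g * t := by rw [hg, div_mul_cancel₀ _ ht.ne']
    rw [hge] at key2
    set y := |X - 2 * t| * ‖a‖ with hy
    have hy0 : 0 ≤ y := by positivity
    set Y := 2 * t with hY
    have hY0 : 0 < Y := by positivity
    have h5 : y * (X + Y) ≤ X * ‖e₁‖ + Y * g := by rw [hy]; linarith
    have h6 : (y * (X + Y)) ^ 2 ≤ (X * ‖e₁‖ + Y * g) ^ 2 :=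
      pow_le_pow_left₀ (by positivity) h5 2
    have hE0 := norm_nonneg e₁
    have h7 : (X * ‖e₁‖ + Y * g) ^ 2 ≤ (X + Y) ^ 2 * (‖e₁‖ ^ 2 + g ^ 2) := by
      have hc : (X * ‖e₁‖ + Y * g) ^ 2 + (X * g - Y * ‖e₁‖) ^ 2 =
          (X ^ 2 + Y ^ 2) * (‖e₁‖ ^ 2 + g ^ 2) := by ring
      nlinarith [sq_nonneg (X * g - Y * ‖e₁‖), mul_nonneg hX0 hY0.le,
        mul_nonneg (mul_nonneg hX0 hY0.le) (add_nonneg (sq_nonneg ‖e₁‖) (sq_nonneg g))]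
    have h8 : (0 : ℝ) < (X + Y) ^ 2 := by positivity
    rw [mul_pow] at h6
    refine le_of_mul_le_mul_left ?_ h8
    linarith

/-- A unitary `U` that acts on `Ψ` and `u` almost like the product of the reflections about `Ψ`
and along `u`, where `u` is the projection of `Ψ` and has norm `t`, has `Ψ` concentrated on the
eigenvalues `μ` with `|1 + μ| / 2` close to `t`. -/
theorem sum_dist_mul_amplitude_sq_le {U Z : Matrix m m ℂ} {μ : m → ℂ}
    (hZ : Z ∈ unitaryGroup m ℂ) (hμ : ∀ i, ‖μ i‖ = 1) (hU : Z * U = diagonal μ * Z)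
    {Ψ u : m → ℂ} {t E : ℝ} (ht : 0 ≤ t) (hE : 0 ≤ E)
    (h₁ : l2norm (U *ᵥ Ψ - ((4 * (t : ℂ) ^ 2 - 1) • Ψ - (2 : ℂ) • u)) ≤ E)
    (h₂ : l2norm (U *ᵥ u - (-u + (2 * (t : ℂ) ^ 2) • Ψ)) ≤ E * t) :
    ∑ i, (‖1 + μ i‖ / 2 - t) ^ 2 * ‖(Z *ᵥ Ψ) i‖ ^ 2 ≤ E ^ 2 / 2 := by
  set x₁ := U *ᵥ Ψ - ((4 * (t : ℂ) ^ 2 - 1) • Ψ - (2 : ℂ) • u) with hx₁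
  set x₂ := U *ᵥ u - (-u + (2 * (t : ℂ) ^ 2) • Ψ) with hx₂
  have hUi : ∀ (w : m → ℂ) i, (Z *ᵥ (U *ᵥ w)) i = μ i * (Z *ᵥ w) i := by
    intro w i
    rw [mulVec_mulVec, hU, ← mulVec_mulVec, mulVec_diagonal]
  have hn : ∀ w, ∑ i, ‖(Z *ᵥ w) i‖ ^ 2 = l2norm w ^ 2 := fun w => by
    rw [← l2norm_sq, l2norm_mulVec_of_unitary hZ]
  have h0 : t = 0 → ∀ i, (Z *ᵥ x₂) i = 0 := by
    intro h i
    rw [h, mul_zero] at h₂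
    have h3 := hn x₂
    rw [le_antisymm h₂ (l2norm_nonneg _), zero_pow two_ne_zero,
      Finset.sum_eq_zero_iff_of_nonneg fun i _ => by positivity] at h3
    simpa using h3 i (Finset.mem_univ i)
  have hle : ∀ i, (‖1 + μ i‖ / 2 - t) ^ 2 * ‖(Z *ᵥ Ψ) i‖ ^ 2 ≤
      (‖(Z *ᵥ x₁) i‖ ^ 2 + (‖(Z *ᵥ x₂) i‖ / t) ^ 2) / 4 := by
    intro i
    refine dist_mul_amplitude_sq_le (b := (Z *ᵥ u) i) (hμ i) ht ?_ ?_ fun h => h0 h i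
    · rw [← hUi, hx₁]
      simp only [mulVec_sub, mulVec_smul, Pi.sub_apply, Pi.smul_apply, smul_eq_mul]; ring
    · rw [← hUi, hx₂]
      simp only [mulVec_sub, mulVec_add, mulVec_neg, mulVec_smul, Pi.sub_apply, Pi.add_apply,
        Pi.neg_apply, Pi.smul_apply, smul_eq_mul]; ring
  refine (Finset.sum_le_sum fun i _ => hle i).trans ?_
  rw [← Finset.sum_div, Finset.sum_add_distrib, hn]
  simp only [div_pow]
  rw [← Finset.sum_div, hn, ← div_pow]
  have h3 : l2norm x₂ / t ≤ E := div_le_of_le_mul₀ ht hE h₂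
  have h4 := pow_le_pow_left₀ (l2norm_nonneg _) h₁ 2
  have h5 := pow_le_pow_left₀ (div_nonneg (l2norm_nonneg _) ht) h3 2
  linarith

/-- Hadamard tests of the dyadic powers of the walk `U`, on a state `v` close to a state `Ψ`
that `U` approximately rotates by the angle encoding `t`, yield an estimate of `t`. -/
theorem le_sum_testProduct {α : Type} [Fintype α] [DecidableEq α] {U : QOp α}
    (hU : U ∈ unitaryGroup (Bits α) ℂ) {v Ψ u : QVec α} {t δ : ℝ} (ht : 0 ≤ t) (hδ : 0 < δ)
    (h₁ : l2norm (U *ᵥ Ψ - ((4 * (t : ℂ) ^ 2 - 1) • Ψ - (2 : ℂ) • u)) ≤ δ / 4)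
    (h₂ : l2norm (U *ᵥ u - (-u + (2 * (t : ℂ) ^ 2) • Ψ)) ≤ δ / 4 * t)
    (hv : l2norm v = 1) (hvΨ : l2norm (v - Ψ) ≤ 1 / 100) {K : ℕ} (hK : 4 / δ ≤ 2 ^ K) :
    17 / 20 ≤ ∑ b : Bits (PhaseTest K) with |decode b - t| ≤ δ,
      l2norm (testProduct U (fun τ : PhaseTest K => 2 ^ (τ.1 : ℕ)) (fun τ => τ.2.1) b
        Finset.univ.toList *ᵥ v) ^ 2 := by
  classical
  obtain ⟨Z, μ, hZ, hμ, hZU⟩ := exists_eigenbasis_of_unitary hU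
  have hspec := sum_dist_mul_amplitude_sq_le hZ hμ hZU ht (by positivity) h₁ h₂
  let P : Bits α → Bits (PhaseTest K) → ℝ := fun i b =>
    ∏ τ, ‖testAmplitude (2 ^ (τ.1 : ℕ)) τ.2.1 (b τ) (μ i)‖ ^ 2
  let w : Bits α → ℝ := fun i => ‖(Z *ᵥ v) i‖ ^ 2
  have hw0 : ∀ i, 0 ≤ w i := fun i => by positivity
  have hP0 : ∀ i b, 0 ≤ P i b := fun i b => Finset.prod_nonneg fun τ _ => by positivity
  have hw1 : ∑ i, w i = 1 := by
    simp only [w]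
    rw [← l2norm_sq, l2norm_mulVec_of_unitary hZ, hv, one_pow]
  have hnorm : ∀ b, l2norm (testProduct U (fun τ : PhaseTest K => 2 ^ (τ.1 : ℕ))
      (fun τ => τ.2.1) b Finset.univ.toList *ᵥ v) ^ 2 = ∑ i, w i * P i b := by
    intro b
    rw [← l2norm_mulVec_of_unitary hZ, mulVec_mulVec, mul_testProduct hZU, ← mulVec_mulVec,
      l2norm_sq]
    refine Finset.sum_congr rfl fun i _ => ?_
    rw [mulVec_diagonal, norm_mul, mul_pow, mul_comm, Finset.prod_map_toList, norm_prod,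
      ← Finset.prod_pow]
  have hKδ : 1 / 2 ^ K ≤ δ / 4 := by
    rw [div_le_div_iff₀ (by positivity) (by norm_num)]
    rw [div_le_iff₀ hδ] at hK
    linarith
  let good : Bits α → Prop := fun i => |‖1 + μ i‖ / 2 - t| ≤ 3 / 4 * δ
  have hgood : ∀ i, good i → 199 / 200 ≤ ∑ b with |decode b - t| ≤ δ, P i b := by
    intro i hi
    refine (le_sum_decode K (hμ i)).trans (Finset.sum_le_sum_of_subset_of_nonneg ?_
      fun b _ _ => hP0 i b)
    intro b hb
    simp only [Finset.mem_filter, Finset.mem_univ, true_and] at hb ⊢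
    have := abs_sub_le (decode b) (‖1 + μ i‖ / 2) t
    simp only [good] at hi
    linarith
  -- the weight of the bad eigenvalues, by Chebyshev's inequality
  have hbad : ∑ i with ¬ good i, w i ≤ 1 / 8 := by
    have hle : ∀ i, (if ¬ good i then w i else 0) ≤ 2 * ‖(Z *ᵥ (v - Ψ)) i‖ ^ 2 +
        2 * (16 / (9 * δ ^ 2) * ((‖1 + μ i‖ / 2 - t) ^ 2 * ‖(Z *ᵥ Ψ) i‖ ^ 2)) := by
      intro i
      split_ifs with h
      · positivity
      · have h3 : 1 ≤ 16 / (9 * δ ^ 2) * (‖1 + μ i‖ / 2 - t) ^ 2 := by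
          rw [div_mul_eq_mul_div, le_div_iff₀ (by positivity)]
          simp only [good, not_le] at h
          have := pow_le_pow_left₀ (by positivity) h.le 2
          rw [sq_abs] at this
          nlinarith
        have h4 : w i ≤ 2 * ‖(Z *ᵥ (v - Ψ)) i‖ ^ 2 + 2 * ‖(Z *ᵥ Ψ) i‖ ^ 2 := by
          have h5 : (Z *ᵥ v) i = (Z *ᵥ (v - Ψ)) i + (Z *ᵥ Ψ) i := by
            rw [← Pi.add_apply, ← mulVec_add, sub_add_cancel]
          have h6 := norm_add_le ((Z *ᵥ (v - Ψ)) i) ((Z *ᵥ Ψ) i)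
          rw [← h5] at h6
          have h7 := pow_le_pow_left₀ (norm_nonneg _) h6 2
          simp only [w]
          nlinarith [sq_nonneg (‖(Z *ᵥ (v - Ψ)) i‖ - ‖(Z *ᵥ Ψ) i‖)]
        nlinarith [sq_nonneg ‖(Z *ᵥ Ψ) i‖]
    rw [Finset.sum_filter]
    refine (Finset.sum_le_sum fun i _ => hle i).trans ?_
    rw [Finset.sum_add_distrib, ← Finset.mul_sum, ← Finset.mul_sum, ← Finset.mul_sum,
      ← l2norm_sq, l2norm_mulVec_of_unitary hZ]
    have h3 := pow_le_pow_left₀ (l2norm_nonneg _) hvΨ 2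
    have h4 : 16 / (9 * δ ^ 2) * ∑ i, (‖1 + μ i‖ / 2 - t) ^ 2 * ‖(Z *ᵥ Ψ) i‖ ^ 2 ≤
        16 / (9 * δ ^ 2) * ((δ / 4) ^ 2 / 2) := by gcongr
    have h5 : 16 / (9 * δ ^ 2) * ((δ / 4) ^ 2 / 2) = 1 / 18 := by
      field_simp; norm_num
    linarith
  have hsplit := Finset.sum_filter_add_sum_filter_not Finset.univ good w
  calc (17 / 20 : ℝ) ≤ (∑ i with good i, w i) * (199 / 200) := by linarith
    _ ≤ ∑ i with good i, w i * ∑ b with |decode b - t| ≤ δ, P i b := by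
      rw [Finset.sum_mul]
      refine Finset.sum_le_sum fun i hi => mul_le_mul_of_nonneg_left ?_ (hw0 i)
      exact hgood i (Finset.mem_filter.mp hi).2
    _ ≤ ∑ i, w i * ∑ b with |decode b - t| ≤ δ, P i b :=
      Finset.sum_le_sum_of_subset_of_nonneg (Finset.filter_subset _ _) fun i _ _ =>
        mul_nonneg (hw0 i) (Finset.sum_nonneg fun b _ => hP0 i b)
    _ = _ := by
      simp only [hnorm, Finset.mul_sum]
      rw [Finset.sum_comm]

end SpectralConcentration

/-! ### Tensor products and encodings -/

section Tensor
open Matrix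
variable {α β S : Type} [Fintype α] [DecidableEq α] [Fintype β] [DecidableEq β]
  [Fintype S] [DecidableEq S]

theorem conjTranspose_tensor (A : QOp α) (B : QOp β) : (tensor A B)ᴴ = tensor Aᴴ Bᴴ := by
  ext x y; simp [tensor]

theorem conjTranspose_ketBra (ψ φ : QVec α) : (ketBra ψ φ)ᴴ = ketBra φ ψ := by
  simp [ketBra, conjTranspose_vecMulVec]

theorem ketBra_mul_ketBra (ψ φ ψ' φ' : QVec α) :
    ketBra ψ φ * ketBra ψ' φ' = braket φ ψ' • ketBra ψ φ' := by
  simp [ketBra, vecMulVec_mul_vecMulVec, braket]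

theorem ketBra_mulVec (ψ φ v : QVec α) : ketBra ψ φ *ᵥ v = braket φ v • ψ := by
  funext x
  simp only [ketBra, mulVec, dotProduct, vecMulVec_apply, braket, Pi.smul_apply, smul_eq_mul,
    Finset.sum_mul]
  exact Finset.sum_congr rfl fun y _ => by ring

theorem tensor_isStarProjection {A : QOp α} {B : QOp β} (hA : IsStarProjection A)
    (hB : IsStarProjection B) : IsStarProjection (tensor A B) := by
  refine ⟨?_, ?_⟩
  · rw [IsIdempotentElem, tensor_mul, hA.isIdempotentElem, hB.isIdempotentElem]
  · rw [IsSelfAdjoint, star_eq_conjTranspose, conjTranspose_tensor, ← star_eq_conjTranspose,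
      ← star_eq_conjTranspose, hA.isSelfAdjoint, hB.isSelfAdjoint]

theorem slice_tensor_mulVec (A : QOp α) (B : QOp β) (v : QVec (α ⊕ β)) (b : Bits β) :
    slice (tensor A B *ᵥ v) b = ∑ b', B b b' • (A *ᵥ slice v b') := by
  funext x
  rw [slice, mulVec, dotProduct, sum_bits_sum, Finset.sum_apply]
  refine Finset.sum_congr rfl fun b' _ => ?_
  simp only [Pi.smul_apply, mulVec, dotProduct, smul_eq_mul, Finset.mul_sum]
  refine Finset.sum_congr rfl fun y _ => ?_
  simp only [tensor, slice, Sum.elim_inl, Sum.elim_inr]; ring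

theorem ketZero_sum : ketZero (α ⊕ β) = withBits (fun _ => false) (ketZero α) := by
  funext z
  have h : (z = fun _ => false) ↔ (fun j => z (Sum.inr j)) = (fun _ => false) ∧
      (fun i => z (Sum.inl i)) = fun _ => false := by
    simp only [funext_iff, Sum.forall]; exact and_comm
  simp only [ketZero, withBits, Pi.single_apply, h, ite_and]

theorem l2norm_ketZero : l2norm (ketZero α) = 1 := l2norm_single_one _

theorem braket_ketZero_self : braket (ketZero α) (ketZero α) = 1 := by
  rw [braket_self, l2norm_ketZero]; simp

theorem tensor_ketBra_mulVec_withBits (A : QOp α) (u : QVec α) :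
    tensor A (ketBra (ketZero β) (ketZero β)) *ᵥ withBits (fun _ => false) u =
      withBits (fun _ => false) (A *ᵥ u) := by
  refine slice_ext fun b => ?_
  rw [slice_tensor_mulVec, slice_withBits, Finset.sum_eq_single fun _ => false]
  · rw [slice_withBits, if_pos rfl]
    by_cases hb : b = fun _ => false <;> simp [ketBra, vecMulVec_apply, ketZero, hb]
  · intro b' _ hb'
    rw [slice_withBits, if_neg hb', mulVec_zero, smul_zero]
  · simp

theorem applyOn_inl_mulVec_withBits (G : QOp α) (b : Bits β) (u : QVec α) :
    applyOn (Function.Embedding.inl : α ↪ α ⊕ β) G *ᵥ withBits b u = withBits b (G *ᵥ u) := by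
  refine slice_ext fun b' => ?_
  rw [slice_applyOn_inl, slice_withBits, slice_withBits]
  split_ifs <;> simp

theorem applyOn_inl_eq_tensor (A : QOp α) :
    applyOn (Function.Embedding.inl : α ↪ α ⊕ β) A = tensor A 1 := by
  ext x y
  have h : (∀ i, i ∉ Set.range (Function.Embedding.inl : α ↪ α ⊕ β) → x i = y i) ↔
      (fun j => x (Sum.inr j)) = fun j => y (Sum.inr j) := by
    simp [funext_iff]
  simp only [applyOn, tensor, one_apply]
  by_cases hxy : (fun j => x (Sum.inr j)) = fun j => y (Sum.inr j)
  · rw [if_pos (h.mpr hxy), if_pos hxy, mul_one]; rfl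
  · rw [if_neg (mt h.mp hxy), if_neg hxy, mul_zero]

theorem applyOn_inr_eq_tensor (B : QOp β) :
    applyOn (Function.Embedding.inr : β ↪ α ⊕ β) B = tensor 1 B := by
  ext x y
  have h : (∀ i, i ∉ Set.range (Function.Embedding.inr : β ↪ α ⊕ β) → x i = y i) ↔
      (fun j => x (Sum.inl j)) = fun j => y (Sum.inl j) := by
    simp [funext_iff]
  simp only [applyOn, tensor, one_apply]
  by_cases hxy : (fun j => x (Sum.inl j)) = fun j => y (Sum.inl j)
  · rw [if_pos (h.mpr hxy), if_pos hxy, one_mul]; rfl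
  · rw [if_neg (mt h.mp hxy), if_neg hxy, zero_mul]

theorem tensor_eq_applyOn_mul (A : QOp α) (B : QOp β) : tensor A B =
    applyOn (Function.Embedding.inl : α ↪ α ⊕ β) A *
      applyOn (Function.Embedding.inr : β ↪ α ⊕ β) B := by
  rw [applyOn_inl_eq_tensor, applyOn_inr_eq_tensor, tensor_mul, Matrix.mul_one, Matrix.one_mul]

theorem mul_conjTranspose_mul_of_isStarProjection {P : QOp α} (h : IsStarProjection P) :
    P * Pᴴ * P = P := by
  have h1 : Pᴴ = P := h.isSelfAdjoint
  rw [h1, h.isIdempotentElem, h.isIdempotentElem]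

/-- Compute `R` into the first flag, apply `V`, and compute `L` into the second flag. -/
noncomputable def flagCircuit (f : α ↪ S) (L V R : QOp α) : QOp (S ⊕ Fin 2) :=
  applyOn (withTarget f (1 : Fin 2)) (cProjNot L) *
    (applyOn (f.trans Function.Embedding.inl) V *
      applyOn (withTarget f (0 : Fin 2)) (cProjNot R))

theorem flagCircuit_mem {f : α ↪ S} {L V R : QOp α} (hL : IsStarProjection L)
    (hR : IsStarProjection R) (hV : V ∈ unitaryGroup (Bits α) ℂ) :
    flagCircuit f L V R ∈ unitaryGroup (Bits (S ⊕ Fin 2)) ℂ :=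
  mul_mem (applyOn_mem_unitaryGroup _ (cProjNot_mem_unitaryGroup hL))
    (mul_mem (applyOn_mem_unitaryGroup _ hV)
      (applyOn_mem_unitaryGroup _ (cProjNot_mem_unitaryGroup hR)))

theorem conjTranspose_flagCircuit {f : α ↪ S} {L V R : QOp α} (hL : IsStarProjection L)
    (hR : IsStarProjection R) : (flagCircuit f L V R)ᴴ =
      applyOn (withTarget f (0 : Fin 2)) (cProjNot R) *
        (applyOn (f.trans Function.Embedding.inl) Vᴴ *
          applyOn (withTarget f (1 : Fin 2)) (cProjNot L)) := by
  rw [flagCircuit, conjTranspose_mul, conjTranspose_mul, ← applyOn_conjTranspose,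
    ← applyOn_conjTranspose, ← applyOn_conjTranspose, cProjNot_isHermitian hL,
    cProjNot_isHermitian hR, Matrix.mul_assoc]

/-- Both flags are set with the encoded operator as amplitude. -/
theorem slice_flagCircuit (f : α ↪ S) (L V R : QOp α) (u : QVec S) :
    slice (flagCircuit f L V R *ᵥ withBits (fun _ => false) u) (fun _ => true) =
      applyOn f (L * V * R) *ᵥ u := by
  rw [flagCircuit, ← mulVec_mulVec, ← mulVec_mulVec, applyOn_trans, slice_applyOn_withTarget,
    slice_applyOn_inl, slice_applyOn_inl, slice_applyOn_withTarget, slice_applyOn_withTarget]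
  have h1 : (fun _ : Fin 2 => true) ≠ fun _ => false := fun h => by simpa using congrFun h 0
  have h2 : Function.update (fun _ : Fin 2 => true) 0 (!true) ≠ fun _ => false := fun h => by
    simpa using congrFun h 1
  have h3 : Function.update (fun _ : Fin 2 => true) 1 (!true) ≠ fun _ => false := fun h => by
    simpa using congrFun h 0
  have h4 : Function.update (Function.update (fun _ : Fin 2 => true) 1 (!true)) 0
      (!(Function.update (fun _ : Fin 2 => true) 1 (!true)) 0) = fun _ => false := by
    funext i; fin_cases i <;> simp
  rw [slice_withBits, slice_withBits, slice_withBits, slice_withBits, if_neg h1, if_neg h2,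
    if_neg h3, if_pos h4]
  simp only [mulVec_zero, add_zero, zero_add, mulVec_mulVec, applyOn_mul, Matrix.mul_assoc]

/-- An encoding of a partial isometry `T`, together with its flags, implements the reflection
`1 - 2 Tᴴ T`. -/
theorem l2norm_encoding_reflection_sub_le {f : α ↪ S} {L V R T : QOp α} {χ : ℝ}
    (hL : IsStarProjection L) (hR : IsStarProjection R) (hV : V ∈ unitaryGroup (Bits α) ℂ)
    (hT : T * Tᴴ * T = T) (hχ : ‖T - L * V * R‖ ≤ χ) (u : QVec S) :
    l2norm (((flagCircuit f L V R)ᴴ * flagSign S * flagCircuit f L V R) *ᵥ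
      withBits (fun _ => false) u -
        withBits (fun _ => false) (u - (2 : ℂ) • (applyOn f (Tᴴ * T) *ᵥ u))) ≤
          (2 * χ + 2 * √(2 * χ)) * l2norm u := by
  rw [applyOn_mul, applyOn_conjTranspose]
  refine l2norm_reflection_sub_le (flagCircuit_mem hL hR hV) (slice_flagCircuit f L V R) ?_ ?_ u
  · rw [← applyOn_conjTranspose, ← applyOn_mul, ← applyOn_mul, hT]
  · rw [← applyOn_sub]
    exact (norm_applyOn_le f _).trans hχ

/-- A unitary encoding of `T` maps a unit vector in the initial space of `T` close to its image
under `T`. -/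
theorem l2norm_encoding_mulVec_sub_sq_le {L V R T : QOp α} {χ : ℝ}
    (hL : IsStarProjection L) (hR : IsStarProjection R) (hV : V ∈ unitaryGroup (Bits α) ℂ)
    (hχ : ‖T - L * V * R‖ ≤ χ) {x : QVec α} (hx : (Tᴴ * T) *ᵥ x = x) (hx1 : l2norm x = 1) :
    l2norm (V *ᵥ x - T *ᵥ x) ^ 2 ≤ 6 * χ := by
  set y := T *ᵥ x with hy
  have hyx : Tᴴ *ᵥ y = x := by rw [hy, mulVec_mulVec, hx]
  have hy1 : l2norm y = 1 := by
    have h1 : braket y y = braket x x := by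
      conv_lhs => rw [hy, braket_mulVec, ← hy, hyx]
    rw [braket_self, braket_self] at h1
    have h2 : l2norm y ^ 2 = l2norm x ^ 2 := by exact_mod_cast h1
    rw [hx1, one_pow] at h2
    exact (pow_eq_one_iff_of_nonneg (l2norm_nonneg _) two_ne_zero).mp h2
  have hLh : Lᴴ = L := hL.isSelfAdjoint
  have hRh : Rᴴ = R := hR.isSelfAdjoint
  have hLn := norm_le_one_of_isStarProjection hL
  have hL1 : l2norm ((1 - L) *ᵥ y) ≤ χ := by
    have h1 : (1 - L) * (T - L * V * R) = (1 - L) * T := by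
      have h2 : (1 - L) * L = 0 := by rw [sub_mul, one_mul, hL.isIdempotentElem, sub_self]
      rw [mul_sub, ← Matrix.mul_assoc, ← Matrix.mul_assoc, h2]; simp
    rw [hy, mulVec_mulVec, ← h1, ← mulVec_mulVec]
    refine (l2norm_mulVec_le _ _).trans ?_
    have h3 := l2norm_mulVec_le (T - L * V * R) x
    rw [hx1, mul_one] at h3
    calc _ ≤ 1 * l2norm ((T - L * V * R) *ᵥ x) := mul_le_mul_of_nonneg_right
          (norm_le_one_of_isStarProjection hL.one_sub) (l2norm_nonneg _)
      _ ≤ χ := by linarith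
  have hR1 : l2norm ((1 - R) *ᵥ x) ≤ χ := by
    have h1 : (1 - R) * (T - L * V * R)ᴴ = (1 - R) * Tᴴ := by
      have h2 : (1 - R) * R = 0 := by rw [sub_mul, one_mul, hR.isIdempotentElem, sub_self]
      rw [conjTranspose_sub, conjTranspose_mul, hRh, mul_sub, ← Matrix.mul_assoc (1 - R) R, h2]
      simp
    rw [← hyx, mulVec_mulVec, ← h1, ← mulVec_mulVec]
    refine (l2norm_mulVec_le _ _).trans ?_
    have h3 := l2norm_mulVec_le (T - L * V * R)ᴴ y
    rw [hy1, mul_one, l2_opNorm_conjTranspose] at h3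
    calc _ ≤ 1 * l2norm ((T - L * V * R)ᴴ *ᵥ y) := mul_le_mul_of_nonneg_right
          (norm_le_one_of_isStarProjection hR.one_sub) (l2norm_nonneg _)
      _ ≤ χ := by linarith
  have hVn : ∀ w, l2norm (V *ᵥ w) = l2norm w := l2norm_mulVec_of_unitary hV
  -- `T = L V R + (T - L V R)`, where `L` and `R` nearly fix `y` and `x`
  have hsplit : braket y (V *ᵥ x) = braket y y - braket y ((T - L * V * R) *ᵥ x) +
      braket ((1 - L) *ᵥ y) (V *ᵥ x) + braket (L *ᵥ y) (V *ᵥ ((1 - R) *ᵥ x)) := by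
    have h1 : ∀ w, braket (L *ᵥ y) w = braket y (L *ᵥ w) := fun w => by
      rw [braket_mulVec, hLh]
    rw [sub_mulVec 1 L, sub_mulVec 1 R, one_mulVec, one_mulVec, mulVec_sub, h1, sub_mulVec, ← hy]
    have h2 : ∀ w, braket (y - L *ᵥ y) w = braket y w - braket (L *ᵥ y) w := fun w => by
      simp [braket, sub_dotProduct]
    have h3 : ∀ w w' : QVec α, braket y (w - w') = braket y w - braket y w' := fun w w' => by
      simp [braket, dotProduct_sub]
    rw [h2, h1, mulVec_sub, h3, h3]
    simp only [mulVec_mulVec, Matrix.mul_assoc]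
    ring
  have b1 : |(braket y ((T - L * V * R) *ᵥ x)).re| ≤ χ := by
    refine (Complex.abs_re_le_norm _).trans ((norm_braket_le _ _).trans ?_)
    have := l2norm_mulVec_le (T - L * V * R) x
    rw [hx1, mul_one] at this
    rw [hy1, one_mul]; linarith
  have b2 : |(braket ((1 - L) *ᵥ y) (V *ᵥ x)).re| ≤ χ := by
    refine (Complex.abs_re_le_norm _).trans ((norm_braket_le _ _).trans ?_)
    rw [hVn, hx1, mul_one]; exact hL1
  have b3 : |(braket (L *ᵥ y) (V *ᵥ ((1 - R) *ᵥ x))).re| ≤ χ := by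
    refine (Complex.abs_re_le_norm _).trans ((norm_braket_le _ _).trans ?_)
    rw [hVn]
    have h1 := l2norm_mulVec_le L y
    rw [hy1, mul_one] at h1
    calc _ ≤ 1 * l2norm ((1 - R) *ᵥ x) :=
          mul_le_mul_of_nonneg_right (h1.trans hLn) (l2norm_nonneg _)
      _ ≤ χ := by linarith
  rw [l2norm_sub_rev, l2norm_sub_sq, hsplit, hVn, hx1, hy1]
  simp only [Complex.add_re, Complex.sub_re, braket_self, Complex.ofReal_re, hy1]
  have c1 := abs_le.mp b1
  have c2 := abs_le.mp b2
  have c3 := abs_le.mp b3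
  linarith

end Tensor

/-! ### Ranks and purifications -/

section Rank
open Matrix

theorem trace_eq_rank_of_isIdempotentElem {m : Type*} [Fintype m] [DecidableEq m]
    {P : Matrix m m ℂ} (h : IsIdempotentElem P) : P.trace = (P.rank : ℂ) := by
  have h1 : LinearMap.IsProj (LinearMap.range P.mulVecLin) P.mulVecLin := by
    refine ⟨fun x => ⟨x, rfl⟩, ?_⟩
    rintro _ ⟨y, rfl⟩
    simp only [mulVecLin_apply, mulVec_mulVec, h.eq]
  have h2 := h1.trace
  rwa [← Matrix.toLin'_apply', Matrix.trace_toLin'_eq] at h2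

theorem mul_eq_of_range_le {m : Type*} [Fintype m] [DecidableEq m] {P Q : Matrix m m ℂ}
    (hQ : IsIdempotentElem Q)
    (h : LinearMap.range P.mulVecLin ≤ LinearMap.range Q.mulVecLin) : Q * P = P := by
  refine Matrix.ext_of_mulVec_single fun i => ?_
  obtain ⟨y, hy⟩ := h ⟨Pi.single i 1, rfl⟩
  simp only [mulVecLin_apply] at hy
  rw [← mulVec_mulVec, ← hy, mulVec_mulVec, hQ.eq]

variable {n r m₁ m₂ : ℕ} {D : Instance n r m₁ m₂} {e : Errors}

/-- Expectations of local operators in a purification are those in the reduced state. -/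
theorem IsPurification.braket_applyOn {α β : Type} [Fintype α] [DecidableEq α] [Fintype β]
    [DecidableEq β] {ψ : QVec (α ⊕ β)} {ρ : QOp α} (h : IsPurification ψ ρ) (A : QOp α) :
    braket ψ (applyOn (Function.Embedding.inl : α ↪ α ⊕ β) A *ᵥ ψ) = (A * ρ).trace := by
  rw [braket, dotProduct, sum_bits_sum, trace]
  simp only [diag_apply, mul_apply, ← h _ _, Finset.mul_sum]
  rw [Finset.sum_comm]
  refine Finset.sum_congr rfl fun x _ => ?_
  rw [Finset.sum_comm]
  refine Finset.sum_congr rfl fun z _ => ?_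
  have := congrFun (slice_applyOn_inl A ψ z) x
  simp only [slice] at this
  rw [this, mulVec, dotProduct, Finset.mul_sum]
  refine Finset.sum_congr rfl fun y _ => ?_
  simp only [Pi.star_apply, slice]; ring

theorem Instance.Valid.rank_ne_zero (h : D.Valid e) : (D.Pt.rank : ℂ) ≠ 0 := by
  rw [Nat.cast_ne_zero]
  intro h0
  refine h.ne_zero (Matrix.toLin'.injective ?_)
  rw [map_zero, ← LinearMap.range_eq_bot]
  exact Submodule.finrank_eq_zero.mp h0

theorem Instance.Valid.l2norm_psi (h : D.Valid e) : l2norm D.ψ = 1 := by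
  have h1 := h.purif.braket_applyOn 1
  rw [applyOn_one, one_mulVec, Matrix.one_mul, trace_smul,
    trace_eq_rank_of_isIdempotentElem h.projt.isIdempotentElem, smul_eq_mul,
    one_div_mul_cancel h.rank_ne_zero, braket_self] at h1
  have h2 : l2norm D.ψ ^ 2 = 1 := by exact_mod_cast h1
  exact (pow_eq_one_iff_of_nonneg (l2norm_nonneg _) two_ne_zero).mp h2

theorem Instance.target_nonneg (D : Instance n r m₁ m₂) : 0 ≤ D.target := Real.sqrt_nonneg _

/-- The overlap `⟨ψ| Π |ψ⟩` is the square of the target. -/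
theorem Instance.Valid.braket_psi (h : D.Valid e) :
    braket D.ψ (applyOn (Function.Embedding.inl : Fin n ↪ Fin n ⊕ Fin r) D.P *ᵥ D.ψ) =
      (D.target : ℂ) ^ 2 := by
  have h1 := mul_eq_of_range_le h.projt.isIdempotentElem h.subset
  rw [h.purif.braket_applyOn, Matrix.mul_smul, trace_smul, trace_mul_comm, h1,
    trace_eq_rank_of_isIdempotentElem h.proj.isIdempotentElem, Instance.target,
    ← Complex.ofReal_pow, Real.sq_sqrt (by positivity)]
  push_cast
  rw [smul_eq_mul]; ring

end Rank

/-! ### The walk operator of an instance -/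

section Walk
open Matrix
variable {S : Type} [Fintype S] [DecidableEq S]

theorem reflection_mem_unitaryGroup {Q : QOp S} (hQ : IsStarProjection Q) :
    1 - (2 : ℂ) • Q ∈ unitaryGroup (Bits S) ℂ := by
  have h1 : Qᴴ = Q := hQ.isSelfAdjoint
  have h2 : Q * Q = Q := hQ.isIdempotentElem
  rw [mem_unitaryGroup_iff, star_eq_conjTranspose, conjTranspose_sub, conjTranspose_one,
    conjTranspose_smul, h1, sub_mul, mul_sub, mul_sub, one_mul, mul_one, one_mul, smul_mul_smul,
    h2]
  simp only [RCLike.star_def, map_ofNat]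
  module

theorem l2norm_sub_two_smul {Q : QOp S} (hQ : IsStarProjection Q) (u : QVec S) :
    l2norm (u - (2 : ℂ) • (Q *ᵥ u)) = l2norm u := by
  rw [← l2norm_mulVec_of_unitary (reflection_mem_unitaryGroup hQ) u, sub_mulVec, one_mulVec,
    smul_mulVec]

/-- The errors of two approximate reflections add up. -/
theorem l2norm_mul_reflection_sub_le {R₁ R₂ : QOp (S ⊕ Fin 2)} {Q₁ Q₂ : QOp S} {η₁ η₂ : ℝ}
    (hR₁ : R₁ ∈ unitaryGroup (Bits (S ⊕ Fin 2)) ℂ) (hQ₂ : IsStarProjection Q₂)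
    (h₁ : ∀ u, l2norm (R₁ *ᵥ withBits (fun _ => false) u -
      withBits (fun _ => false) (u - (2 : ℂ) • (Q₁ *ᵥ u))) ≤ η₁ * l2norm u)
    (h₂ : ∀ u, l2norm (R₂ *ᵥ withBits (fun _ => false) u -
      withBits (fun _ => false) (u - (2 : ℂ) • (Q₂ *ᵥ u))) ≤ η₂ * l2norm u) (u : QVec S) :
    l2norm ((R₁ * R₂) *ᵥ withBits (fun _ => false) u -
      withBits (fun _ => false) (u - (2 : ℂ) • (Q₂ *ᵥ u) -
        (2 : ℂ) • (Q₁ *ᵥ (u - (2 : ℂ) • (Q₂ *ᵥ u))))) ≤ (η₁ + η₂) * l2norm u := by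
  have h3 := h₁ (u - (2 : ℂ) • (Q₂ *ᵥ u))
  rw [l2norm_sub_two_smul hQ₂] at h3
  have h4 := h₂ u
  rw [← l2norm_mulVec_of_unitary hR₁, mulVec_sub, mulVec_mulVec] at h4
  refine (l2norm_sub_le_sub _ _ _).trans ((add_le_add h4 h3).trans (le_of_eq ?_))
  ring

end Walk

section InstanceWalk
open Matrix
variable {n r m₁ m₂ : ℕ}

/-- The wires of the system: the registers of the state, and the ancillas of the encodings. -/
abbrev SysWires (n r m₁ m₂ : ℕ) : Type := ((Fin n ⊕ Fin r) ⊕ Fin m₁) ⊕ Fin m₂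

/-- The wires on which the encoding of `|ψ⟩⟨0|` acts. -/
abbrev embPsi (n r m₁ m₂ : ℕ) : (Fin n ⊕ Fin r) ⊕ Fin m₁ ↪ SysWires n r m₁ m₂ :=
  Function.Embedding.inl

/-- The wires on which the encoding of `Π` acts. -/
def embProj (n r m₁ m₂ : ℕ) : Fin n ⊕ Fin m₂ ↪ SysWires n r m₁ m₂ :=
  (Function.Embedding.inl.trans Function.Embedding.inl).sumMap (Function.Embedding.refl _)

/-- Computation of the two flags of the encoding of `Π`. -/
def preProj (n r m₁ m₂ : ℕ) : List (WireOp n r m₁ m₂ (SysWires n r m₁ m₂ ⊕ Fin 2)) :=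
  [.call .CRproj (withTarget (embProj n r m₁ m₂) 0),
    .call .Vproj ((embProj n r m₁ m₂).trans Function.Embedding.inl),
    .call .CLproj (withTarget (embProj n r m₁ m₂) 1)]

/-- The inverse of `preProj`. -/
def postProj (n r m₁ m₂ : ℕ) : List (WireOp n r m₁ m₂ (SysWires n r m₁ m₂ ⊕ Fin 2)) :=
  [.call .CLproj (withTarget (embProj n r m₁ m₂) 1),
    .call .Vprojinv ((embProj n r m₁ m₂).trans Function.Embedding.inl),
    .call .CRproj (withTarget (embProj n r m₁ m₂) 0)]

/-- Computation of the two flags of the encoding of `|0⟩⟨ψ|` given by the inverse of `V_ψ`. -/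
def prePsi (n r m₁ m₂ : ℕ) : List (WireOp n r m₁ m₂ (SysWires n r m₁ m₂ ⊕ Fin 2)) :=
  [.call .CLpsi (withTarget (embPsi n r m₁ m₂) 0),
    .call .Vpsiinv ((embPsi n r m₁ m₂).trans Function.Embedding.inl),
    .call .CRpsi (withTarget (embPsi n r m₁ m₂) 1)]

/-- The inverse of `prePsi`. -/
def postPsi (n r m₁ m₂ : ℕ) : List (WireOp n r m₁ m₂ (SysWires n r m₁ m₂ ⊕ Fin 2)) :=
  [.call .CRpsi (withTarget (embPsi n r m₁ m₂) 1),
    .call .Vpsi ((embPsi n r m₁ m₂).trans Function.Embedding.inl),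
    .call .CLpsi (withTarget (embPsi n r m₁ m₂) 0)]

variable {D : Instance n r m₁ m₂} {e : Errors}

theorem circuitMatrix_preProj (D : Instance n r m₁ m₂) :
    circuitMatrix D.ideal (preProj n r m₁ m₂) =
      flagCircuit (embProj n r m₁ m₂) D.Lproj D.Vproj D.Rproj := by
  simp only [preProj, circuitMatrix, Matrix.one_mul, Matrix.mul_assoc]; rfl

theorem circuitMatrix_postProj (h : D.Valid e) :
    circuitMatrix D.ideal (postProj n r m₁ m₂) =
      (flagCircuit (embProj n r m₁ m₂) D.Lproj D.Vproj D.Rproj)ᴴ := by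
  rw [conjTranspose_flagCircuit h.encproj.left h.encproj.right]
  simp only [postProj, circuitMatrix, Matrix.one_mul, Matrix.mul_assoc]; rfl

theorem circuitMatrix_prePsi (D : Instance n r m₁ m₂) :
    circuitMatrix D.ideal (prePsi n r m₁ m₂) =
      flagCircuit (embPsi n r m₁ m₂) D.Rpsi D.Vpsiᴴ D.Lpsi := by
  simp only [prePsi, circuitMatrix, Matrix.one_mul, Matrix.mul_assoc]; rfl

theorem circuitMatrix_postPsi (h : D.Valid e) :
    circuitMatrix D.ideal (postPsi n r m₁ m₂) =
      (flagCircuit (embPsi n r m₁ m₂) D.Rpsi D.Vpsiᴴ D.Lpsi)ᴴ := by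
  rw [conjTranspose_flagCircuit h.encpsi.right h.encpsi.left, conjTranspose_conjTranspose]
  simp only [postPsi, circuitMatrix, Matrix.one_mul, Matrix.mul_assoc]; rfl

/-- The walk operator of an instance: the product of the reflections about `|ψ⟩` and about the
range of `Π`, each implemented by computing flags, flipping the sign and uncomputing. -/
noncomputable def walkOp (D : Instance n r m₁ m₂) : QOp (SysWires n r m₁ m₂ ⊕ Fin 2) :=
  (circuitMatrix D (postPsi n r m₁ m₂) * flagSign _ * circuitMatrix D (prePsi n r m₁ m₂)) *
    (circuitMatrix D (postProj n r m₁ m₂) * flagSign _ * circuitMatrix D (preProj n r m₁ m₂))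

/-- The walk, controlled by the wire `τ`. -/
noncomputable def ctrlWalk (n r m₁ m₂ : ℕ) {T : Type} [DecidableEq T] (τ : T) :
    List (WireOp n r m₁ m₂ ((SysWires n r m₁ m₂ ⊕ Fin 2) ⊕ T)) :=
  ctrlReflection (preProj n r m₁ m₂) (postProj n r m₁ m₂) τ ++
    ctrlReflection (prePsi n r m₁ m₂) (postPsi n r m₁ m₂) τ

theorem Instance.Valid.walkOp_mem (h : D.Valid e) :
    walkOp D.ideal ∈ unitaryGroup (Bits (SysWires n r m₁ m₂ ⊕ Fin 2)) ℂ := by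
  have hc := fun c => h.ideal_isUnitary.circuitMatrix_mem (W := SysWires n r m₁ m₂ ⊕ Fin 2) c
  exact mul_mem (mul_mem (mul_mem (hc _) flagSign_mem_unitaryGroup) (hc _))
    (mul_mem (mul_mem (hc _) flagSign_mem_unitaryGroup) (hc _))

theorem Instance.Valid.isControlled_ctrlWalk (h : D.Valid e) {T : Type} [Fintype T]
    [DecidableEq T] (τ : T) :
    IsControlled τ (walkOp D.ideal) (circuitMatrix D.ideal (ctrlWalk n r m₁ m₂ τ)) := by
  rw [ctrlWalk, circuitMatrix_append]
  refine (isControlled_ctrlReflection D.ideal τ ?_).mul (isControlled_ctrlReflection D.ideal τ ?_)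
  · rw [circuitMatrix_prePsi, circuitMatrix_postPsi h]
    exact mem_unitaryGroup_iff'.mp (flagCircuit_mem h.encpsi.right h.encpsi.left
      (conjTranspose_mem_unitaryGroup h.encpsi.unitary))
  · rw [circuitMatrix_preProj, circuitMatrix_postProj h]
    exact mem_unitaryGroup_iff'.mp (flagCircuit_mem h.encproj.left h.encproj.right
      h.encproj.unitary)

/-- The system state in which the ancillas of the encodings are zero. -/
def sysState (m₁ m₂ : ℕ) (y : QVec (Fin n ⊕ Fin r)) : QVec (SysWires n r m₁ m₂) :=
  withBits (fun _ => false) (withBits (fun _ => false) y)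

theorem l2norm_sysState (y : QVec (Fin n ⊕ Fin r)) : l2norm (sysState m₁ m₂ y) = l2norm y := by
  rw [sysState, l2norm_withBits, l2norm_withBits]

theorem sysState_sub (y z : QVec (Fin n ⊕ Fin r)) :
    sysState m₁ m₂ (y - z) = sysState m₁ m₂ y - sysState m₁ m₂ z := by
  simp only [sysState, withBits_sub]

theorem sysState_smul (c : ℂ) (y : QVec (Fin n ⊕ Fin r)) :
    sysState m₁ m₂ (c • y) = c • sysState m₁ m₂ y := by
  simp only [sysState, withBits_smul]

theorem applyOn_embProj_mulVec_sysState (P : QOp (Fin n)) (y : QVec (Fin n ⊕ Fin r)) :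
    applyOn (embProj n r m₁ m₂) (tensor P (ketBra (ketZero _) (ketZero _))) *ᵥ
      sysState m₁ m₂ y = sysState m₁ m₂ (applyOn Function.Embedding.inl P *ᵥ y) := by
  have h1 : Function.Embedding.inl.trans (embProj n r m₁ m₂) =
      (Function.Embedding.inl.trans Function.Embedding.inl).trans Function.Embedding.inl := rfl
  have h2 : Function.Embedding.inr.trans (embProj n r m₁ m₂) = Function.Embedding.inr := rfl
  rw [tensor_eq_applyOn_mul, applyOn_mul, ← applyOn_trans, ← applyOn_trans, h1, h2,
    applyOn_trans, applyOn_trans, applyOn_inr_eq_tensor, ← mulVec_mulVec, sysState,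
    tensor_ketBra_mulVec_withBits, one_mulVec, applyOn_inl_mulVec_withBits,
    applyOn_inl_mulVec_withBits]
  rfl

/-- The ideal encoded operator `|ψ⟩⟨0| ⊗ |0⟩⟨0|`. -/
noncomputable def preparation (D : Instance n r m₁ m₂) : QOp ((Fin n ⊕ Fin r) ⊕ Fin m₁) :=
  tensor (ketBra D.ψ (ketZero _)) (ketBra (ketZero _) (ketZero _))

theorem preparation_mul_conjTranspose (D : Instance n r m₁ m₂) :
    preparation D * (preparation D)ᴴ =
      tensor (ketBra D.ψ D.ψ) (ketBra (ketZero _) (ketZero _)) := by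
  simp only [preparation, conjTranspose_tensor, conjTranspose_ketBra, tensor_mul,
    ketBra_mul_ketBra, braket_ketZero_self, one_smul]

theorem Instance.Valid.conjTranspose_preparation_mul (h : D.Valid e) :
    (preparation D)ᴴ * preparation D =
      tensor (ketBra (ketZero _) (ketZero _)) (ketBra (ketZero _) (ketZero _)) := by
  simp only [preparation, conjTranspose_tensor, conjTranspose_ketBra, tensor_mul,
    ketBra_mul_ketBra, braket_self, l2norm_ketZero, h.l2norm_psi, one_smul, one_pow,
    Complex.ofReal_one]

theorem Instance.Valid.preparation_mul_mul (h : D.Valid e) :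
    preparation D * (preparation D)ᴴ * preparation D = preparation D := by
  rw [preparation_mul_conjTranspose]
  simp only [preparation, tensor_mul, ketBra_mul_ketBra, braket_self, l2norm_ketZero,
    h.l2norm_psi, one_smul, one_pow, Complex.ofReal_one]

theorem applyOn_embPsi_mulVec_sysState (D : Instance n r m₁ m₂) (y : QVec (Fin n ⊕ Fin r)) :
    applyOn (embPsi n r m₁ m₂) (preparation D * (preparation D)ᴴ) *ᵥ sysState m₁ m₂ y =
      sysState m₁ m₂ (braket D.ψ y • D.ψ) := by
  rw [preparation_mul_conjTranspose, sysState, applyOn_inl_mulVec_withBits,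
    tensor_ketBra_mulVec_withBits, ketBra_mulVec]
  rfl

/-- The error of a reflection implemented with an encoding of error `χ`. -/
noncomputable def reflectionError (χ : ℝ) : ℝ := 2 * χ + 2 * √(2 * χ)

/-- The walk operator acts on states with zero ancillas as the product of the two exact
reflections, up to the errors of the encodings. -/
theorem Instance.Valid.l2norm_walkOp_sub_le (h : D.Valid e) (y : QVec (Fin n ⊕ Fin r)) :
    l2norm (walkOp D.ideal *ᵥ withBits (fun _ => false) (sysState m₁ m₂ y) -
      withBits (fun _ => false) (sysState m₁ m₂
        (y - (2 : ℂ) • (applyOn Function.Embedding.inl D.P *ᵥ y) - (2 : ℂ) •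
          (braket D.ψ (y - (2 : ℂ) • (applyOn Function.Embedding.inl D.P *ᵥ y)) • D.ψ)))) ≤
      (reflectionError e.χpsi + reflectionError e.χproj) * l2norm y := by
  have hK := ketBra_ketZero_isStarProjection (α := Fin m₂)
  have hT := tensor_isStarProjection h.proj hK
  have hTT : (tensor D.P (ketBra (ketZero (Fin m₂)) (ketZero (Fin m₂))))ᴴ *
      tensor D.P (ketBra (ketZero (Fin m₂)) (ketZero (Fin m₂))) =
        tensor D.P (ketBra (ketZero (Fin m₂)) (ketZero (Fin m₂))) := by
    rw [← star_eq_conjTranspose, hT.isSelfAdjoint.star_eq, hT.isIdempotentElem]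
  have hb₁ := h.encpsi.bound
  have hb₂ := h.encproj.bound
  rw [Complex.ofReal_one, one_smul] at hb₁ hb₂
  rw [← l2_opNorm_conjTranspose, conjTranspose_sub, conjTranspose_mul, conjTranspose_mul,
    ← star_eq_conjTranspose D.Lpsi, ← star_eq_conjTranspose D.Rpsi,
    h.encpsi.left.isSelfAdjoint.star_eq, h.encpsi.right.isSelfAdjoint.star_eq,
    ← Matrix.mul_assoc] at hb₁
  have hp := h.preparation_mul_mul
  have hp' : (preparation D)ᴴ * (preparation D)ᴴᴴ * (preparation D)ᴴ = (preparation D)ᴴ := by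
    conv_rhs => rw [← hp]
    rw [conjTranspose_mul, conjTranspose_mul, Matrix.mul_assoc]
  have h₁ := l2norm_encoding_reflection_sub_le (f := embPsi n r m₁ m₂) h.encpsi.right
    h.encpsi.left (conjTranspose_mem_unitaryGroup h.encpsi.unitary) hp' hb₁
  have h₂ := l2norm_encoding_reflection_sub_le (f := embProj n r m₁ m₂) h.encproj.left
    h.encproj.right h.encproj.unitary (mul_conjTranspose_mul_of_isStarProjection hT) hb₂
  rw [conjTranspose_conjTranspose] at h₁
  rw [hTT] at h₂
  have hc := fun c => h.ideal_isUnitary.circuitMatrix_mem (W := SysWires n r m₁ m₂ ⊕ Fin 2) c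
  have hR := mul_mem (mul_mem (hc (postPsi n r m₁ m₂)) flagSign_mem_unitaryGroup)
    (hc (prePsi n r m₁ m₂))
  have key := l2norm_mul_reflection_sub_le (R₁ := circuitMatrix D.ideal (postPsi n r m₁ m₂) *
      flagSign _ * circuitMatrix D.ideal (prePsi n r m₁ m₂))
    (R₂ := circuitMatrix D.ideal (postProj n r m₁ m₂) * flagSign _ *
      circuitMatrix D.ideal (preProj n r m₁ m₂)) hR
    (applyOn_isStarProjection (embProj n r m₁ m₂) hT)
    (by rw [circuitMatrix_prePsi, circuitMatrix_postPsi h]; exact h₁)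
    (by rw [circuitMatrix_preProj, circuitMatrix_postProj h]; exact h₂)
    (sysState m₁ m₂ y)
  rw [l2norm_sysState, applyOn_embProj_mulVec_sysState, ← sysState_smul, ← sysState_sub,
    applyOn_embPsi_mulVec_sysState, ← sysState_smul, ← sysState_sub] at key
  exact key

theorem Instance.Valid.l2norm_proj_psi (h : D.Valid e) :
    l2norm (applyOn (Function.Embedding.inl : Fin n ↪ Fin n ⊕ Fin r) D.P *ᵥ D.ψ) = D.target := by
  have hQ := applyOn_isStarProjection (Function.Embedding.inl : Fin n ↪ Fin n ⊕ Fin r) h.proj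
  have h1 := h.braket_psi
  set Q := applyOn (Function.Embedding.inl : Fin n ↪ Fin n ⊕ Fin r) D.P
  have h2 : braket (Q *ᵥ D.ψ) (Q *ᵥ D.ψ) = (D.target : ℂ) ^ 2 := by
    rw [braket_mulVec, mulVec_mulVec, ← star_eq_conjTranspose, hQ.isSelfAdjoint.star_eq,
      hQ.isIdempotentElem, ← h1, braket_mulVec, ← star_eq_conjTranspose,
      hQ.isSelfAdjoint.star_eq]
  rw [braket_self] at h2
  have h3 : l2norm (Q *ᵥ D.ψ) ^ 2 = D.target ^ 2 := by exact_mod_cast h2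
  exact (pow_left_inj₀ (l2norm_nonneg _) D.target_nonneg two_ne_zero).mp h3

end InstanceWalk

/-! ### Estimation by phase estimation of the walk -/

section Repetition
open Matrix
variable {n r m₁ m₂ : ℕ} {W : Type} [Fintype W] [DecidableEq W]

theorem Instance.IsUnitary.sum_outcome_eq_one {D : Instance n r m₁ m₂} (h : D.IsUnitary)
    (c : List (WireOp n r m₁ m₂ W)) :
    ∑ x, ‖(circuitMatrix D c *ᵥ ketZero W) x‖ ^ 2 = 1 := by
  rw [← l2norm_sq, l2norm_mulVec_of_unitary (h.circuitMatrix_mem c), l2norm_ketZero, one_pow]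

/-- Medians of independent runs amplify a constant success probability. -/
theorem exists_algorithm_median (c : List (WireOp n r m₁ m₂ W)) (est : Bits W → ℝ) {η : ℝ}
    (hη : 0 < η) :
    ∃ a : Algorithm n r m₁ m₂, a.reps = ⌈64 * Real.log (1 / η)⌉₊ ∧
      a.calls = c.countP (fun g => g.isCall) ∧ a.gates = c.countP (fun g => !g.isCall) ∧
      ∀ (D : Instance n r m₁ m₂) (δ : ℝ), D.IsUnitary →
        3 / 4 ≤ ∑ x with |est x - D.target| ≤ δ, ‖(circuitMatrix D c *ᵥ ketZero W) x‖ ^ 2 →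
          1 - η ≤ a.successProb D δ := by
  obtain ⟨a, h1, h2, h3, h4⟩ := exists_algorithm c ⌈64 * Real.log (1 / η)⌉₊
    fun ω => median fun i => est (ω i)
  refine ⟨a, h1, h2, h3, fun D δ hD h => ?_⟩
  rw [h4]
  exact le_sum_median (fun x => sq_nonneg _) (hD.sum_outcome_eq_one c) hη h (Nat.le_ceil _)

/-- The probability of an event changes little under a small perturbation of the state. -/
theorem le_sum_filter_of_l2norm_sub_le {ι : Type*} [Fintype ι] {v w : ι → ℂ} (p : ι → Prop)
    [DecidablePred p] (hw : 17 / 20 ≤ ∑ x with p x, ‖w x‖ ^ 2) (h : l2norm (v - w) ≤ 1 / 20) :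
    3 / 4 ≤ ∑ x with p x, ‖v x‖ ^ 2 := by
  let res : (ι → ℂ) → ι → ℂ := fun u x => if p x then u x else 0
  have hres : ∀ u, l2norm (res u) ^ 2 = ∑ x with p x, ‖u x‖ ^ 2 := by
    intro u
    rw [l2norm_sq, Finset.sum_filter]
    refine Finset.sum_congr rfl fun x _ => ?_
    simp only [res]; split_ifs <;> simp
  have hsub : l2norm (res v - res w) ≤ l2norm (v - w) := by
    have h1 : res v - res w = res (v - w) := by
      funext x; simp only [res, Pi.sub_apply]; split_ifs <;> simp
    refine (sq_le_sq₀ (l2norm_nonneg _) (l2norm_nonneg _)).mp ?_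
    rw [h1, hres, l2norm_sq]
    exact Finset.sum_le_sum_of_subset_of_nonneg (Finset.filter_subset _ _) fun x _ _ => sq_nonneg _
  have h1 := (abs_le.mp (abs_l2norm_sub_le (res v) (res w))).1
  rw [← hres] at hw ⊢
  have h2 : 92 / 100 ≤ l2norm (res w) := by nlinarith [l2norm_nonneg (res w)]
  nlinarith [l2norm_nonneg (res v)]

end Repetition

section PhaseCircuit
open Matrix
set_option synthInstance.maxSize 1000
variable {n r m₁ m₂ : ℕ} {D : Instance n r m₁ m₂} {e : Errors}

/-- Preparation of the state, followed by Hadamard tests of the powers `2 ^ k`, `k ≤ K`, of the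
walk. -/
noncomputable def phaseCircuit (n r m₁ m₂ K : ℕ) :
    List (WireOp n r m₁ m₂ ((SysWires n r m₁ m₂ ⊕ Fin 2) ⊕ PhaseTest K)) :=
  .call .Vpsi (((embPsi n r m₁ m₂).trans Function.Embedding.inl).trans Function.Embedding.inl) ::
    (Finset.univ : Finset (PhaseTest K)).toList.flatMap fun τ =>
      hadamardTest (ctrlWalk n r m₁ m₂) (2 ^ (τ.1 : ℕ)) τ.2.1 τ

/-- Levels `k ≤ K` of cost `2 ^ k`, each used `K + 1 - k` times, cost `O(2 ^ K)` in total. -/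
theorem sum_sub_mul_two_pow (K : ℕ) :
    ∑ k ∈ Finset.range (K + 1), (K + 1 - k) * 2 ^ k + K + 3 = 4 * 2 ^ K := by
  induction K with
  | zero => simp
  | succ K ih =>
    have h1 : ∑ k ∈ Finset.range (K + 1), (K + 1 + 1 - k) * 2 ^ k =
        ∑ k ∈ Finset.range (K + 1), (K + 1 - k) * 2 ^ k + ∑ k ∈ Finset.range (K + 1), 2 ^ k := by
      rw [← Finset.sum_add_distrib]
      refine Finset.sum_congr rfl fun k hk => ?_
      have : K + 1 + 1 - k = (K + 1 - k) + 1 := by have := Finset.mem_range.mp hk; omega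
      rw [this]; ring
    have h2 : ∑ k ∈ Finset.range (K + 1), 2 ^ k + 1 = 2 ^ (K + 1) := by
      have := Nat.geomSum_eq (le_refl 2) (K + 1)
      simp only [Nat.add_one_sub_one, Nat.div_one] at this
      rw [this]; exact Nat.sub_add_cancel Nat.one_le_two_pow
    rw [Finset.sum_range_succ, h1]
    have h3 : K + 1 + 1 - (K + 1) = 1 := by omega
    rw [h3]
    have h4 : 2 ^ (K + 1) = 2 * 2 ^ K := by ring
    omega

/-- If a Hadamard test of the `j`-th power contains at most `12 j + 2` operations of some kind, then
the whole circuit contains `O(2 ^ K)` of them. -/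
theorem countP_phaseCircuit_le (p : ∀ {W : Type}, WireOp n r m₁ m₂ W → Bool)
    (hp : ∀ (K j : ℕ) (τ : PhaseTest K) (sine : Bool),
      (hadamardTest (ctrlWalk n r m₁ m₂) j sine τ).countP p ≤ 12 * j + 2) (K : ℕ) :
    (phaseCircuit n r m₁ m₂ K).countP p ≤ 161280 * 2 ^ K + 1 := by
  rw [phaseCircuit, List.countP_cons, List.countP_flatMap, Finset.sum_map_toList]
  refine add_le_add ?_ (by split_ifs <;> simp)
  calc _ ≤ ∑ τ : PhaseTest K, 14 * 2 ^ (τ.1 : ℕ) := Finset.sum_le_sum fun τ _ => by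
        refine (hp K _ τ _).trans ?_
        have : 1 ≤ 2 ^ (τ.1 : ℕ) := Nat.one_le_two_pow
        omega
    _ = 40320 * ∑ k ∈ Finset.range (K + 1), (K + 1 - k) * 2 ^ k := by
        rw [Fintype.sum_sigma, Finset.sum_range, Finset.mul_sum]
        refine Finset.sum_congr rfl fun k _ => ?_
        change ∑ _y : Bool × Fin (testCount K k), 14 * 2 ^ (k : ℕ) = _
        rw [Finset.sum_const, Finset.card_univ, Fintype.card_prod, Fintype.card_bool,
          Fintype.card_fin, testCount, smul_eq_mul]
        ring
    _ ≤ _ := by have := sum_sub_mul_two_pow K; omega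

theorem countP_hadamardTest {T : Type} [DecidableEq T]
    (p : WireOp n r m₁ m₂ ((SysWires n r m₁ m₂ ⊕ Fin 2) ⊕ T) → Bool)
    (walk : T → List (WireOp n r m₁ m₂ ((SysWires n r m₁ m₂ ⊕ Fin 2) ⊕ T))) (j : ℕ)
    (sine : Bool) (τ : T) {a : ℕ} (h : (walk τ).countP p = a) :
    (hadamardTest walk j sine τ).countP p ≤ a * j + 2 := by
  rw [hadamardTest, List.countP_cons, List.countP_append, List.countP_flatten,
    List.map_replicate, List.sum_replicate, h, smul_eq_mul, List.countP_singleton, mul_comm]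
  split_ifs <;> omega

theorem countP_isCall_phaseCircuit_le (K : ℕ) :
    (phaseCircuit n r m₁ m₂ K).countP (fun g => g.isCall) ≤ 161280 * 2 ^ K + 1 :=
  countP_phaseCircuit_le (fun g => g.isCall) (fun K j τ sine =>
    countP_hadamardTest _ _ j sine τ (by rfl)) K

theorem countP_not_isCall_phaseCircuit_le (K : ℕ) :
    (phaseCircuit n r m₁ m₂ K).countP (fun g => !g.isCall) ≤ 161280 * 2 ^ K + 1 :=
  countP_phaseCircuit_le (fun g => !g.isCall) (fun K j τ sine =>
    (countP_hadamardTest _ _ j sine τ (a := 10) (by rfl)).trans (by omega)) K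

/-- With exact `C_ΠNOT` gates and good encodings, one run of the circuit yields an accurate
estimate with constant probability. -/
theorem Instance.Valid.le_sum_phaseCircuit_ideal (h : D.Valid e) {δ : ℝ} (hδ : 0 < δ)
    (hχ : reflectionError e.χpsi + reflectionError e.χproj ≤ δ / 4)
    (hψ : 6 * e.χpsi ≤ (1 / 100) ^ 2) {K : ℕ} (hK : 4 / δ ≤ 2 ^ K) :
    17 / 20 ≤ ∑ x with |decode (fun τ : PhaseTest K => x (Sum.inr τ)) - D.target| ≤ δ,
      ‖(circuitMatrix D.ideal (phaseCircuit n r m₁ m₂ K) *ᵥ ketZero _) x‖ ^ 2 := by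
  set Q := applyOn (Function.Embedding.inl : Fin n ↪ Fin n ⊕ Fin r) D.P with hQ
  have hQp : IsStarProjection Q := applyOn_isStarProjection _ h.proj
  have hsub : ∀ y z : QVec (Fin n ⊕ Fin r),
      braket D.ψ (y - (2 : ℂ) • z) = braket D.ψ y - 2 * braket D.ψ z := fun y z => by
    simp [braket, dotProduct_sub, dotProduct_smul]
  have hψψ : braket D.ψ D.ψ = 1 := by rw [braket_self, h.l2norm_psi]; simp
  have hψQ : braket D.ψ (Q *ᵥ D.ψ) = (D.target : ℂ) ^ 2 := h.braket_psi
  have hQQ : Q *ᵥ (Q *ᵥ D.ψ) = Q *ᵥ D.ψ := by rw [mulVec_mulVec, hQp.isIdempotentElem]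
  let ι : QVec (Fin n ⊕ Fin r) → QVec (SysWires n r m₁ m₂ ⊕ Fin 2) := fun y =>
    withBits (fun _ => false) (sysState m₁ m₂ y)
  have ιsub : ∀ y z, ι (y - z) = ι y - ι z := fun y z => by
    simp only [ι, sysState_sub, withBits_sub]
  have ιsmul : ∀ (c : ℂ) y, ι (c • y) = c • ι y := fun c y => by
    simp only [ι, sysState_smul, withBits_smul]
  have h₁ : l2norm (walkOp D.ideal *ᵥ ι D.ψ -
      ((4 * (D.target : ℂ) ^ 2 - 1) • ι D.ψ - (2 : ℂ) • ι (Q *ᵥ D.ψ))) ≤ δ / 4 := by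
    have key := h.l2norm_walkOp_sub_le D.ψ
    rw [← hQ, hsub, hψψ, hψQ, h.l2norm_psi, mul_one] at key
    refine le_trans (le_of_eq ?_) (key.trans hχ)
    rw [← ιsmul, ← ιsmul, ← ιsub]
    congr 3
    module
  have h₂ : l2norm (walkOp D.ideal *ᵥ ι (Q *ᵥ D.ψ) -
      (-ι (Q *ᵥ D.ψ) + (2 * (D.target : ℂ) ^ 2) • ι D.ψ)) ≤ δ / 4 * D.target := by
    have key := h.l2norm_walkOp_sub_le (Q *ᵥ D.ψ)
    rw [← hQ, hQQ, hsub, hψQ, h.l2norm_proj_psi] at key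
    refine le_trans (le_of_eq ?_) (key.trans (mul_le_mul_of_nonneg_right hχ D.target_nonneg))
    have h3 : -ι (Q *ᵥ D.ψ) + (2 * (D.target : ℂ) ^ 2) • ι D.ψ =
        ι ((2 * (D.target : ℂ) ^ 2) • D.ψ - Q *ᵥ D.ψ) := by
      rw [ιsub, ιsmul]; abel
    rw [h3]
    congr 3
    module
  have hVψ : (applyOn (embPsi n r m₁ m₂) D.Vpsi) *ᵥ ketZero (SysWires n r m₁ m₂) =
      withBits (fun _ => false) (D.Vpsi *ᵥ ketZero _) := by
    rw [ketZero_sum, applyOn_inl_mulVec_withBits]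
  set v : QVec (SysWires n r m₁ m₂ ⊕ Fin 2) :=
    withBits (fun _ => false) (withBits (fun _ => false) (D.Vpsi *ᵥ ketZero _)) with hv
  have hv1 : l2norm v = 1 := by
    rw [hv, l2norm_withBits, l2norm_withBits, l2norm_mulVec_of_unitary h.encpsi.unitary,
      l2norm_ketZero]
  have hvΨ : l2norm (v - ι D.ψ) ≤ 1 / 100 := by
    have hb := h.encpsi.bound
    rw [Complex.ofReal_one, one_smul] at hb
    have hT : preparation D *ᵥ ketZero _ = withBits (fun _ => false) D.ψ := by
      rw [preparation, ketZero_sum (β := Fin m₁), tensor_ketBra_mulVec_withBits, ketBra_mulVec,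
        braket_ketZero_self, one_smul]
    have hTT : ((preparation D)ᴴ * preparation D) *ᵥ ketZero _ = ketZero _ := by
      rw [h.conjTranspose_preparation_mul, ketZero_sum (β := Fin m₁), tensor_ketBra_mulVec_withBits,
        ketBra_mulVec, braket_ketZero_self, one_smul]
    have key := l2norm_encoding_mulVec_sub_sq_le h.encpsi.left h.encpsi.right h.encpsi.unitary hb
      hTT l2norm_ketZero
    change l2norm (_ - preparation D *ᵥ _) ^ 2 ≤ _ at key
    rw [hT] at key
    rw [show v - ι D.ψ = withBits (fun _ => false) (withBits (fun _ => false)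
      (D.Vpsi *ᵥ ketZero _ - withBits (fun _ => false) D.ψ)) by
        rw [withBits_sub, withBits_sub]; rfl, l2norm_withBits, l2norm_withBits]
    exact (sq_le_sq₀ (l2norm_nonneg _) (by norm_num)).mp (key.trans hψ)
  have key := le_sum_testProduct h.walkOp_mem D.target_nonneg hδ h₁ h₂ hv1 hvΨ hK
  refine key.trans (le_of_eq ?_)
  have hslice : ∀ b : Bits (PhaseTest K),
      slice (circuitMatrix D.ideal (phaseCircuit n r m₁ m₂ K) *ᵥ ketZero _) b =
        testProduct (walkOp D.ideal) (fun τ : PhaseTest K => 2 ^ (τ.1 : ℕ)) (fun τ => τ.2.1) b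
          Finset.univ.toList *ᵥ v := by
    intro b
    have h0 : (WireOp.call Call.Vpsi (((embPsi n r m₁ m₂).trans Function.Embedding.inl).trans
        Function.Embedding.inl)).toMatrix D.ideal *ᵥ
          ketZero ((SysWires n r m₁ m₂ ⊕ Fin 2) ⊕ PhaseTest K) = withBits (fun _ => false) v := by
      rw [ketZero_sum, ketZero_sum]
      change applyOn (((embPsi n r m₁ m₂).trans Function.Embedding.inl).trans
        Function.Embedding.inl) D.Vpsi *ᵥ _ = _
      rw [applyOn_trans, applyOn_trans, applyOn_inl_mulVec_withBits, applyOn_inl_mulVec_withBits,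
        hVψ]
    rw [phaseCircuit, circuitMatrix, ← mulVec_mulVec, h0,
      slice_hadamardTests D.ideal (fun τ => h.isControlled_ctrlWalk τ)
        (fun τ : PhaseTest K => 2 ^ (τ.1 : ℕ)) (fun τ => τ.2.1) _ (Finset.nodup_toList _)]
    · congr 1
      rw [slice_withBits, if_pos]
      funext τ; simp
    · intro b τ _ hb
      rw [slice_withBits, if_neg]
      rintro rfl
      simp at hb
  rw [Finset.sum_filter, Finset.sum_filter, sum_bits_sum]
  refine Finset.sum_congr rfl fun b _ => ?_
  by_cases hb : |decode b - D.target| ≤ δ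
  · rw [if_pos hb, ← hslice, l2norm_sq]
    exact Finset.sum_congr rfl fun x _ => (if_pos hb).symm
  · rw [if_neg hb]
    exact (Finset.sum_eq_zero fun x _ => if_neg hb).symm

/-- The algorithm that runs phase estimation on the walk, on the powers up to `2 ^ (K + 1)`, where
`4 / δ ≤ 2 ^ (K + 1) ≤ 8 / δ`, and takes the median of the estimates. The constant bounds
`161280 * 8 + 1`. -/
theorem exists_algorithm_phaseEstimation (n r m₁ m₂ : ℕ) {δ η : ℝ} (hδ : 0 < δ) (hδ1 : δ < 1)
    (hη : 0 < η) :
    ∃ a : Algorithm n r m₁ m₂, a.reps = ⌈64 * Real.log (1 / η)⌉₊ ∧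
      (a.calls : ℝ) ≤ 1300000 / δ ∧ (a.gates : ℝ) ≤ 1300000 / δ ∧
      ∀ (D : Instance n r m₁ m₂) (e : Errors), D.Valid e →
        reflectionError e.χpsi + reflectionError e.χproj ≤ δ / 4 →
        6 * e.χpsi ≤ (1 / 100) ^ 2 → 1300000 / δ * e.gateTotal ≤ 1 / 20 →
          1 - η ≤ a.successProb D δ := by
  obtain ⟨K, hK1, hK2⟩ := exists_nat_pow_near (x := 4 / δ) (y := 2)
    (by rw [le_div_iff₀ hδ]; linarith) (by norm_num)
  have hcost : ∀ N : ℕ, N ≤ 161280 * 2 ^ (K + 1) + 1 → (N : ℝ) ≤ 1300000 / δ := by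
    intro N hN
    have h1 : (N : ℝ) ≤ 161280 * 2 ^ (K + 1) + 1 := by exact_mod_cast hN
    have h2 : (2 : ℝ) ^ (K + 1) ≤ 8 / δ := by
      rw [pow_succ]; calc (2 : ℝ) ^ K * 2 ≤ 4 / δ * 2 := by linarith
        _ = _ := by ring
    have h3 : 1 ≤ 1 / δ := by rw [le_div_iff₀ hδ]; linarith
    calc (N : ℝ) ≤ 161280 * (8 / δ) + 1 / δ := by linarith
      _ = 1290241 / δ := by ring
      _ ≤ _ := by gcongr; norm_num
  obtain ⟨a, h1, h2, h3, h4⟩ := exists_algorithm_median (phaseCircuit n r m₁ m₂ (K + 1))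
    (fun x => decode fun τ => x (Sum.inr τ)) hη
  have hcalls := hcost _ (countP_isCall_phaseCircuit_le (n := n) (r := r) (m₁ := m₁) (m₂ := m₂) _)
  refine ⟨a, h1, h2 ▸ hcalls, h3 ▸ hcost _ (countP_not_isCall_phaseCircuit_le _),
    fun D e hD hχ hψ hg => h4 D δ hD.isUnitary ?_⟩
  refine le_sum_filter_of_l2norm_sub_le _ (hD.le_sum_phaseCircuit_ideal hδ hχ hψ hK2.le) ?_
  have hg0 : 0 ≤ e.gateTotal := (norm_nonneg _).trans (hD.norm_op_sub_ideal_le .CLpsi)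
  rw [← sub_mulVec]
  refine (l2norm_mulVec_le _ _).trans ?_
  rw [l2norm_ketZero, mul_one]
  refine (norm_circuitMatrix_sub_le hD.isUnitary hD.ideal_isUnitary hD.norm_op_sub_ideal_le
    _).trans ((mul_le_mul_of_nonneg_right hcalls hg0).trans hg)

end PhaseCircuit

/-! ### Estimation from the frequency of the flags -/

section Frequency

theorem abs_sub_le_of_abs_sq_sub_sq_le {x y c : ℝ} (hx : 0 ≤ x) (hy : 0 ≤ y) (hc : 0 ≤ c)
    (h : |x ^ 2 - y ^ 2| ≤ c ^ 2) : |x - y| ≤ c := by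
  refine abs_le_of_sq_le_sq ?_ hc
  have h1 : |x ^ 2 - y ^ 2| = |x - y| * (x + y) := by
    rw [sq_sub_sq, abs_mul, abs_of_nonneg (add_nonneg hx hy), mul_comm]
  have h2 : |x - y| ≤ x + y := abs_le.mpr ⟨by linarith, by linarith⟩
  rw [← sq_abs]
  nlinarith [abs_nonneg (x - y)]

/-- The square root of the frequency of an event of probability `q ^ 2` is a good estimate of `q`:
a deviation of the frequency by at most `(δ / 2) ^ 2` changes the root by at most `δ / 2`. -/
theorem le_sum_sqrt_frequency {Ω : Type*} [Fintype Ω] {p : Ω → ℝ} (hp0 : ∀ x, 0 ≤ p x)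
    (hp : ∑ x, p x = 1) (E : Ω → Prop) [DecidablePred E] {q t δ η : ℝ} (hq : 0 ≤ q)
    (hE : ∑ x with E x, p x = q ^ 2) (hδ : 0 < δ) (hδ1 : δ < 1) (hη : 0 < η) (hη1 : η < 1)
    (ht : |q - t| ≤ δ / 2) {N : ℕ} (hN : 64 / δ ^ 4 * (1 + Real.log (1 / η)) ≤ N) :
    1 - η ≤ ∑ ω : Fin N → Ω with
      |√((Finset.univ.filter fun i => E (ω i)).card / (N : ℝ)) - t| ≤ δ, ∏ i, p (ω i) := by
  classical
  have hlog : 0 < Real.log (1 / η) := Real.log_pos (by rw [lt_div_iff₀ hη]; linarith)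
  have hN0 : (0 : ℝ) < N := lt_of_lt_of_le (by positivity) hN
  set good : (Fin N → Ω) → Prop := fun ω =>
    |√((Finset.univ.filter fun i => E (ω i)).card / (N : ℝ)) - t| ≤ δ with hgood
  have hsplit := Finset.sum_filter_add_sum_filter_not Finset.univ good fun ω => ∏ i, p (ω i)
  rw [sum_prod_eq_one (p := fun _ : Fin N => p) fun _ => hp] at hsplit
  have hq1 : q ^ 2 ≤ 1 := by
    rw [← hE, ← hp]
    exact Finset.sum_le_sum_of_subset_of_nonneg (Finset.filter_subset _ _) fun x _ _ => hp0 x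
  let f : Bool → Ω → ℝ := fun s x => outcomeSign s * ((if E x then 1 else 0) - q ^ 2)
  have hf : ∀ s x, |f s x| ≤ 1 := by
    intro s x
    have h1 : |outcomeSign s| = 1 := by cases s <;> simp [outcomeSign]
    rw [abs_mul, h1, one_mul, abs_le]
    have := sq_nonneg q
    split_ifs <;> constructor <;> linarith
  have hmean : ∀ s, ∑ x, p x * f s x = 0 := by
    intro s
    have h1 : ∑ x, p x * (if E x then 1 else 0) = q ^ 2 := by
      rw [← hE, Finset.sum_filter]
      exact Finset.sum_congr rfl fun x _ => by split_ifs <;> simp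
    have h2 : ∀ x, p x * f s x = outcomeSign s * (p x * (if E x then 1 else 0) - q ^ 2 * p x) :=
      fun x => by simp only [f]; ring
    simp only [h2]
    rw [← Finset.mul_sum, Finset.sum_sub_distrib, h1, ← Finset.mul_sum, hp, mul_one, sub_self,
      mul_zero]
  have htail : ∀ s, ∑ ω : Fin N → Ω with
      δ ^ 2 / 4 * (Finset.univ : Finset (Fin N)).card ≤ ∑ i, f s (ω i), ∏ i, p (ω i) ≤ η / 2 := by
    intro s
    refine (sum_prod_tail_le (p := fun _ : Fin N => p) (fun _ => hp0) (fun _ => hp)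
      (f := fun _ => f s) (fun _ => hf s) Finset.univ (fun _ _ => hmean s) (by positivity)
      (by nlinarith)).trans ?_
    rw [Finset.card_univ, Fintype.card_fin]
    have h1 : 1 + Real.log (1 / η) ≤ N * ((δ ^ 2 / 4) ^ 2 / 4) := by
      calc 1 + Real.log (1 / η) = 64 / δ ^ 4 * (1 + Real.log (1 / η)) * ((δ ^ 2 / 4) ^ 2 / 4) := by
            field_simp; norm_num
        _ ≤ _ := mul_le_mul_of_nonneg_right hN (by positivity)
    have h2 : Real.log 2 ≤ 1 := by have := Real.log_two_lt_d9; linarith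
    have h3 : Real.log (η / 2) = -Real.log (1 / η) - Real.log 2 := by
      rw [Real.log_div hη.ne' two_ne_zero, one_div, Real.log_inv, neg_neg]
    rw [← Real.le_log_iff_exp_le (by positivity), h3]
    linarith
  have hbad := sum_filter_le_sum_sum_filter (w := fun ω : Fin N → Ω => ∏ i, p (ω i))
    (fun ω => Finset.prod_nonneg fun i _ => hp0 _) (fun ω => ¬ good ω)
    (fun (s : Bool) ω => δ ^ 2 / 4 * (Finset.univ : Finset (Fin N)).card ≤ ∑ i, f s (ω i)) (by
      intro ω hω
      by_contra! hcon
      refine hω ?_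
      set x := ((Finset.univ.filter fun i => E (ω i)).card : ℝ) with hx
      have hsum : ∀ s, ∑ i, f s (ω i) = outcomeSign s * (x - N * q ^ 2) := by
        intro s
        simp only [f]
        rw [← Finset.mul_sum, Finset.sum_sub_distrib, Finset.sum_boole]
        simp [hx]
      have h0 := hcon false
      have h1 := hcon true
      rw [hsum, Finset.card_univ, Fintype.card_fin] at h0 h1
      simp only [outcomeSign, if_true, Bool.false_eq_true, if_false] at h0 h1
      have h2 : |x / N - q ^ 2| ≤ (δ / 2) ^ 2 := by
        have : x / N - q ^ 2 = (x - N * q ^ 2) / N := by field_simp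
        rw [this, abs_div, abs_of_pos hN0, div_le_iff₀ hN0, abs_le]
        constructor <;> linarith
      have hx0 : 0 ≤ x / N := by positivity
      have h3 := abs_sub_le_of_abs_sq_sub_sq_le (Real.sqrt_nonneg (x / N)) hq
        (by positivity : 0 ≤ δ / 2) (by rw [Real.sq_sqrt hx0]; exact h2)
      calc |√(x / N) - t| ≤ |√(x / N) - q| + |q - t| := abs_sub_le _ _ _
        _ ≤ δ := by linarith)
  rw [Fintype.sum_bool] at hbad
  have := htail true
  have := htail false
  linarith

end Frequency

section DirectCircuit
open Matrix
set_option synthInstance.maxSize 1000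
variable {n r m₁ m₂ : ℕ} {D : Instance n r m₁ m₂} {e : Errors}

/-- The circuit that applies the encodings of `|ψ⟩⟨0|` and `Π` once to the zero state, computing
the two flags of each. -/
def directCircuit (n r m₁ m₂ : ℕ) :
    List (WireOp n r m₁ m₂ ((SysWires n r m₁ m₂ ⊕ Fin 2) ⊕ Fin 2)) :=
  List.map (WireOp.map Function.Embedding.inl)
    [.call .CRpsi (withTarget (embPsi n r m₁ m₂) 0),
      .call .Vpsi ((embPsi n r m₁ m₂).trans Function.Embedding.inl),
      .call .CLpsi (withTarget (embPsi n r m₁ m₂) 1)] ++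
  [.call .CRproj (withTarget ((embProj n r m₁ m₂).trans Function.Embedding.inl) 0),
    .call .Vproj (((embProj n r m₁ m₂).trans Function.Embedding.inl).trans
      Function.Embedding.inl),
    .call .CLproj (withTarget ((embProj n r m₁ m₂).trans Function.Embedding.inl) 1)]

/-- The component of a state in which all four flags are set. -/
def flagged (v : QVec ((SysWires n r m₁ m₂ ⊕ Fin 2) ⊕ Fin 2)) : QVec (SysWires n r m₁ m₂) :=
  slice (slice v fun _ => true) fun _ => true

theorem l2norm_slice_le {α β : Type} [Fintype α] [DecidableEq α] [Fintype β] [DecidableEq β]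
    (v : QVec (α ⊕ β)) (b : Bits β) : l2norm (slice v b) ≤ l2norm v := by
  refine (sq_le_sq₀ (l2norm_nonneg _) (l2norm_nonneg _)).mp ?_
  rw [l2norm_sq_eq_sum_slice v]
  exact Finset.single_le_sum (f := fun b => l2norm (slice v b) ^ 2) (fun b _ => sq_nonneg _)
    (Finset.mem_univ b)

theorem sum_flags_eq (v : QVec ((SysWires n r m₁ m₂ ⊕ Fin 2) ⊕ Fin 2)) :
    ∑ x with (fun j => x (Sum.inr j)) = (fun _ => true) ∧
      (fun j => x (Sum.inl (Sum.inr j))) = (fun _ => true), ‖v x‖ ^ 2 = l2norm (flagged v) ^ 2 := by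
  rw [Finset.sum_filter, sum_bits_sum, Finset.sum_eq_single fun _ => true]
  · rw [sum_bits_sum, Finset.sum_eq_single fun _ => true]
    · rw [l2norm_sq]
      exact Finset.sum_congr rfl fun x _ => if_pos ⟨rfl, rfl⟩
    · intro b _ hb
      exact Finset.sum_eq_zero fun x _ => if_neg fun h => hb h.2
    · simp
  · intro b _ hb
    exact Finset.sum_eq_zero fun x _ => if_neg fun h => hb h.1
  · simp

/-- With exact `C_ΠNOT` gates, all flags are set with the product of the encoded operators as
amplitude. -/
theorem flagged_directCircuit (D : Instance n r m₁ m₂) :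
    flagged (circuitMatrix D.ideal (directCircuit n r m₁ m₂) *ᵥ ketZero _) =
      applyOn (embProj n r m₁ m₂) (D.Lproj * D.Vproj * D.Rproj) *ᵥ
        (applyOn (embPsi n r m₁ m₂) (D.Lpsi * D.Vpsi * D.Rpsi) *ᵥ ketZero _) := by
  have h1 : circuitMatrix D.ideal
      [.call .CRpsi (withTarget (embPsi n r m₁ m₂) 0),
        .call .Vpsi ((embPsi n r m₁ m₂).trans Function.Embedding.inl),
        .call .CLpsi (withTarget (embPsi n r m₁ m₂) 1)] =
      flagCircuit (embPsi n r m₁ m₂) D.Lpsi D.Vpsi D.Rpsi := by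
    simp only [circuitMatrix, Matrix.one_mul, Matrix.mul_assoc]; rfl
  have h2 : circuitMatrix D.ideal
      [.call .CRproj (withTarget ((embProj n r m₁ m₂).trans Function.Embedding.inl) 0),
        .call .Vproj (((embProj n r m₁ m₂).trans Function.Embedding.inl).trans
          Function.Embedding.inl),
        .call .CLproj (withTarget ((embProj n r m₁ m₂).trans Function.Embedding.inl) 1)] =
      flagCircuit ((embProj n r m₁ m₂).trans (Function.Embedding.inl (β := Fin 2)))
        D.Lproj D.Vproj D.Rproj := by
    simp only [circuitMatrix, Matrix.one_mul, Matrix.mul_assoc]; rfl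
  rw [directCircuit, circuitMatrix_append, circuitMatrix_map, h1, h2, ← mulVec_mulVec, ketZero_sum,
    applyOn_inl_mulVec_withBits, flagged, slice_flagCircuit, applyOn_trans, slice_applyOn_inl,
    ketZero_sum, slice_flagCircuit]

/-- The amplitude of all flags being set is the target, up to the errors of the six calls and of the
encodings. -/
theorem Instance.Valid.abs_l2norm_flagged_sub_le (h : D.Valid e) :
    |l2norm (flagged (circuitMatrix D (directCircuit n r m₁ m₂) *ᵥ ketZero _)) - D.target| ≤
      6 * e.gateTotal + (e.χproj + e.χpsi) := by
  have hb₁ := h.encpsi.bound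
  have hb₂ := h.encproj.bound
  rw [Complex.ofReal_one, one_smul] at hb₁ hb₂
  set v := circuitMatrix D (directCircuit n r m₁ m₂) *ᵥ ketZero _ with hv
  set w := circuitMatrix D.ideal (directCircuit n r m₁ m₂) *ᵥ ketZero _ with hw
  have h1 : l2norm (v - w) ≤ 6 * e.gateTotal := by
    rw [hv, hw, ← sub_mulVec]
    refine (l2norm_mulVec_le _ _).trans ?_
    rw [l2norm_ketZero, mul_one]
    exact norm_circuitMatrix_sub_le h.isUnitary h.ideal_isUnitary h.norm_op_sub_ideal_le _
  have h2 : |l2norm (flagged v) - l2norm (flagged w)| ≤ 6 * e.gateTotal :=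
    (abs_l2norm_sub_le _ _).trans (((l2norm_slice_le (slice (v - w) fun _ => true) _).trans
      (l2norm_slice_le (v - w) _)).trans h1)
  have hM : ∀ {α : Type} [Fintype α] [DecidableEq α] {L V R : QOp α}, IsStarProjection L →
      IsStarProjection R → V ∈ unitaryGroup (Bits α) ℂ → ‖L * V * R‖ ≤ 1 := by
    intro α _ _ L V R hL hR hV
    have h3 := norm_le_one_of_isStarProjection hL
    have h4 := norm_le_one_of_isStarProjection hR
    have h5 := norm_le_one_of_unitary hV
    calc ‖L * V * R‖ ≤ ‖L‖ * ‖V‖ * ‖R‖ :=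
          (norm_mul_le _ _).trans (mul_le_mul_of_nonneg_right (norm_mul_le _ _) (norm_nonneg _))
      _ ≤ 1 * 1 * 1 := by gcongr
      _ = 1 := by norm_num
  set M₂ := applyOn (embProj n r m₁ m₂) (D.Lproj * D.Vproj * D.Rproj) with hM₂
  set M₁ := applyOn (embPsi n r m₁ m₂) (D.Lpsi * D.Vpsi * D.Rpsi) with hM₁
  set T₂ := applyOn (embProj n r m₁ m₂) (tensor D.P (ketBra (ketZero _) (ketZero _))) with hT₂
  set T₁ := applyOn (embPsi n r m₁ m₂) (preparation D) with hT₁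
  have hT : T₁ *ᵥ ketZero _ = sysState m₁ m₂ D.ψ := by
    rw [hT₁, ketZero_sum (β := Fin m₂), applyOn_inl_mulVec_withBits, preparation,
      ketZero_sum (β := Fin m₁), tensor_ketBra_mulVec_withBits, ketBra_mulVec,
      braket_ketZero_self, one_smul]
    rfl
  have ht : l2norm (T₂ *ᵥ (T₁ *ᵥ ketZero _)) = D.target := by
    rw [hT, hT₂, applyOn_embProj_mulVec_sysState, l2norm_sysState, h.l2norm_proj_psi]
  have h3 : l2norm (M₂ *ᵥ (M₁ *ᵥ ketZero _) - M₂ *ᵥ (T₁ *ᵥ ketZero _)) ≤ e.χpsi := by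
    have h5 : ‖M₂‖ ≤ 1 :=
      (norm_applyOn_le _ _).trans (hM h.encproj.left h.encproj.right h.encproj.unitary)
    have h6 : ‖M₁ - T₁‖ ≤ e.χpsi := by
      rw [norm_sub_rev, hT₁, hM₁, ← applyOn_sub]
      exact (norm_applyOn_le _ _).trans hb₁
    rw [← mulVec_sub, ← sub_mulVec]
    refine (l2norm_mulVec_le _ _).trans ?_
    have h7 := l2norm_mulVec_le (M₁ - T₁) (ketZero (SysWires n r m₁ m₂))
    rw [l2norm_ketZero, mul_one] at h7
    nlinarith [l2norm_nonneg ((M₁ - T₁) *ᵥ ketZero (SysWires n r m₁ m₂)), norm_nonneg M₂]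
  have h4 : l2norm (M₂ *ᵥ (T₁ *ᵥ ketZero _) - T₂ *ᵥ (T₁ *ᵥ ketZero _)) ≤ e.χproj := by
    have h6 : ‖M₂ - T₂‖ ≤ e.χproj := by
      rw [norm_sub_rev, hT₂, hM₂, ← applyOn_sub]
      exact (norm_applyOn_le _ _).trans hb₂
    rw [← sub_mulVec]
    refine (l2norm_mulVec_le _ _).trans ?_
    rwa [hT, l2norm_sysState, h.l2norm_psi, mul_one]
  have h5 : |l2norm (flagged w) - D.target| ≤ e.χproj + e.χpsi := by
    rw [hw, flagged_directCircuit, ← ht]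
    refine (abs_l2norm_sub_le _ _).trans
      ((l2norm_sub_le_sub _ (M₂ *ᵥ (T₁ *ᵥ ketZero _)) _).trans ?_)
    linarith [h3, h4]
  exact (abs_sub_le _ _ _).trans (add_le_add h2 h5)

/-- The algorithm that estimates the probability of all flags being set. -/
theorem exists_algorithm_frequency (n r m₁ m₂ : ℕ) {δ η : ℝ} (hδ : 0 < δ) (hδ1 : δ < 1)
    (hη : 0 < η) (hη1 : η < 1) :
    ∃ a : Algorithm n r m₁ m₂, a.reps = ⌈64 / δ ^ 4 * (1 + Real.log (1 / η))⌉₊ ∧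
      a.calls = 6 ∧ a.gates = 0 ∧
      ∀ (D : Instance n r m₁ m₂) (e : Errors), D.Valid e →
        6 * e.gateTotal + (e.χproj + e.χpsi) ≤ δ / 2 → 1 - η ≤ a.successProb D δ := by
  obtain ⟨a, h1, h2, h3, h4⟩ := exists_algorithm (directCircuit n r m₁ m₂)
    ⌈64 / δ ^ 4 * (1 + Real.log (1 / η))⌉₊ fun ω => √((Finset.univ.filter fun i =>
      (fun j => ω i (Sum.inr j)) = (fun _ => true) ∧
        (fun j => ω i (Sum.inl (Sum.inr j))) = (fun _ => true)).card /
          (⌈64 / δ ^ 4 * (1 + Real.log (1 / η))⌉₊ : ℝ))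
  refine ⟨a, h1, h2, h3, fun D e hD hS => ?_⟩
  rw [h4]
  exact le_sum_sqrt_frequency (fun x => sq_nonneg _) (hD.isUnitary.sum_outcome_eq_one _)
    (fun x => (fun j => x (Sum.inr j)) = (fun _ => true) ∧
      (fun j => x (Sum.inl (Sum.inr j))) = (fun _ => true)) (l2norm_nonneg _) (sum_flags_eq _)
    hδ hδ1 hη hη1 (hD.abs_l2norm_flagged_sub_le.trans hS) (Nat.le_ceil _)

end DirectCircuit

/-! ### Error parameters -/

section Parameters
variable {e : Errors} {δ η εf : ℝ}

/-- The sum of the error bounds under the square root in `ε`. -/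
noncomputable def Errors.total (e : Errors) : ℝ := 2 * e.χpsi + e.χproj + e.gateTotal

theorem Errors.Nonneg.gateTotal (h : e.Nonneg) : 0 ≤ e.gateTotal := by
  have := h.εLpsi; have := h.εRpsi; have := h.εLproj; have := h.εRproj
  rw [Errors.gateTotal]; linarith

theorem two_sub_le_log_inv {x : ℝ} (hx : 0 < x) : 2 - 4 * x ≤ Real.log (1 / x) := by
  have h1 := Real.log_le_sub_one_of_pos (x := 4 * x) (by positivity)
  have h2 : Real.log (4 * x) = 2 * Real.log 2 + Real.log x := by
    rw [Real.log_mul (by norm_num) hx.ne', show (4 : ℝ) = 2 ^ 2 by norm_num, Real.log_pow]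
    push_cast; ring
  have h3 := Real.log_two_gt_d9
  rw [one_div, Real.log_inv]
  linarith

/-- If `ε < 1/2`, then all errors are small compared to `δ ^ 2`, whatever `ε_f` is. -/
theorem Errors.sqrt_total_le (hδ : 0 < δ) (hεf : 0 < εf) (hεf1 : εf < 1)
    (h : e.eps δ εf < 1 / 2) : √e.total ≤ δ / 16 ∧ 1 / 2 ≤ Real.log (1 / εf) := by
  have h0 : e.eps δ εf = 4 / δ * Real.log (1 / εf) * √e.total + εf := rfl
  have h1 := two_sub_le_log_inv hεf
  have hlog : 0 < Real.log (1 / εf) := Real.log_pos (by rw [lt_div_iff₀ hεf]; linarith)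
  have hs : 0 ≤ 4 / δ * √e.total := by positivity
  rw [h0] at h
  have hhalf : εf < 1 / 2 := by nlinarith
  refine ⟨?_, ?_⟩
  · -- `(4 √S / δ) (2 - 4 ε_f) ≤ (4 √S / δ) log (1/ε_f) < (2 - 4 ε_f) / 4`
    have h2 : 4 / δ * √e.total ≤ 1 / 4 := by nlinarith
    rw [div_mul_eq_mul_div, div_le_iff₀ hδ] at h2
    linarith
  · have h2 : Real.log 2 ≤ Real.log (1 / εf) :=
      Real.log_le_log (by norm_num) (by rw [le_div_iff₀ hεf]; linarith)
    have h3 := Real.log_two_gt_d9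
    linarith

theorem Errors.Nonneg.one_add_log_le_repScale (h : e.Nonneg) (hδ : 0 < δ) (hδ1 : δ < 1)
    (hη : 0 < η) (hη1 : η < 1) (hεf : 0 < εf) (hεf1 : εf < 1) (hχ : e.χpsi ≤ 1 / 2)
    (heps : e.eps δ εf < 1 / 2) : 1 + Real.log (1 / η) ≤ e.repScale δ η εf := by
  have hl₁ : 0 ≤ Real.log (1 / δ) := Real.log_nonneg (by rw [le_div_iff₀ hδ]; linarith)
  have hl₂ : 0 ≤ Real.log (1 / η) := Real.log_nonneg (by rw [le_div_iff₀ hη]; linarith)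
  have hl₃ : 0 ≤ Real.log (1 / εf) := Real.log_nonneg (by rw [le_div_iff₀ hεf]; linarith)
  have heps0 : 0 ≤ e.eps δ εf := by rw [Errors.eps]; positivity
  have hχ0 := h.χpsi
  have h1 : 0 < 1 - e.χpsi := by linarith
  have h2 : 0 < 1 - 2 * e.eps δ εf := by linarith
  rw [Errors.repScale, le_div_iff₀ (by positivity)]
  have h3 : (1 - e.χpsi) ^ 2 ≤ 1 := by nlinarith
  have h4 : (1 - 2 * e.eps δ εf) ^ 2 ≤ 1 := by nlinarith
  have h5 : (1 - e.χpsi) ^ 2 * (1 - 2 * e.eps δ εf) ^ 2 ≤ 1 :=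
    mul_le_one₀ h3 (sq_nonneg _) h4
  nlinarith [mul_nonneg hl₁ (add_nonneg zero_le_one hl₂)]

theorem Errors.Nonneg.total_le (h : e.Nonneg) (hδ : 0 < δ) (hs : √e.total ≤ δ / 16) :
    e.total ≤ δ ^ 2 / 256 := by
  have h0 : 0 ≤ e.total := by
    have := h.χpsi; have := h.χproj; have := h.gateTotal; rw [Errors.total]; linarith
  rw [← Real.sq_sqrt h0]
  nlinarith [Real.sqrt_nonneg e.total]

theorem Errors.Nonneg.reflectionError_add_le (h : e.Nonneg) (hδ : 0 < δ) (hδ1 : δ < 1)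
    (hs : √e.total ≤ δ / 16) : reflectionError e.χpsi + reflectionError e.χproj ≤ δ / 4 := by
  have hψ := h.χpsi
  have hπ := h.χproj
  have hg := h.gateTotal
  have ha := Real.sq_sqrt (show 0 ≤ 2 * e.χpsi by linarith)
  have hb := Real.sq_sqrt (show 0 ≤ 2 * e.χproj by linarith)
  have ha0 := Real.sqrt_nonneg (2 * e.χpsi)
  have hb0 := Real.sqrt_nonneg (2 * e.χproj)
  have htot := h.total_le hδ hs
  have htot' : e.total = 2 * e.χpsi + e.χproj + e.gateTotal := rfl
  rw [reflectionError, reflectionError]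
  set a := √(2 * e.χpsi)
  set b := √(2 * e.χproj)
  -- Cauchy-Schwarz: `(a + b) ^ 2 ≤ 3 (a ^ 2 + b ^ 2 / 2) ≤ 3 S`
  have hab : (a + b) ^ 2 ≤ 3 * (δ ^ 2 / 256) := by nlinarith [sq_nonneg (2 * a - b)]
  have hab' : a + b ≤ δ * (7 / 64) := by
    refine (sq_le_sq₀ (by positivity) (by positivity)).mp (hab.trans ?_)
    nlinarith [sq_nonneg δ]
  nlinarith

end Parameters

end RankEst

/-! ### Choice of the algorithm -/

theorem theorem2 :
    ∃ (C : ℝ) (k : ℕ), 0 < C ∧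
      -- exact ingredients
      (∀ (n r m₁ m₂ : ℕ) (δ η : ℝ), 0 < δ → δ < 1 → 0 < η → η < 1 →
        ∃ a : RankEst.Algorithm n r m₁ m₂,
          (a.reps : ℝ) ≤ C * (1 + Real.log (1 / η)) ∧
          (a.calls : ℝ) ≤ C * (1 / δ) ∧
          (a.gates : ℝ) ≤ C * (1 / δ) * (1 + Real.log (1 / δ)) ^ k ∧
          ∀ D : RankEst.Instance n r m₁ m₂, D.Valid RankEst.Errors.zero →
            1 - η ≤ a.successProb D δ) ∧
      -- faulty ingredients
      (∀ (n r m₁ m₂ : ℕ) (δ η εf : ℝ) (e : RankEst.Errors), 0 < δ → δ < 1 → 0 < η → η < 1 →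
        0 < εf → εf < 1 → e.Nonneg → e.eps δ εf < 1 / 2 →
        ∃ a : RankEst.Algorithm n r m₁ m₂,
          (a.reps : ℝ) ≤
            C * e.repScale δ η εf * (1 + Real.log (e.repScale δ η εf)) ^ k ∧
          (a.calls : ℝ) ≤ C * (1 / δ * Real.log (1 / εf)) ∧
          (a.gates : ℝ) ≤ C * (1 / δ * Real.log (1 / εf)) ∧
          ∀ D : RankEst.Instance n r m₁ m₂, D.Valid e →
            1 - η ≤ a.successProb D δ) := by
  have hceil : ∀ c x : ℝ, 0 ≤ c → 0 ≤ x → (⌈c * (1 + x)⌉₊ : ℝ) ≤ (c + 1) * (1 + x) := by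
    intro c x hc hx
    have h1 := (Nat.ceil_lt_add_one (show 0 ≤ c * (1 + x) by positivity)).le
    linarith
  have hlog : ∀ x : ℝ, 0 < x → x < 1 → 0 ≤ Real.log (1 / x) := fun x h0 h1 =>
    Real.log_nonneg (by rw [le_div_iff₀ h0]; linarith)
  have hwalk : ∀ x : ℝ, 0 ≤ x → (⌈64 * x⌉₊ : ℝ) ≤ 10 ^ 24 * (1 + x) := by
    intro x hx
    have h1 := (Nat.ceil_lt_add_one (show 0 ≤ 64 * x by positivity)).le
    linarith
  -- no logarithmic factors are needed;
  -- the constant is dominated by `64 / δ ^ 4` at `δ = 1 / 200000`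
  refine ⟨10 ^ 24, 0, by norm_num, fun n r m₁ m₂ δ η hδ hδ1 hη hη1 => ?_,
    fun n r m₁ m₂ δ η εf e hδ hδ1 hη hη1 hεf hεf1 he heps => ?_⟩
  · have hcost : 1300000 / δ ≤ 10 ^ 24 * (1 / δ) := by
      rw [mul_one_div]; gcongr; norm_num
    obtain ⟨a, h1, h2, h3, h4⟩ := RankEst.exists_algorithm_phaseEstimation n r m₁ m₂ hδ hδ1 hη
    refine ⟨a, ?_, h2.trans hcost, ?_, fun D hD => h4 D _ hD ?_ ?_ ?_⟩
    · rw [h1]; exact hwalk _ (hlog η hη hη1)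
    · rw [pow_zero, mul_one]; exact h3.trans hcost
    · simp only [RankEst.Errors.zero, RankEst.reflectionError, mul_zero, Real.sqrt_zero, add_zero]
      positivity
    · simp only [RankEst.Errors.zero]; norm_num
    · simp only [RankEst.Errors.zero, RankEst.Errors.gateTotal]; norm_num
  · obtain ⟨hs, hL⟩ := RankEst.Errors.sqrt_total_le hδ hεf hεf1 heps
    have htot := he.total_le hδ hs
    have htot' : e.total = 2 * e.χpsi + e.χproj + e.gateTotal := rfl
    have hψ := he.χpsi
    have hπ := he.χproj
    have hg := he.gateTotal
    have hη0 := hlog η hη hη1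
    have hδδ : δ ^ 2 ≤ δ := by nlinarith
    have hX := he.one_add_log_le_repScale hδ hδ1 hη hη1 hεf hεf1 (by linarith) heps
    have hcost : 1300000 / δ ≤ 10 ^ 24 * (1 / δ * Real.log (1 / εf)) := by
      have h1 : 1 / δ * (1 / 2) ≤ 1 / δ * Real.log (1 / εf) := by gcongr
      have h2 : 0 < 1 / δ := by positivity
      have h3 : 1300000 / δ = 1300000 * (1 / δ) := by ring
      rw [h3]; linarith
    have hreps : ∀ N : ℕ, (N : ℝ) ≤ 10 ^ 24 * (1 + Real.log (1 / η)) →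
        (N : ℝ) ≤ 10 ^ 24 * e.repScale δ η εf * (1 + Real.log (e.repScale δ η εf)) ^ 0 := by
      intro N hN
      rw [pow_zero, mul_one]
      exact hN.trans (by gcongr)
    rcases lt_or_ge δ (1 / 200000) with hsmall | hlarge
    · -- the gate errors are at most `δ ^ 2 / 256`, so they perturb the final state of `1300000 / δ`
      -- calls by at most `1 / 20` if `δ` is small
      obtain ⟨a, h1, h2, h3, h4⟩ := RankEst.exists_algorithm_phaseEstimation n r m₁ m₂ hδ hδ1 hη
      refine ⟨a, hreps _ ?_, h2.trans hcost, h3.trans hcost, fun D hD => h4 D e hD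
        (he.reflectionError_add_le hδ hδ1 hs) (by nlinarith) ?_⟩
      · rw [h1]; exact hwalk _ hη0
      · have h5 : e.gateTotal ≤ δ ^ 2 / 256 := by linarith
        calc 1300000 / δ * e.gateTotal ≤ 1300000 / δ * (δ ^ 2 / 256) := by gcongr
          _ = 1300000 / 256 * δ := by field_simp
          _ ≤ 1 / 20 := by linarith
    · obtain ⟨a, h1, h2, h3, h4⟩ :=
        RankEst.exists_algorithm_frequency n r m₁ m₂ hδ hδ1 hη hη1
      have h6 : (6 : ℝ) ≤ 1300000 / δ := by rw [le_div_iff₀ hδ]; linarith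
      refine ⟨a, hreps _ ?_, ?_, ?_, fun D hD => h4 D e hD (by linarith)⟩
      · rw [h1]
        refine (hceil _ _ (by positivity) hη0).trans ?_
        have h5 : 64 / δ ^ 4 ≤ 64 / (1 / 200000) ^ 4 := by gcongr
        gcongr
        refine (add_le_add_left h5 1).trans ?_
        norm_num
      · rw [h2]; exact le_trans (by exact_mod_cast h6) hcost
      · rw [h3]; exact le_trans (by simpa using (le_trans (by norm_num) h6)) hcost
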